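/- Let $\mathfrak A$ be a commutative Hausdorff topological ring with unit whose topology is induced by a family $(p_i)_{i\in I}$ of functions $p_i:\mathfrak A\to[0,\infty)$ with $p_i(0)=0$, $p_i(-x)=p_i(x)$, $p_i(x+y)\le p_i(x)+p_i(y)$, such that for every $i$ there is $j$ with $p_i(x_1\cdots x_n)\le p_j(x_1)\cdots p_j(x_n)$ for all $n\ge 1$ and all $x_1,\dots,x_n\in\mathfrak A$. Assume that every Cauchy sequence in $\mathfrak A$ converges. Let $\mathfrak A[z^{-1},z]$ be the ring of Laurent series $a(z)=\sum_{n\in\mathbb Z}a_nz^n$ with $\sup_n(1+|n|)^kp_i(a_n)<\infty$ for all $i\in I$, $k\in\mathbb N$, topologized by these suprema, with product $(ab)_n=\sum_m a_mb_{n-m}$. Let $G$ be its unit group, with the topology induced by $a\mapsto(a,a^{-1})$. Put * $G^+=\{a\in G: \text{both } c=a \text{ and } c=a^{-1} \text{ satisfy } c_0=1,\ c_n=0\ (n<0)\}$ (strictly holomorphic series), * $G^-=\{a\in G: \text{both } c=a \text{ and } c=a^{-1} \text{ satisfy } c_0=1,\ c_n=0\ (n>0)\}$ (strictly antiholomorphic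 series), * $\tilde G=\{a\in G: a_na_m=0 \text{ for all } n\ne m\}$ (orthogonal series). For an infinite matrix $W$ indexed by $\mathbb Z$ with entries in a commutative topological ring, $\det W=\sum_\sigma \operatorname{sgn}(\sigma)\prod_{n\in\mathbb Z}W_{n,\sigma(n)}$, where $\sigma$ runs over the permutations of $\mathbb Z$ moving only finitely many elements (the determinant exists if all these products and the sum converge unconditionally). Let $\mathbf e_{n,m}$ be the matrix units, and let $w$ be a second Laurent variable. For $a\in G$ let $\mathsf U(a)=\sum_{n,m}a_{n-m}\mathbf e_{n,m}$; it has inverse $\mathsf U(a^{-1})$. Let $\widetilde{\mathsf U}(a,w)$ be the $\mathbb Z\times\mathbb Z$ matrix over $\mathfrak A[w^{-1},w]$ whose $0$th row and column are those of the identity, and whose entry at $(n,m)$, $n,m\neq0$, is $a_{n-m}$ if $nm>0$, $-w\,a_{n-m+1}$ if $n<0<m$, and $-w^{-1}a_{n-m-1}$ if $m<0<n$; it has inverse $\widetilde{\mathsf U}(a^{-1},w)$. With a formal power series variable $t$ let $$\mathsf F^{+}(t,w)=\mathbf 1-tw\sum_{n<0}\mathbf e_{n,n+1},\qquad \mathsf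 F^{-}(t,w)=\mathbf 1-tw^{-1}\sum_{n>0}\mathbf e_{n,n-1},$$ and let $\mathsf U^{\pm}(a,1,w)$ be the matrix over $\mathfrak A[w^{-1},w]$ obtained from $\mathsf F^{\pm}(t,w)\,\mathsf U(a)\,\mathsf F^{\pm}(t,w)^{-1}$ by setting $t=1$. Then $G^-,\tilde G,G^+$ are subgroups of $G$, and $G$ is their inner direct product as a topological group: the map $G^-\times\tilde G\times G^+\to G$, $(x,y,z)\mapsto xyz$, is an isomorphism of groups and a homeomorphism. For every $a\in G$ all the matrix products, inverses, substitutions $t=1$ and determinants below exist, and the components of $a$ in $G^-$, $\tilde G$, $G^+$ are, after replacing $w$ by $z$, respectively $$\det\bigl(\mathsf U^{-}(a,1,w)\,\mathsf U(a)^{-1}\bigr),\qquad \det\bigl(\mathsf U(a)\,\widetilde{\mathsf U}(a,w)^{-1}\bigr),\qquad \det\bigl(\mathsf U^{+}(a,1,w)\,\mathsf U(a)^{-1}\bigr).$$ -/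

import Mathlib

open Filter Topology
open scoped PowerSeries.WithPiTopology

noncomputable section

namespace Polymetric

universe u v

section Basic

/-- The topology on an additive group induced by a family of group seminorms. -/
abbrev seminormTopology {E : Type u} [AddCommGroup E] {κ : Type v} (q : κ → AddGroupSeminorm E) :
    TopologicalSpace E :=
  ⨅ k, (q k).toSeminormedAddCommGroup.toUniformSpace.toTopologicalSpace

/-- The family `p` of seminorms makes the topological ring `A` into a strong polymetric ring: `p`
induces the topology, and each `p i` is dominated on products of arbitrary length `≥ 1` by the
product of the values of one other seminorm of the family. (An `AddGroupSeminorm` is exactly a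
function with `p 0 = 0`, `p (-x) = p x`, `p (x + y) ≤ p x + p y`.) -/
class StrongPolymetric {A : Type u} [CommRing A] [TopologicalSpace A] {ι : Type v}
    (p : ι → AddGroupSeminorm A) : Prop where
  topology_eq : ‹TopologicalSpace A› = seminormTopology p
  prod_le : ∀ i, ∃ j, ∀ l : List A, l ≠ [] → p i l.prod ≤ (l.map (p j)).prod

/-- Sequential completeness of a topological additive group: every Cauchy sequence converges. -/
class SeqComplete (A : Type u) [AddCommGroup A] [TopologicalSpace A] : Prop where
  exists_lim : ∀ x : ℕ → A,
    (∀ U ∈ 𝓝 (0 : A), ∃ N, ∀ m ≥ N, ∀ n ≥ N, x m - x n ∈ U) → ∃ a, Tendsto x atTop (𝓝 a)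

variable {A : Type u} [CommRing A] [TopologicalSpace A] {ι : Type v}

theorem nhds_eq (p : ι → AddGroupSeminorm A) [hp : StrongPolymetric p] (a : A) :
    𝓝 a = ⨅ i, comap (fun x => p i (x - a)) (𝓝 0) := by
  have h := hp.topology_eq
  subst h
  rw [seminormTopology, nhds_iInf]
  congr 1
  funext i
  let := (p i).toSeminormedAddCommGroup
  have := (nhds_comap_dist a)
  rw [← this]
  congr 1
  funext x
  rw [dist_eq_norm]
  rfl

theorem tendsto_iff (p : ι → AddGroupSeminorm A) [StrongPolymetric p] {β : Type*} {f : β → A}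
    {F : Filter β} {a : A} :
    Tendsto f F (𝓝 a) ↔ ∀ i, Tendsto (fun b => p i (f b - a)) F (𝓝 0) := by
  rw [nhds_eq p, tendsto_iInf]
  simp only [tendsto_comap_iff]
  rfl

theorem summable_nat (p : ι → AddGroupSeminorm A) [StrongPolymetric p] [SeqComplete A]
    {f : ℕ → A} (hf : ∀ i, Summable fun b => p i (f b)) : Summable f := by
  have key : ∀ i, ∀ ε > 0, ∃ N, ∀ s : Finset ℕ, (∀ b ∈ s, N ≤ b) → p i (∑ b ∈ s, f b) < ε := by
    intro i ε hε
    obtain ⟨s, hs⟩ := summable_iff_vanishing_norm.1 (hf i) ε hε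
    refine ⟨s.sup id + 1, fun t ht => lt_of_le_of_lt ?_ (hs t ?_)⟩
    · refine le_trans ?_ (le_abs_self _)
      exact Finset.le_sum_of_subadditive _ (map_zero _).le (fun a b => map_add_le_add _ a b) _ _
    · rw [Finset.disjoint_left]
      intro b hb hbs
      have h1 := ht b hb
      have h2 : b ≤ s.sup id := Finset.le_sup (f := id) hbs
      omega
  have diff : ∀ i, ∀ ε > 0, ∃ N, ∀ s t : Finset ℕ, Finset.range N ⊆ s → Finset.range N ⊆ t →
      p i (∑ b ∈ s, f b - ∑ b ∈ t, f b) < ε := by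
    intro i ε hε
    obtain ⟨N, hN⟩ := key i (ε / 2) (by positivity)
    refine ⟨N, fun s t hs ht => ?_⟩
    have e : ∑ b ∈ s, f b - ∑ b ∈ t, f b
        = ∑ b ∈ s \ Finset.range N, f b - ∑ b ∈ t \ Finset.range N, f b := by
      rw [← Finset.sum_sdiff hs, ← Finset.sum_sdiff ht]; abel
    rw [e]
    have h1 := hN (s \ Finset.range N) (by simp)
    have h2 := hN (t \ Finset.range N) (by simp)
    have h3 := map_sub_le_add (p i) (∑ b ∈ s \ Finset.range N, f b) (∑ b ∈ t \ Finset.range N, f b)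
    linarith
  obtain ⟨a, ha⟩ := SeqComplete.exists_lim (fun n => ∑ b ∈ Finset.range n, f b) (by
    intro U hU
    have : ∀ᶠ mn in (atTop : Filter ℕ) ×ˢ atTop,
        ∑ b ∈ Finset.range mn.1, f b - ∑ b ∈ Finset.range mn.2, f b ∈ U := by
      have ht : Tendsto (fun mn : ℕ × ℕ =>
          ∑ b ∈ Finset.range mn.1, f b - ∑ b ∈ Finset.range mn.2, f b) (atTop ×ˢ atTop) (𝓝 0) := by
        rw [tendsto_iff p]
        intro i
        rw [Metric.tendsto_nhds]
        intro ε hε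
        obtain ⟨N, hN⟩ := diff i ε hε
        rw [prod_atTop_atTop_eq, eventually_atTop]
        refine ⟨(N, N), fun mn hmn => ?_⟩
        rw [Real.dist_0_eq_abs, abs_of_nonneg (apply_nonneg _ _), sub_zero]
        exact hN _ _ (Finset.range_subset_range.2 hmn.1) (Finset.range_subset_range.2 hmn.2)
      exact ht hU
    rw [prod_atTop_atTop_eq, eventually_atTop] at this
    obtain ⟨⟨N1, N2⟩, h⟩ := this
    exact ⟨max N1 N2, fun m hm n hn =>
      h (m, n) ⟨le_trans (le_max_left _ _) hm, le_trans (le_max_right _ _) hn⟩⟩)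
  refine ⟨a, ?_⟩
  rw [HasSum, SummationFilter.unconditional_filter, tendsto_iff p]
  intro i
  rw [Metric.tendsto_nhds]
  intro ε hε
  obtain ⟨N, hN⟩ := diff i (ε / 2) (by positivity)
  have h2 := Metric.tendsto_nhds.1 ((tendsto_iff p).1 ha i) (ε / 2) (by positivity)
  obtain ⟨M, hM⟩ := eventually_atTop.1 h2
  rw [eventually_atTop]
  refine ⟨Finset.range N, fun s hs => ?_⟩
  have h3 := hM (max N M) (le_max_right _ _)
  have h4 := hN s (Finset.range (max N M)) hs (Finset.range_subset_range.2 (le_max_left _ _))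
  rw [Real.dist_0_eq_abs, abs_of_nonneg (apply_nonneg _ _)] at h3 ⊢
  have h5 := map_add_le_add (p i) (∑ b ∈ s, f b - ∑ b ∈ Finset.range (max N M), f b)
    (∑ b ∈ Finset.range (max N M), f b - a)
  rw [sub_add_sub_cancel] at h5
  linarith

theorem summable_of_seminorm (p : ι → AddGroupSeminorm A) [StrongPolymetric p] [SeqComplete A]
    {β : Type*} [Countable β] {f : β → A} (hf : ∀ i, Summable fun b => p i (f b)) :
    Summable f := by
  obtain ⟨e, he⟩ := exists_injective_nat β
  have h0 : ∀ n ∉ Set.range e, Function.extend e f 0 n = 0 := fun n hn => by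
    rw [Function.extend_apply' _ _ _ (by simpa using hn)]; rfl
  have : Summable (Function.extend e f 0) := by
    refine summable_nat p fun i => ?_
    rw [← he.summable_iff]
    · convert hf i using 2 with b
      simp [he.extend_apply]
    · intro n hn
      rw [h0 n hn, map_zero]
  rw [← he.summable_iff h0] at this
  convert this using 1
  funext b
  simp [he.extend_apply]

theorem seminorm_tsum_le (p : ι → AddGroupSeminorm A) [StrongPolymetric p] [SeqComplete A]
    {β : Type*} [Countable β] {f : β → A} (hf : ∀ i, Summable fun b => p i (f b)) (i : ι) :
    p i (∑' b, f b) ≤ ∑' b, p i (f b) := by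
  have hs := (summable_of_seminorm p hf).hasSum
  rw [HasSum, SummationFilter.unconditional_filter, tendsto_iff p] at hs
  have h := hs i
  have h2 : Tendsto (fun s : Finset β => ∑ b ∈ s, p i (f b) + p i (∑ b ∈ s, f b - ∑' b, f b)) atTop
      (𝓝 (∑' b, p i (f b) + 0)) := by
    have h3 := (hf i).hasSum
    rw [HasSum, SummationFilter.unconditional_filter] at h3
    exact h3.add h
  rw [add_zero] at h2
  refine ge_of_tendsto' h2 fun s => ?_
  have h4 := map_sub_le_add (p i) (∑ b ∈ s, f b) (∑ b ∈ s, f b - ∑' b, f b)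
  rw [sub_sub_cancel] at h4
  have h5 : p i (∑ b ∈ s, f b) ≤ ∑ b ∈ s, p i (f b) :=
    Finset.le_sum_of_subadditive _ (map_zero _).le (fun a b => map_add_le_add _ a b) _ _
  linarith

theorem exists_mul_le (p : ι → AddGroupSeminorm A) [hp : StrongPolymetric p] (i : ι) :
    ∃ j, (∀ x y, p i (x * y) ≤ p j x * p j y) ∧
      ∀ x y z, p i (x * y * z) ≤ p j x * p j y * p j z := by
  obtain ⟨j, hj⟩ := hp.prod_le i
  refine ⟨j, fun x y => ?_, fun x y z => ?_⟩
  · simpa using hj [x, y] (by simp)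
  · simpa [mul_assoc] using hj [x, y, z] (by simp)

end Basic

section Laurent

/-- The set `𝔄[z⁻¹, z]` of Laurent series with rapidly decreasing coefficients. -/
@[ext]
structure RapidLaurent {A : Type u} [CommRing A] {ι : Type v} (p : ι → AddGroupSeminorm A) where
  /-- the coefficients `a_n`, `n ∈ ℤ` -/
  coeff : ℤ → A
  rapid : ∀ (i : ι) (k : ℕ), ∃ C : ℝ, ∀ n : ℤ, (1 + |(n : ℝ)|) ^ k * p i (coeff n) ≤ C

namespace RapidLaurent

variable {A : Type u} [CommRing A] {ι : Type v} {p : ι → AddGroupSeminorm A}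

theorem summable_weight (a : RapidLaurent p) (i : ι) (k : ℕ) :
    Summable fun n : ℤ => (1 + |(n : ℝ)|) ^ k * p i (a.coeff n) := by
  obtain ⟨C, hC⟩ := a.rapid i (k + 2)
  have hs : Summable fun n : ℤ => (C / (n : ℝ) ^ 2 + if n = 0 then C else 0) := by
    refine Summable.add ?_ (summable_of_hasFiniteSupport ?_)
    · simpa [div_eq_mul_inv] using ((Real.summable_one_div_int_pow (p := 2)).2 (by norm_num)).mul_left C
    · refine (Set.finite_singleton (0 : ℤ)).subset fun n hn => ?_
      by_contra h
      simp at h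
      simp [h] at hn
  refine Summable.of_nonneg_of_le (fun n => by have := apply_nonneg (p i) (a.coeff n); positivity)
    (fun n => ?_) hs
  have h := hC n
  have hp := apply_nonneg (p i) (a.coeff n)
  by_cases hn : n = 0
  · subst hn; simpa using h
  · have hn' : (0 : ℝ) < (n : ℝ) ^ 2 := by positivity
    simp only [hn, if_false, add_zero]
    rw [le_div_iff₀ hn']
    refine le_trans ?_ h
    have : (n : ℝ) ^ 2 ≤ (1 + |(n : ℝ)|) ^ 2 := by
      rw [← sq_abs (n : ℝ)]; gcongr; linarith
    calc (1 + |(n : ℝ)|) ^ k * p i (a.coeff n) * (n : ℝ) ^ 2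
        ≤ (1 + |(n : ℝ)|) ^ k * p i (a.coeff n) * (1 + |(n : ℝ)|) ^ 2 := by gcongr
      _ = (1 + |(n : ℝ)|) ^ (k + 2) * p i (a.coeff n) := by ring

theorem summable_seminorm (a : RapidLaurent p) (i : ι) : Summable fun n : ℤ => p i (a.coeff n) := by
  simpa using a.summable_weight i 0

theorem bound (a : RapidLaurent p) (i : ι) : ∃ C : ℝ, 0 ≤ C ∧ ∀ n, p i (a.coeff n) ≤ C := by
  obtain ⟨C, hC⟩ := a.rapid i 0
  have h : ∀ n, p i (a.coeff n) ≤ C := fun n => by simpa using hC n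
  exact ⟨C, (apply_nonneg _ _).trans (h 0), h⟩

instance : Zero (RapidLaurent p) := ⟨⟨fun _ => 0, fun _ _ => ⟨0, fun _ => by simp⟩⟩⟩

instance : Add (RapidLaurent p) := ⟨fun a b => ⟨fun n => a.coeff n + b.coeff n, fun i k => by
  obtain ⟨C, hC⟩ := a.rapid i k
  obtain ⟨D, hD⟩ := b.rapid i k
  refine ⟨C + D, fun n => ?_⟩
  refine le_trans ?_ (add_le_add (hC n) (hD n))
  rw [← mul_add]
  gcongr
  exact map_add_le_add _ _ _⟩⟩

instance : Neg (RapidLaurent p) := ⟨fun a => ⟨fun n => - a.coeff n, fun i k => by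
  obtain ⟨C, hC⟩ := a.rapid i k
  exact ⟨C, fun n => by simpa [map_neg_eq_map] using hC n⟩⟩⟩

/-- The monomial `x zᵏ`. -/
def monomial (k : ℤ) (x : A) : RapidLaurent p :=
  ⟨fun n => if n = k then x else 0, fun i r => ⟨(1 + |(k : ℝ)|) ^ r * p i x, fun n => by
    by_cases h : n = k
    · simp [h]
    · have := apply_nonneg (p i) x
      simp only [h, if_false, map_zero, mul_zero]
      positivity⟩⟩

instance : One (RapidLaurent p) := ⟨monomial 0 1⟩

@[simp] theorem coeff_zero (n : ℤ) : (0 : RapidLaurent p).coeff n = 0 := rfl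
@[simp] theorem coeff_add (a b : RapidLaurent p) (n : ℤ) :
    (a + b).coeff n = a.coeff n + b.coeff n := rfl
@[simp] theorem coeff_neg (a : RapidLaurent p) (n : ℤ) : (-a).coeff n = - a.coeff n := rfl
theorem coeff_one (n : ℤ) : (1 : RapidLaurent p).coeff n = if n = 0 then 1 else 0 := rfl

instance : AddCommGroup (RapidLaurent p) where
  add_assoc a b c := by ext n; simp [add_assoc]
  zero_add a := by ext n; simp
  add_zero a := by ext n; simp
  add_comm a b := by ext n; simp [add_comm]
  neg_add_cancel a := by ext n; simp
  nsmul := nsmulRec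
  zsmul := zsmulRec

/-- The seminorms `a ↦ sup_n (1 + |n|)ᵏ p_i(a_n)` on the Laurent series. -/
def seminorm (p : ι → AddGroupSeminorm A) (ik : ι × ℕ) : AddGroupSeminorm (RapidLaurent p) where
  toFun a := ⨆ n : ℤ, (1 + |(n : ℝ)|) ^ ik.2 * p ik.1 (a.coeff n)
  map_zero' := by simp
  add_le' a b := by
    have hb : ∀ c : RapidLaurent p,
        BddAbove (Set.range fun n : ℤ => (1 + |(n : ℝ)|) ^ ik.2 * p ik.1 (c.coeff n)) := fun c => by
      obtain ⟨C, hC⟩ := c.rapid ik.1 ik.2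
      exact ⟨C, by rintro _ ⟨n, rfl⟩; exact hC n⟩
    refine ciSup_le fun n => ?_
    refine le_trans ?_ (add_le_add (le_ciSup (hb a) n) (le_ciSup (hb b) n))
    rw [← mul_add]
    gcongr
    exact map_add_le_add _ _ _
  neg' a := by simp [map_neg_eq_map]

/-- The usual topology of the space of rapidly decreasing Laurent series. -/
instance : TopologicalSpace (RapidLaurent p) := seminormTopology (seminorm p)

variable [TopologicalSpace A] [StrongPolymetric p] [SeqComplete A]

theorem summable_conv_seminorm (a b : RapidLaurent p) (n : ℤ) (i : ι) :
    Summable fun m : ℤ => p i (a.coeff m * b.coeff (n - m)) := by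
  obtain ⟨j, hj, -⟩ := exists_mul_le p i
  obtain ⟨C, hC0, hC⟩ := b.bound j
  refine Summable.of_nonneg_of_le (fun m => apply_nonneg _ _) (fun m => ?_)
    ((a.summable_seminorm j).mul_right C)
  exact (hj _ _).trans (mul_le_mul_of_nonneg_left (hC _) (apply_nonneg _ _))

theorem summable_conv (a b : RapidLaurent p) (n : ℤ) :
    Summable fun m : ℤ => a.coeff m * b.coeff (n - m) :=
  summable_of_seminorm p (a.summable_conv_seminorm b n)

/-- The product of Laurent series: `(a b)_n = ∑_m a_m b_{n-m}`. -/
instance : Mul (RapidLaurent p) := ⟨fun a b =>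
  ⟨fun n => ∑' m : ℤ, a.coeff m * b.coeff (n - m), fun i k => by
    obtain ⟨j, hj, -⟩ := exists_mul_le p i
    obtain ⟨C, hC⟩ := b.rapid j k
    refine ⟨∑' m : ℤ, (1 + |(m : ℝ)|) ^ k * p j (a.coeff m) * C, fun n => ?_⟩
    have h1 := seminorm_tsum_le p (a.summable_conv_seminorm b n) i
    calc (1 + |(n : ℝ)|) ^ k * p i (∑' m : ℤ, a.coeff m * b.coeff (n - m))
        ≤ (1 + |(n : ℝ)|) ^ k * ∑' m : ℤ, p i (a.coeff m * b.coeff (n - m)) := by gcongr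
      _ = ∑' m : ℤ, (1 + |(n : ℝ)|) ^ k * p i (a.coeff m * b.coeff (n - m)) := by
          rw [tsum_mul_left]
      _ ≤ _ := by
          refine Summable.tsum_le_tsum (fun m => ?_)
            ((a.summable_conv_seminorm b n i).mul_left _) ((a.summable_weight j k).mul_right C)
          have h2 : (1 + |(n : ℝ)|) ≤ (1 + |(m : ℝ)|) * (1 + |((n - m : ℤ) : ℝ)|) := by
            have : |(n : ℝ)| ≤ |(m : ℝ)| + |((n - m : ℤ) : ℝ)| := by
              push_cast
              calc |(n : ℝ)| = |(m : ℝ) + (n - m)| := by ring_nf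
                _ ≤ _ := abs_add_le _ _
            nlinarith [abs_nonneg (m : ℝ), abs_nonneg ((n - m : ℤ) : ℝ)]
          have h3 := apply_nonneg (p j) (a.coeff m)
          have h4 := apply_nonneg (p j) (b.coeff (n - m))
          calc (1 + |(n : ℝ)|) ^ k * p i (a.coeff m * b.coeff (n - m))
              ≤ ((1 + |(m : ℝ)|) * (1 + |((n - m : ℤ) : ℝ)|)) ^ k *
                  (p j (a.coeff m) * p j (b.coeff (n - m))) := by
                gcongr
                exact hj _ _
            _ = (1 + |(m : ℝ)|) ^ k * p j (a.coeff m) *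
                  ((1 + |((n - m : ℤ) : ℝ)|) ^ k * p j (b.coeff (n - m))) := by
                rw [mul_pow]; ring
            _ ≤ _ := by
                gcongr
                exact hC _⟩⟩

theorem coeff_mul (a b : RapidLaurent p) (n : ℤ) :
    (a * b).coeff n = ∑' m : ℤ, a.coeff m * b.coeff (n - m) := rfl

variable [IsTopologicalRing A] [T2Space A]

theorem hasSum_coeff_mul (a b : RapidLaurent p) (n : ℤ) :
    HasSum (fun m : ℤ => a.coeff m * b.coeff (n - m)) ((a * b).coeff n) :=
  (a.summable_conv b n).hasSum

theorem mul_comm_aux (a b : RapidLaurent p) : a * b = b * a := by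
  ext n
  rw [coeff_mul, coeff_mul, ← (Equiv.subLeft n).tsum_eq]
  refine tsum_congr fun m => ?_
  simp [mul_comm]

theorem mul_assoc_aux (a b c : RapidLaurent p) : a * b * c = a * (b * c) := by
  ext n
  have hs : Summable fun lm : ℤ × ℤ => a.coeff lm.1 * b.coeff lm.2 * c.coeff (n - lm.1 - lm.2) := by
    refine summable_of_seminorm p fun i => ?_
    obtain ⟨j, -, hj⟩ := exists_mul_le p i
    obtain ⟨C, hC0, hC⟩ := c.bound j
    have h1 : Summable fun lm : ℤ × ℤ => p j (a.coeff lm.1) * p j (b.coeff lm.2) :=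
      (a.summable_seminorm j).mul_of_nonneg (b.summable_seminorm j)
        (fun _ => apply_nonneg _ _) (fun _ => apply_nonneg _ _)
    refine Summable.of_nonneg_of_le (fun _ => apply_nonneg _ _) (fun lm => ?_) (h1.mul_right C)
    exact (hj _ _ _).trans (mul_le_mul_of_nonneg_left (hC _)
      (mul_nonneg (apply_nonneg _ _) (apply_nonneg _ _)))
  have hR : HasSum (fun l : ℤ => a.coeff l * (b * c).coeff (n - l))
      (∑' lm : ℤ × ℤ, a.coeff lm.1 * b.coeff lm.2 * c.coeff (n - lm.1 - lm.2)) := by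
    refine hs.hasSum.prod_fiberwise fun l => ?_
    simp only [mul_assoc]
    exact (hasSum_coeff_mul b c (n - l)).mul_left _
  have hL : HasSum (fun k : ℤ => (a * b).coeff k * c.coeff (n - k))
      (∑' lm : ℤ × ℤ, a.coeff lm.1 * b.coeff lm.2 * c.coeff (n - lm.1 - lm.2)) := by
    let e : ℤ × ℤ ≃ ℤ × ℤ :=
      { toFun := fun kl => (kl.2, kl.1 - kl.2)
        invFun := fun lm => (lm.1 + lm.2, lm.1)
        left_inv := fun kl => by simp
        right_inv := fun lm => by simp }
    refine ((e.hasSum_iff).2 hs.hasSum).prod_fiberwise fun k => ?_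
    refine ((hasSum_coeff_mul a b k).mul_right (c.coeff (n - k))).congr_fun ?_
    intro l
    simp [e]
  exact (hasSum_coeff_mul (a * b) c n).unique hL |>.trans
    (hR.unique (hasSum_coeff_mul a (b * c) n))

theorem one_mul_aux (a : RapidLaurent p) : 1 * a = a := by
  ext n
  rw [coeff_mul, tsum_eq_single 0]
  · simp [coeff_one]
  · intro m hm
    simp [coeff_one, hm]

theorem add_mul_aux (a b c : RapidLaurent p) : (a + b) * c = a * c + b * c := by
  ext n
  refine (hasSum_coeff_mul (a + b) c n).unique ?_
  simpa [add_mul] using (hasSum_coeff_mul a c n).add (hasSum_coeff_mul b c n)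

theorem zero_mul_aux (a : RapidLaurent p) : 0 * a = 0 := by
  ext n
  simp [coeff_mul]

/-- The algebra `𝔄[z⁻¹, z]`. -/
instance : CommRing (RapidLaurent p) where
  __ := (inferInstance : AddCommGroup (RapidLaurent p))
  mul_comm := mul_comm_aux
  mul_assoc := mul_assoc_aux
  one_mul := one_mul_aux
  mul_one a := by rw [mul_comm_aux, one_mul_aux]
  left_distrib a b c := by
    rw [mul_comm_aux, add_mul_aux, mul_comm_aux b, mul_comm_aux c]
  right_distrib := add_mul_aux
  zero_mul := zero_mul_aux
  mul_zero a := by rw [mul_comm_aux, zero_mul_aux]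

end RapidLaurent

end Laurent

section Groups

variable {A : Type u} [CommRing A] [TopologicalSpace A] [IsTopologicalRing A] [T2Space A]
  [SeqComplete A] {ι : Type v} {p : ι → AddGroupSeminorm A} [StrongPolymetric p]

theorem coeff_mul_holo {a b : RapidLaurent p} (ha : a.coeff 0 = 1 ∧ ∀ n < 0, a.coeff n = 0)
    (hb : b.coeff 0 = 1 ∧ ∀ n < 0, b.coeff n = 0) :
    (a * b).coeff 0 = 1 ∧ ∀ n < 0, (a * b).coeff n = 0 := by
  refine ⟨?_, fun n hn => ?_⟩
  · rw [RapidLaurent.coeff_mul, tsum_eq_single 0]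
    · simp [ha.1, hb.1]
    · intro m hm
      rcases lt_or_gt_of_ne hm with h | h
      · rw [ha.2 m h, zero_mul]
      · rw [hb.2 _ (by omega), mul_zero]
  · rw [RapidLaurent.coeff_mul]
    refine (tsum_congr fun m => ?_).trans tsum_zero
    by_cases h : m < 0
    · rw [ha.2 m h, zero_mul]
    · rw [hb.2 _ (by omega), mul_zero]

theorem coeff_mul_antiholo {a b : RapidLaurent p} (ha : a.coeff 0 = 1 ∧ ∀ n > 0, a.coeff n = 0)
    (hb : b.coeff 0 = 1 ∧ ∀ n > 0, b.coeff n = 0) :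
    (a * b).coeff 0 = 1 ∧ ∀ n > 0, (a * b).coeff n = 0 := by
  refine ⟨?_, fun n hn => ?_⟩
  · rw [RapidLaurent.coeff_mul, tsum_eq_single 0]
    · simp [ha.1, hb.1]
    · intro m hm
      rcases lt_or_gt_of_ne hm with h | h
      · rw [hb.2 _ (by omega), mul_zero]
      · rw [ha.2 m h, zero_mul]
  · rw [RapidLaurent.coeff_mul]
    refine (tsum_congr fun m => ?_).trans tsum_zero
    by_cases h : 0 < m
    · rw [ha.2 m h, zero_mul]
    · rw [hb.2 _ (by omega), mul_zero]

/-- The group `G⁺` of strictly holomorphic Laurent series: those units `a` for which both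
`a = 1 + ∑_{n>0} a_n zⁿ` and `a⁻¹ = 1 + ∑_{n>0} b_n zⁿ`. -/
def holomorphicGroup (p : ι → AddGroupSeminorm A) [StrongPolymetric p] :
    Subgroup (RapidLaurent p)ˣ where
  carrier := {a | ((a : RapidLaurent p).coeff 0 = 1 ∧ ∀ n < 0, (a : RapidLaurent p).coeff n = 0) ∧
    ((a⁻¹ : (RapidLaurent p)ˣ) : RapidLaurent p).coeff 0 = 1 ∧
      ∀ n < 0, ((a⁻¹ : (RapidLaurent p)ˣ) : RapidLaurent p).coeff n = 0}
  mul_mem' {a b} ha hb := by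
    refine ⟨coeff_mul_holo ha.1 hb.1, ?_⟩
    rw [mul_inv]
    exact coeff_mul_holo ha.2 hb.2
  one_mem' := by
    have h : (1 : RapidLaurent p).coeff 0 = 1 ∧ ∀ n < 0, (1 : RapidLaurent p).coeff n = 0 :=
      ⟨by simp [RapidLaurent.coeff_one], fun n hn => by simp [RapidLaurent.coeff_one, hn.ne]⟩
    exact ⟨h, by simpa using h⟩
  inv_mem' {a} ha := ⟨ha.2, by simpa using ha.1⟩

/-- The group `G⁻` of strictly antiholomorphic Laurent series: those units `a` for which both
`a = 1 + ∑_{n<0} a_n zⁿ` and `a⁻¹ = 1 + ∑_{n<0} b_n zⁿ`. -/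
def antiholomorphicGroup (p : ι → AddGroupSeminorm A) [StrongPolymetric p] :
    Subgroup (RapidLaurent p)ˣ where
  carrier := {a | ((a : RapidLaurent p).coeff 0 = 1 ∧ ∀ n > 0, (a : RapidLaurent p).coeff n = 0) ∧
    ((a⁻¹ : (RapidLaurent p)ˣ) : RapidLaurent p).coeff 0 = 1 ∧
      ∀ n > 0, ((a⁻¹ : (RapidLaurent p)ˣ) : RapidLaurent p).coeff n = 0}
  mul_mem' {a b} ha hb := by
    refine ⟨coeff_mul_antiholo ha.1 hb.1, ?_⟩
    rw [mul_inv]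
    exact coeff_mul_antiholo ha.2 hb.2
  one_mem' := by
    have h : (1 : RapidLaurent p).coeff 0 = 1 ∧ ∀ n > 0, (1 : RapidLaurent p).coeff n = 0 :=
      ⟨by simp [RapidLaurent.coeff_one], fun n hn => by simp [RapidLaurent.coeff_one, hn.ne']⟩
    exact ⟨h, by simpa using h⟩
  inv_mem' {a} ha := ⟨ha.2, by simpa using ha.1⟩

theorem orthogonal_mul {a b : RapidLaurent p} (ha : ∀ n m, n ≠ m → a.coeff n * a.coeff m = 0)
    (hb : ∀ n m, n ≠ m → b.coeff n * b.coeff m = 0) (n k : ℤ) (hnk : n ≠ k) :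
    (a * b).coeff n * (a * b).coeff k = 0 := by
  refine ((RapidLaurent.hasSum_coeff_mul a b n).mul_right _).unique ?_
  convert hasSum_zero with m
  have h2 := (RapidLaurent.hasSum_coeff_mul a b k).mul_left (a.coeff m * b.coeff (n - m))
  refine h2.unique ?_
  convert hasSum_zero with l
  by_cases h : m = l
  · subst h
    calc a.coeff m * b.coeff (n - m) * (a.coeff m * b.coeff (k - m))
        = a.coeff m * a.coeff m * (b.coeff (n - m) * b.coeff (k - m)) := by ring
      _ = 0 := by rw [hb _ _ (by omega), mul_zero]
  · calc a.coeff m * b.coeff (n - m) * (a.coeff l * b.coeff (k - l))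
        = a.coeff m * a.coeff l * (b.coeff (n - m) * b.coeff (k - l)) := by ring
      _ = 0 := by rw [ha _ _ h, zero_mul]

theorem orthogonal_inv {a b : RapidLaurent p} (hab : a * b = 1)
    (ha : ∀ n m, n ≠ m → a.coeff n * a.coeff m = 0) (i j : ℤ) (hij : i ≠ j) :
    b.coeff i * b.coeff j = 0 := by
  have h1 : ∀ k n, a.coeff k * (a.coeff k * b.coeff (n - k)) =
      a.coeff k * (1 : RapidLaurent p).coeff n := by
    intro k n
    have h := (RapidLaurent.hasSum_coeff_mul a b n).mul_left (a.coeff k)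
    rw [hab] at h
    refine (hasSum_single k fun m hm => ?_).unique h
    rw [← mul_assoc, ha _ _ hm.symm, zero_mul]
  have h2 : ∀ k j, j ≠ -k → a.coeff k * b.coeff j = 0 := by
    intro k j hj
    have e1 := h1 k 0
    have e2 := h1 k (j + k)
    rw [RapidLaurent.coeff_one, if_pos rfl, mul_one] at e1
    rw [RapidLaurent.coeff_one, if_neg (by omega), mul_zero, add_sub_cancel_right] at e2
    rw [← e1]
    calc a.coeff k * (a.coeff k * b.coeff (0 - k)) * b.coeff j
        = a.coeff k * (a.coeff k * b.coeff j) * b.coeff (0 - k) := by ring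
      _ = 0 := by rw [e2, zero_mul]
  have h := (RapidLaurent.hasSum_coeff_mul a b 0).mul_right (b.coeff i * b.coeff j)
  rw [hab, RapidLaurent.coeff_one, if_pos rfl, one_mul] at h
  refine h.unique ?_
  convert hasSum_zero with m
  by_cases hm : i = -m
  · calc a.coeff m * b.coeff (0 - m) * (b.coeff i * b.coeff j)
        = a.coeff m * b.coeff j * (b.coeff (0 - m) * b.coeff i) := by ring
      _ = 0 := by rw [h2 m j (by omega), zero_mul]
  · calc a.coeff m * b.coeff (0 - m) * (b.coeff i * b.coeff j)
        = a.coeff m * b.coeff i * (b.coeff (0 - m) * b.coeff j) := by ring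
      _ = 0 := by rw [h2 m i hm, zero_mul]

/-- The group `G̃` of orthogonal Laurent series: those units `a` with `a_n a_m = 0` for `n ≠ m`. -/
def orthogonalGroup (p : ι → AddGroupSeminorm A) [StrongPolymetric p] :
    Subgroup (RapidLaurent p)ˣ where
  carrier := {a | ∀ n m, n ≠ m →
    (a : RapidLaurent p).coeff n * (a : RapidLaurent p).coeff m = 0}
  mul_mem' {_ _} ha hb := orthogonal_mul ha hb
  one_mem' n m h := by
    simp only [Units.val_one, RapidLaurent.coeff_one]
    split_ifs <;> simp_all
  inv_mem' {a} ha := orthogonal_inv a.mul_inv ha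

end Groups

section Matrices

variable {R : Type u} [CommRing R] [TopologicalSpace R]

/-- The product of the infinite matrices `X` and `Y` exists and equals `Z`: each entry
`∑_l X_{n,l} Y_{l,m}` converges to `Z_{n,m}`. -/
def HasMatMul (X Y Z : Matrix ℤ ℤ R) : Prop :=
  ∀ n m, HasSum (fun l => X n l * Y l m) (Z n m)

/-- `Y` is a two-sided inverse of the infinite matrix `X`. -/
def IsMatInverse (X Y : Matrix ℤ ℤ R) : Prop :=
  HasMatMul X Y 1 ∧ HasMatMul Y X 1

/-- The permutations of `ℤ` that move only finitely many elements. -/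
abbrev FinitePerm : Type := {σ : Equiv.Perm ℤ // {n | σ n ≠ n}.Finite}

/-- The sign of a finite permutation, computed on the finite set of elements that it moves. -/
def FinitePerm.sign (σ : FinitePerm) : ℤˣ :=
  haveI : Fintype {n // σ.1 n ≠ n} := σ.2.fintype
  Equiv.Perm.sign (σ.1.subtypePerm (p := fun n => σ.1 n ≠ n) fun n => by simp)

/-- The infinite matrix `W` has determinant `d`: the products `∏_n W_{n,σ(n)}` for the finite
permutations `σ` of `ℤ` converge, and their alternating sum converges to `d`. -/
def HasDet (W : Matrix ℤ ℤ R) (d : R) : Prop :=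
  (∀ σ : FinitePerm, Multipliable fun n => W n (σ.1 n)) ∧
    HasSum (fun σ : FinitePerm => (((FinitePerm.sign σ : ℤˣ) : ℤ) : R) * ∏' n, W n (σ.1 n)) d

end Matrices

section Projections

variable {A : Type u} [CommRing A] [TopologicalSpace A] [IsTopologicalRing A] [T2Space A]
  [SeqComplete A] {ι : Type v} {p : ι → AddGroupSeminorm A} [StrongPolymetric p]

/-- The variable `w`. The matrices below have entries in `𝔄[w⁻¹, w]`, or in `𝔄[w⁻¹, w][[t]]`. -/
def w : RapidLaurent p := RapidLaurent.monomial 1 1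

/-- The inverse `w⁻¹` of the variable `w`. -/
def wInv : RapidLaurent p := RapidLaurent.monomial (-1) 1

/-- The constants `𝔄 ⊆ 𝔄[w⁻¹, w]`. -/
def const (x : A) : RapidLaurent p := RapidLaurent.monomial 0 x

/-- The multiplication matrix `U(a) = ∑ a_{n-m} e_{n,m}`, with constant entries. -/
def matU (a : RapidLaurent p) : Matrix ℤ ℤ (RapidLaurent p) :=
  fun n m => const (a.coeff (n - m))

/-- The matrix `Ũ(a, w)`: the `0`-th row and column are those of the identity matrix, and after
deleting them and closing the gap it is the Toeplitz matrix of `a` with its upper right block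
multiplied by `-w` and its lower left block multiplied by `-w⁻¹`. -/
def matUTilde (a : RapidLaurent p) : Matrix ℤ ℤ (RapidLaurent p) := fun n m =>
  if n = 0 ∨ m = 0 then (if n = m then 1 else 0)
  else if n < 0 ∧ 0 < m then -(w * const (a.coeff (n - m + 1)))
  else if 0 < n ∧ m < 0 then -(wInv * const (a.coeff (n - m - 1)))
  else const (a.coeff (n - m))

/-- The matrix `F⁺(t, w) = 1 - t w 1_{ℤ⁻} U(z⁻¹)`. -/
def matFPlus (p : ι → AddGroupSeminorm A) [StrongPolymetric p] :
    Matrix ℤ ℤ (PowerSeries (RapidLaurent p)) := fun n m =>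
  (if n = m then 1 else 0) - if n < 0 ∧ m = n + 1 then PowerSeries.X * PowerSeries.C w else 0

/-- The matrix `F⁻(t, w) = 1 - t w⁻¹ 1_{ℤ⁺} U(z)`. -/
def matFMinus (p : ι → AddGroupSeminorm A) [StrongPolymetric p] :
    Matrix ℤ ℤ (PowerSeries (RapidLaurent p)) := fun n m =>
  (if n = m then 1 else 0) - if 0 < n ∧ m = n - 1 then PowerSeries.X * PowerSeries.C wInv else 0

/-- `V` is the value at `t = 1` of the matrix `F(t) U(a) F(t)⁻¹`. -/
def IsConjAtOne (F : Matrix ℤ ℤ (PowerSeries (RapidLaurent p))) (a : RapidLaurent p)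
    (V : Matrix ℤ ℤ (RapidLaurent p)) : Prop :=
  ∃ F' X Y : Matrix ℤ ℤ (PowerSeries (RapidLaurent p)), IsMatInverse F F' ∧
    HasMatMul F ((matU a).map PowerSeries.C) X ∧ HasMatMul X F' Y ∧
    ∀ n m, HasSum (fun k => PowerSeries.coeff k (Y n m)) (V n m)

/-- `d = π̃(a, w) = det (U(a) Ũ(a, w)⁻¹)`, where `Ũ(a, w)⁻¹ = Ũ(a⁻¹, w)`. -/
def IsPiTilde (a : (RapidLaurent p)ˣ) (d : RapidLaurent p) : Prop :=
  IsMatInverse (matUTilde (a : RapidLaurent p)) (matUTilde ((a⁻¹ : (RapidLaurent p)ˣ) : _)) ∧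
  ∃ W, HasMatMul (matU (a : RapidLaurent p)) (matUTilde ((a⁻¹ : (RapidLaurent p)ˣ) : _)) W ∧
    HasDet W d

/-- `d = det (V U(a)⁻¹)`, where `V` is the value at `t = 1` of `F(t) U(a) F(t)⁻¹` and
`U(a)⁻¹ = U(a⁻¹)`. -/
def IsConjDet (F : Matrix ℤ ℤ (PowerSeries (RapidLaurent p))) (a : (RapidLaurent p)ˣ)
    (d : RapidLaurent p) : Prop :=
  IsMatInverse (matU (a : RapidLaurent p)) (matU ((a⁻¹ : (RapidLaurent p)ˣ) : _)) ∧
  ∃ V W, IsConjAtOne F a V ∧ HasMatMul V (matU ((a⁻¹ : (RapidLaurent p)ˣ) : _)) W ∧ HasDet W d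

/-- `d = π⁺(a, 1, w)`. -/
def IsPiPlus (a : (RapidLaurent p)ˣ) (d : RapidLaurent p) : Prop := IsConjDet (matFPlus p) a d

/-- `d = π⁻(a, 1, w)`. -/
def IsPiMinus (a : (RapidLaurent p)ˣ) (d : RapidLaurent p) : Prop := IsConjDet (matFMinus p) a d

end Projections

end Polymetric

end

open Polymetric

noncomputable section

namespace Polymetric

universe u v u' v'

open scoped ENNReal

set_option linter.unusedSectionVars false

/-! ### Topologies defined by seminorms -/

section SeminormTopology

variable {E : Type u} [AddCommGroup E] {κ : Type v} {κ' : Type v'}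

/-! Every determinant in question is `det (1 + K)` with the entries of `K` absolutely summable. It
is the sum of the principal minors of `K`. Its terms are indexed by pairs `(σ, T)` with `σ`
supported in the finite set `T`; their graphs are distinct finite subsets of `ℤ × ℤ`, so the sum is
dominated by `exp ∑ |K n m|`. By dominated convergence (`tendsto_det1`) it is a limit of finite
determinants, and `det (xy) = det x · det y` and `det (1 + xy) = det (1 + yx)` carry over. The
entries lie in `𝔄[w⁻¹, w]`, which is again strongly polymetric, Hausdorff and sequentially complete
once the suprema are replaced by the equivalent weighted sums.

Let `F⁺`, `F⁻` be the matrices of the statement at `t = 1`. The matrices `V⁺`, `V⁻` (the values at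
`t = 1` of the conjugates of `U(a)`) are written down explicitly and satisfy `V F = F U`
(`V_mul_F`). Although `F` has no inverse with bounded row and column sums, it can be cancelled on
the right (`mul_F_cancel`), so `V` is multiplicative in `a`. The difference `V - U` is summable
because its entries involve only coefficients `a_r` with `|r|` at least as large as both indices.
Hence `π⁺` and `π⁻`, the determinants of `V U⁻¹`, exist, and they are homomorphisms since
determinants are invariant under conjugation. The entries of `V⁺ - U` contain only positive powers
of `w`, those of `V⁻ - U` only negative ones, so the values lie in `G⁺` and `G⁻`.

For the factorization of `a`, conjugate by `F = F⁻ F⁺`. Off row `0`, the matrix `F` is `P (1 - Z)`,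
where `Z` commutes with `U(a)` and `P` closes the gap at `0`. Therefore `M = F U F⁻¹` agrees with
`Ũ` off row `0`, while `M 0 0 = a(w)`, and `det (M Ũ⁻¹) = a(w)`. In `M Ũ⁻¹ = (M (V⁻)⁻¹) (V⁻ U⁻¹) (U
Ũ⁻¹)` the first factor is formally the conjugate of `V⁺ U⁻¹` by `F⁻`. Hence `a = π⁺ π⁻ π̃`
(`piPM_mul_piTilde`).

Orthogonality of `π̃` uses a second variable `w'`. Conjugation by the diagonal matrix with entries
`w` at negative indices and `1` elsewhere turns `Ũ(a, w')` into `Ũ(a, w w')`. This yields `π̃(w w')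
π̃(1) = π̃(w) π̃(w')` (`twist_piTilde_mul`), and comparison of coefficients gives `π̃_n π̃_m = 0`
for `n ≠ m`.

Continuity of `π⁺` and `π⁻` follows at `1` from a bound `exp (C ‖a - 1‖ ‖a⁻¹‖) - 1`. Uniqueness of
the factorization is a comparison of coefficients (`eq_one_of_mul_mul_eq_one`). -/

theorem nhds_seminormTopology (q : κ → AddGroupSeminorm E) (a : E) :
    @nhds E (seminormTopology q) a = ⨅ k, comap (fun x => q k (x - a)) (𝓝 0) := by
  rw [seminormTopology, nhds_iInf]
  congr 1
  funext i
  let := (q i).toSeminormedAddCommGroup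
  rw [← nhds_comap_dist a]
  congr 1
  funext x
  rw [dist_eq_norm]
  rfl

theorem seminormTopology_le {q : κ → AddGroupSeminorm E} {q' : κ' → AddGroupSeminorm E}
    (h : ∀ k, ∃ k', ∃ C : ℝ, ∀ x, q k x ≤ C * q' k' x) :
    seminormTopology q' ≤ seminormTopology q := by
  refine le_of_nhds_le_nhds fun a => ?_
  rw [nhds_seminormTopology, nhds_seminormTopology]
  refine le_iInf fun k => ?_
  obtain ⟨k', C, hC⟩ := h k
  refine (iInf_le _ k').trans ?_
  rw [← tendsto_iff_comap]
  have h0 : Tendsto (fun x => C * q' k' (x - a)) (comap (fun x => q' k' (x - a)) (𝓝 0)) (𝓝 0) := by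
    simpa using (tendsto_comap (f := fun x => q' k' (x - a)) (x := 𝓝 (0 : ℝ))).const_mul C
  exact squeeze_zero (fun _ => apply_nonneg _ _) (fun x => hC _) h0

end SeminormTopology

/-! ### Seminorm estimates with values in `ℝ≥0∞` -/

section Norms

variable {A : Type u} [CommRing A] {ι : Type v}

/-- The seminorm `p i` with values in `ℝ≥0∞`. -/
def en (p : ι → AddGroupSeminorm A) (i : ι) (x : A) : ℝ≥0∞ := ENNReal.ofReal (p i x)

variable (p : ι → AddGroupSeminorm A) (i : ι)

@[simp] theorem en_zero : en p i 0 = 0 := by simp [en]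
@[simp] theorem en_neg (x : A) : en p i (-x) = en p i x := by simp [en, map_neg_eq_map]
theorem en_ne_top (x : A) : en p i x ≠ ⊤ := ENNReal.ofReal_ne_top
theorem toReal_en (x : A) : (en p i x).toReal = p i x := ENNReal.toReal_ofReal (apply_nonneg _ _)

theorem en_add_le (x y : A) : en p i (x + y) ≤ en p i x + en p i y := by
  rw [en, en, en, ← ENNReal.ofReal_add (apply_nonneg _ _) (apply_nonneg _ _)]
  exact ENNReal.ofReal_le_ofReal (map_add_le_add _ _ _)

theorem en_sub_le (x y : A) : en p i (x - y) ≤ en p i x + en p i y := by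
  rw [sub_eq_add_neg]
  simpa using en_add_le p i x (-y)

theorem en_sum_le {β : Type*} (s : Finset β) (f : β → A) :
    en p i (∑ b ∈ s, f b) ≤ ∑ b ∈ s, en p i (f b) :=
  Finset.le_sum_of_subadditive _ (en_zero p i).le (en_add_le p i) _ _

theorem summable_of_tsum_en {β : Type*} {f : β → A} (h : ∑' b, en p i (f b) ≠ ⊤) :
    Summable fun b => p i (f b) := by
  simpa only [toReal_en] using ENNReal.summable_toReal h

variable [TopologicalSpace A] [hp : StrongPolymetric p]

theorem exists_en_mul_le : ∃ j, (∀ x y, en p i (x * y) ≤ en p j x * en p j y) ∧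
    ∀ x y z, en p i (x * y * z) ≤ en p j x * en p j y * en p j z := by
  obtain ⟨j, h1, h2⟩ := exists_mul_le p i
  refine ⟨j, fun x y => ?_, fun x y z => ?_⟩
  · rw [en, en, en, ← ENNReal.ofReal_mul (apply_nonneg _ _)]
    exact ENNReal.ofReal_le_ofReal (h1 _ _)
  · rw [en, en, en, en, ← ENNReal.ofReal_mul (apply_nonneg _ _),
      ← ENNReal.ofReal_mul (mul_nonneg (apply_nonneg _ _) (apply_nonneg _ _))]
    exact ENNReal.ofReal_le_ofReal (h2 _ _ _)

theorem exists_en_prod_le : ∃ j, ∀ l : List A, l ≠ [] → en p i l.prod ≤ (l.map (en p j)).prod := by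
  obtain ⟨j, hj⟩ := hp.prod_le i
  refine ⟨j, fun l hl => (ENNReal.ofReal_le_ofReal (hj l hl)).trans ?_⟩
  clear hl
  induction l with
  | nil => simp
  | cons x l ih =>
    rw [List.map_cons, List.prod_cons, List.map_cons, List.prod_cons,
      ENNReal.ofReal_mul (apply_nonneg _ _)]
    gcongr
    exact le_rfl

theorem summable_of_en [SeqComplete A] {β : Type*} [Countable β] {f : β → A}
    (h : ∀ i, ∑' b, en p i (f b) ≠ ⊤) : Summable f :=
  summable_of_seminorm p fun i => summable_of_tsum_en p i (h i)

theorem continuous_seminorm : Continuous (p i) := by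
  rw [continuous_iff_continuousAt]
  intro a
  rw [ContinuousAt, tendsto_iff_dist_tendsto_zero]
  refine squeeze_zero (fun _ => dist_nonneg) (fun x => ?_) ((tendsto_iff p).1 tendsto_id i)
  rw [Real.dist_eq]
  exact abs_sub_map_le_sub (p i) x a

theorem en_le_of_hasSum {β : Type*} {f : β → A} {a : A} (h : HasSum f a) :
    en p i a ≤ ∑' b, en p i (f b) := by
  have hc : Continuous (en p i) := ENNReal.continuous_ofReal.comp (continuous_seminorm p i)
  refine le_of_tendsto ((hc.tendsto a).comp h) (Eventually.of_forall fun s => ?_)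
  exact (en_sum_le p i s f).trans (ENNReal.sum_le_tsum s)

theorem en_tsum_le {β : Type*} (f : β → A) : en p i (∑' b, f b) ≤ ∑' b, en p i (f b) := by
  by_cases h : Summable f
  · exact en_le_of_hasSum p i h.hasSum
  · rw [tsum_eq_zero_of_not_summable h]; simp

theorem eq_zero_of_en [T2Space A] {x : A} (h : ∀ i, en p i x = 0) : x = 0 := by
  have : Tendsto (fun _ : ℕ => (0 : A)) atTop (𝓝 x) := by
    rw [tendsto_iff p]
    intro i
    have h1 : p i (0 - x) = 0 := by
      rw [zero_sub, map_neg_eq_map, ← toReal_en p, h i, ENNReal.toReal_zero]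
    simp only [h1]
    exact tendsto_const_nhds
  exact tendsto_nhds_unique this tendsto_const_nhds

/-- The topology induced by a strong family of seminorms is a ring topology. -/
theorem isTopologicalRing {ι : Type v} (p : ι → AddGroupSeminorm A) [StrongPolymetric p] :
    IsTopologicalRing A := by
  have hadd : ContinuousAdd A := ⟨by
    rw [continuous_iff_continuousAt]
    rintro ⟨a, b⟩
    rw [ContinuousAt, nhds_prod_eq, tendsto_iff p]
    intro i
    have h1 := ((tendsto_iff p).1 (tendsto_id (x := 𝓝 a)) i).comp (tendsto_fst (g := 𝓝 b))
    have h2 := ((tendsto_iff p).1 (tendsto_id (x := 𝓝 b)) i).comp (tendsto_snd (f := 𝓝 a))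
    refine squeeze_zero (fun _ => apply_nonneg _ _) (fun x => ?_) (by simpa using h1.add h2)
    simpa [add_sub_add_comm] using map_add_le_add (p i) (x.1 - a) (x.2 - b)⟩
  have hmul : ContinuousMul A := ⟨by
    rw [continuous_iff_continuousAt]
    rintro ⟨a, b⟩
    rw [ContinuousAt, nhds_prod_eq, tendsto_iff p]
    intro i
    obtain ⟨j, hj, -⟩ := exists_mul_le p i
    have h1 := ((tendsto_iff p).1 (tendsto_id (x := 𝓝 a)) j).comp (tendsto_fst (g := 𝓝 b))
    have h2 := ((tendsto_iff p).1 (tendsto_id (x := 𝓝 b)) j).comp (tendsto_snd (f := 𝓝 a))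
    have h3 : Tendsto (fun x : A × A => p j (x.1 - a) * p j (x.2 - b) + p j a * p j (x.2 - b) +
        p j (x.1 - a) * p j b) (𝓝 a ×ˢ 𝓝 b) (𝓝 0) := by
      simpa using ((h1.mul h2).add (h2.const_mul (p j a))).add (h1.mul_const (p j b))
    refine squeeze_zero (fun _ => apply_nonneg _ _) (fun x => ?_) h3
    have e : x.1 * x.2 - a * b = (x.1 - a) * (x.2 - b) + a * (x.2 - b) + (x.1 - a) * b := by ring
    rw [e]
    refine (map_add_le_add (p i) _ _).trans (add_le_add ?_ (hj _ _))
    exact (map_add_le_add (p i) _ _).trans (add_le_add (hj _ _) (hj _ _))⟩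
  have hneg : ContinuousNeg A := ⟨by
    rw [continuous_iff_continuousAt]
    intro a
    rw [ContinuousAt, tendsto_iff p]
    intro i
    refine (((tendsto_iff p).1 (tendsto_id (x := 𝓝 a)) i)).congr fun x => ?_
    rw [← map_neg_eq_map (p i)]
    congr 1
    simp only [id]
    ring⟩
  exact { }

/-- A map between rings whose seminorms are dominated by those of the source. -/
def SeminormBounded {B : Type u'} [CommRing B] {κ : Type v'} (q : κ → AddGroupSeminorm B)
    (f : A → B) : Prop :=
  ∀ k, ∃ i, ∃ C : ℝ≥0∞, C ≠ ⊤ ∧ ∀ x, en q k (f x) ≤ C * en p i x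

variable {p}

theorem SeminormBounded.continuous {B : Type u'} [CommRing B] [TopologicalSpace B] {κ : Type v'}
    {q : κ → AddGroupSeminorm B} [StrongPolymetric q] {f : A →+ B} (hf : SeminormBounded p q f) :
    Continuous f := by
  rw [continuous_iff_continuousAt]
  intro a
  rw [ContinuousAt, tendsto_iff q]
  intro k
  obtain ⟨i, C, hC, h⟩ := hf k
  have h1 := ((tendsto_iff p).1 (tendsto_id (x := 𝓝 a)) i).const_mul C.toReal
  rw [mul_zero] at h1
  refine squeeze_zero (fun _ => apply_nonneg _ _) (fun x => ?_) h1
  have h2 := ENNReal.toReal_mono (ENNReal.mul_ne_top hC (en_ne_top _ _ _)) (h (x - a))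
  rw [ENNReal.toReal_mul, toReal_en, toReal_en, map_sub] at h2
  exact h2

end Norms

/-! ### The polynomial weights -/

section Weights

/-- The weight `(1 + |n|)ᵏ`. -/
def wt (k : ℕ) (n : ℤ) : ℝ≥0∞ := ((1 + n.natAbs : ℕ) : ℝ≥0∞) ^ k

theorem wt_eq_ofReal (k : ℕ) (n : ℤ) : wt k n = ENNReal.ofReal ((1 + |(n : ℝ)|) ^ k) := by
  rw [wt, ENNReal.ofReal_pow (by positivity)]
  congr 1
  have : 1 + |(n : ℝ)| = ((1 + n.natAbs : ℕ) : ℝ) := by push_cast; rw [Nat.cast_natAbs]; simp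
  rw [this, ENNReal.ofReal_natCast]

theorem wt_ne_top (k : ℕ) (n : ℤ) : wt k n ≠ ⊤ := by
  rw [wt_eq_ofReal]; exact ENNReal.ofReal_ne_top

@[simp] theorem wt_zero_left (n : ℤ) : wt 0 n = 1 := by simp [wt]
@[simp] theorem wt_zero_right (k : ℕ) : wt k 0 = 1 := by simp [wt]

theorem one_le_wt (k : ℕ) (n : ℤ) : 1 ≤ wt k n := by
  rw [wt]; exact one_le_pow₀ (by simp)

theorem wt_ne_zero (k : ℕ) (n : ℤ) : wt k n ≠ 0 := (zero_lt_one.trans_le (one_le_wt k n)).ne'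

theorem wt_mono_left {k l : ℕ} (h : k ≤ l) (n : ℤ) : wt k n ≤ wt l n :=
  pow_le_pow_right₀ (by simp) h

theorem wt_mono_right (k : ℕ) {m n : ℤ} (h : m.natAbs ≤ n.natAbs) : wt k m ≤ wt k n := by
  rw [wt, wt]; gcongr

theorem wt_add (k l : ℕ) (n : ℤ) : wt (k + l) n = wt k n * wt l n := pow_add _ _ _

theorem wt_neg (k : ℕ) (n : ℤ) : wt k (-n) = wt k n := by simp [wt]

theorem wt_add_le (k : ℕ) (m n : ℤ) : wt k (m + n) ≤ wt k m * wt k n := by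
  rw [wt, wt, wt, ← mul_pow, ← Nat.cast_mul]
  gcongr
  nlinarith [Int.natAbs_add_le m n, Nat.zero_le (m.natAbs * n.natAbs)]

theorem summable_inv_sq : Summable fun n : ℤ => ((1 + |(n : ℝ)|) ^ 2)⁻¹ := by
  have hs : Summable fun n : ℤ => (1 / (n : ℝ) ^ 2 + if n = 0 then 1 else 0) := by
    refine Summable.add ((Real.summable_one_div_int_pow (p := 2)).2 (by norm_num))
      (summable_of_hasFiniteSupport ((Set.finite_singleton (0 : ℤ)).subset fun n hn => ?_))
    by_contra h
    simp at h
    simp [h] at hn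
  refine Summable.of_nonneg_of_le (fun n => by positivity) (fun n => ?_) hs
  by_cases hn : n = 0
  · simp [hn]
  · simp only [hn, if_false, add_zero]
    rw [one_div]
    have h : (0 : ℝ) < (n : ℝ) ^ 2 := by positivity
    refine inv_anti₀ h ?_
    rw [← sq_abs (n : ℝ)]
    gcongr
    linarith

theorem tsum_inv_wt_ne_top : ∑' n : ℤ, (wt 2 n)⁻¹ ≠ ⊤ := by
  have h : ∀ n : ℤ, (wt 2 n)⁻¹ = ENNReal.ofReal (((1 + |(n : ℝ)|) ^ 2)⁻¹) := fun n => by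
    rw [wt_eq_ofReal, ENNReal.ofReal_inv_of_pos (by positivity)]
  simp only [h]
  exact summable_inv_sq.tsum_ofReal_ne_top

end Weights

/-! ### Weighted sums instead of weighted suprema -/

section SumNorm

variable {A : Type u} [CommRing A] {ι : Type v} {p : ι → AddGroupSeminorm A}

/-- The seminorms `a ↦ ∑ (1 + |n|)ᵏ p_i(a_n)`. They induce the same topology as the suprema, and in
contrast to these they dominate products of arbitrary length. -/
def sumNorm (p : ι → AddGroupSeminorm A) (ik : ι × ℕ) : AddGroupSeminorm (RapidLaurent p) where
  toFun a := ∑' n : ℤ, (1 + |(n : ℝ)|) ^ ik.2 * p ik.1 (a.coeff n)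
  map_zero' := by simp
  add_le' a b := by
    rw [← (a.summable_weight ik.1 ik.2).tsum_add (b.summable_weight ik.1 ik.2)]
    refine Summable.tsum_le_tsum (fun n => ?_) ((a + b).summable_weight ik.1 ik.2)
      ((a.summable_weight ik.1 ik.2).add (b.summable_weight ik.1 ik.2))
    rw [← mul_add]
    gcongr
    exact map_add_le_add _ _ _
  neg' a := by simp [map_neg_eq_map]

theorem bddAbove_weight (a : RapidLaurent p) (i : ι) (k : ℕ) :
    BddAbove (Set.range fun n : ℤ => (1 + |(n : ℝ)|) ^ k * p i (a.coeff n)) := by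
  obtain ⟨C, hC⟩ := a.rapid i k
  exact ⟨C, by rintro _ ⟨n, rfl⟩; exact hC n⟩

theorem seminorm_le_sumNorm (ik : ι × ℕ) (a : RapidLaurent p) :
    RapidLaurent.seminorm p ik a ≤ sumNorm p ik a := by
  refine ciSup_le fun n => ?_
  exact (a.summable_weight ik.1 ik.2).le_tsum n
    fun m _ => mul_nonneg (by positivity) (apply_nonneg _ _)

/-- Two additional powers of the weight pay for the summation, as `∑ (1 + |n|)⁻²` is finite. -/
theorem sumNorm_le_seminorm (i : ι) (k : ℕ) (a : RapidLaurent p) :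
    sumNorm p (i, k) a ≤
      (∑' n : ℤ, ((1 + |(n : ℝ)|) ^ 2)⁻¹) * RapidLaurent.seminorm p (i, k + 2) a := by
  rw [← tsum_mul_right]
  refine Summable.tsum_le_tsum (fun n => ?_) (a.summable_weight i k)
    (summable_inv_sq.mul_right _)
  have h := le_ciSup (bddAbove_weight a i (k + 2)) n
  have h1 : (0 : ℝ) < (1 + |(n : ℝ)|) ^ 2 := by positivity
  rw [inv_mul_eq_div, le_div_iff₀ h1]
  refine le_trans (le_of_eq ?_) h
  ring

theorem topology_eq_sumNorm :
    (inferInstance : TopologicalSpace (RapidLaurent p)) = seminormTopology (sumNorm p) :=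
  le_antisymm
    (seminormTopology_le fun ik => ⟨(ik.1, ik.2 + 2), _, sumNorm_le_seminorm ik.1 ik.2⟩)
    (seminormTopology_le fun ik => ⟨ik, 1, fun a => by simpa using seminorm_le_sumNorm ik a⟩)

end SumNorm

/-! ### The Laurent series ring satisfies the hypotheses on the coefficient ring -/

section LaurentInstances

variable {A : Type u} [CommRing A] [TopologicalSpace A] [IsTopologicalRing A] [T2Space A]
  [SeqComplete A] {ι : Type v} {p : ι → AddGroupSeminorm A} [hp : StrongPolymetric p]

theorem en_sumNorm (i : ι) (k : ℕ) (a : RapidLaurent p) :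
    en (sumNorm p) (i, k) a = ∑' n, wt k n * en p i (a.coeff n) := by
  have h := ENNReal.ofReal_tsum_of_nonneg
    (fun n : ℤ => mul_nonneg (pow_nonneg (by positivity : (0 : ℝ) ≤ 1 + |(n : ℝ)|) k)
      (apply_nonneg (p i) (a.coeff n))) (a.summable_weight i k)
  refine h.trans (tsum_congr fun n => ?_)
  rw [ENNReal.ofReal_mul (by positivity), wt_eq_ofReal]
  rfl

theorem wt_mul_en_coeff_le (i : ι) (k : ℕ) (a : RapidLaurent p) (n : ℤ) :
    wt k n * en p i (a.coeff n) ≤ en (sumNorm p) (i, k) a := by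
  rw [en_sumNorm]; exact ENNReal.le_tsum n

theorem en_coeff_le (i : ι) (k : ℕ) (a : RapidLaurent p) (n : ℤ) :
    en p i (a.coeff n) ≤ (wt k n)⁻¹ * en (sumNorm p) (i, k) a := by
  rw [mul_comm, ← div_eq_mul_inv, ENNReal.le_div_iff_mul_le (Or.inl (wt_ne_zero _ _))
    (Or.inl (wt_ne_top _ _)), mul_comm]
  exact wt_mul_en_coeff_le i k a n

theorem en_sumNorm_mono (i : ι) {k l : ℕ} (h : k ≤ l) (a : RapidLaurent p) :
    en (sumNorm p) (i, k) a ≤ en (sumNorm p) (i, l) a := by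
  rw [en_sumNorm, en_sumNorm]
  exact ENNReal.tsum_le_tsum fun n => by gcongr; exact wt_mono_left h n

theorem en_sumNorm_monomial (i : ι) (k : ℕ) (n : ℤ) (x : A) :
    en (sumNorm p) (i, k) (RapidLaurent.monomial n x) = wt k n * en p i x := by
  rw [en_sumNorm, tsum_eq_single n]
  · simp [RapidLaurent.monomial]
  · intro m hm
    simp [RapidLaurent.monomial, hm]

/-- Domination of `p i` by `p j` may be used only once, since repeated pairwise use would change the
index each time. The list `c` therefore collects the coefficients already split off, and `hj` is
applied to the complete list at the end of the induction. The weights are submultiplicative along `n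
= m + (n - m)`. -/
theorem tsum_wt_mul_en_prod_le {i j : ι}
    (hj : ∀ l : List A, l ≠ [] → en p i l.prod ≤ (l.map (en p j)).prod) (k : ℕ)
    (l : List (RapidLaurent p)) : ∀ c : List A, c ≠ [] ∨ l ≠ [] →
      ∑' n, wt k n * en p i (c.prod * l.prod.coeff n) ≤
        (c.map (en p j)).prod * (l.map (en (sumNorm p) (j, k))).prod := by
  induction l with
  | nil =>
    intro c hc
    rw [tsum_eq_single 0]
    · simpa [RapidLaurent.coeff_one] using hj c (by simpa using hc)
    · intro n hn
      simp [RapidLaurent.coeff_one, hn]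
  | cons a l ih =>
    intro c _
    calc ∑' n, wt k n * en p i (c.prod * (a :: l).prod.coeff n)
        ≤ ∑' n, ∑' m, wt k m * (wt k (n - m) *
            en p i ((c ++ [a.coeff m]).prod * l.prod.coeff (n - m))) := by
          refine ENNReal.tsum_le_tsum fun n => ?_
          have h := (RapidLaurent.hasSum_coeff_mul a l.prod n).mul_left c.prod
          rw [List.prod_cons]
          refine (mul_le_mul' le_rfl (en_le_of_hasSum p i h)).trans ?_
          rw [← ENNReal.tsum_mul_left]
          refine ENNReal.tsum_le_tsum fun m => ?_
          rw [List.prod_append, List.prod_singleton, mul_assoc c.prod, ← mul_assoc (wt k m)]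
          refine mul_le_mul' ?_ le_rfl
          simpa using wt_add_le k m (n - m)
      _ = ∑' m, wt k m * ∑' n, (wt k n *
            en p i ((c ++ [a.coeff m]).prod * l.prod.coeff n)) := by
          rw [ENNReal.tsum_comm]
          refine tsum_congr fun m => ?_
          rw [ENNReal.tsum_mul_left]
          congr 1
          exact (Equiv.subRight m).tsum_eq
            (fun n => wt k n * en p i ((c ++ [a.coeff m]).prod * l.prod.coeff n))
      _ ≤ ∑' m, wt k m * (((c ++ [a.coeff m]).map (en p j)).prod *
            (l.map (en (sumNorm p) (j, k))).prod) := by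
          refine ENNReal.tsum_le_tsum fun m => mul_le_mul' le_rfl (ih _ (by simp))
      _ = _ := by
          rw [List.map_cons, List.prod_cons, en_sumNorm, ← ENNReal.tsum_mul_right,
            ← ENNReal.tsum_mul_left]
          refine tsum_congr fun m => ?_
          simp only [List.map_append, List.map_cons, List.map_nil, List.prod_append,
            List.prod_singleton]
          ring

/-- This makes the construction iterable: determinants can be taken over `𝔄[w⁻¹, w]`, and over the
ring in two variables needed for orthogonality. -/
instance : StrongPolymetric (sumNorm p) where
  topology_eq := topology_eq_sumNorm
  prod_le := by
    rintro ⟨i, k⟩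
    obtain ⟨j, hj⟩ := exists_en_prod_le p i
    refine ⟨(j, k), fun l hl => ?_⟩
    have h := tsum_wt_mul_en_prod_le hj k l [] (Or.inr hl)
    simp only [List.prod_nil, one_mul, List.map_nil] at h
    rw [← en_sumNorm] at h
    have e : ∀ l : List (RapidLaurent p), (l.map (en (sumNorm p) (j, k))).prod =
        ENNReal.ofReal (l.map (sumNorm p (j, k))).prod := fun l => by
      induction l with
      | nil => simp
      | cons a l ih =>
        rw [List.map_cons, List.prod_cons, ih, List.map_cons, List.prod_cons,
          ENNReal.ofReal_mul (apply_nonneg _ _)]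
        rfl
    rw [e, en] at h
    refine (ENNReal.ofReal_le_ofReal_iff (List.prod_nonneg ?_)).1 h
    simp only [List.mem_map]
    rintro _ ⟨a, -, rfl⟩
    exact apply_nonneg _ _

instance : IsTopologicalRing (RapidLaurent p) := isTopologicalRing (sumNorm p)

theorem RapidLaurent.continuous_coeff (n : ℤ) :
    Continuous fun a : RapidLaurent p => a.coeff n := by
  refine SeminormBounded.continuous (p := sumNorm p) (q := p)
    (f := (⟨⟨fun a : RapidLaurent p => a.coeff n, rfl⟩, fun _ _ => rfl⟩ : RapidLaurent p →+ A)) ?_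
  refine fun i => ⟨(i, 0), 1, ENNReal.one_ne_top, fun a => ?_⟩
  simpa using wt_mul_en_coeff_le i 0 a n

instance : T2Space (RapidLaurent p) := by
  refine T2Space.of_injective_continuous (f := fun a : RapidLaurent p => a.coeff)
    (fun a b h => RapidLaurent.ext h) ?_
  exact continuous_pi fun n => RapidLaurent.continuous_coeff n

/-- Coefficientwise limits exist, and uniform bounds on the suprema pass to the limit. -/
instance : SeqComplete (RapidLaurent p) where
  exists_lim x hx := by
    have hc : ∀ ik : ι × ℕ, ∀ ε > 0, ∃ N, ∀ m ≥ N, ∀ n ≥ N,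
        RapidLaurent.seminorm p ik (x m - x n) < ε := by
      intro ik ε hε
      have h1 : Tendsto (fun a => RapidLaurent.seminorm p ik a) (𝓝 0) (𝓝 0) := by
        have h0 := (tendsto_iff (sumNorm p)).1 (tendsto_id (x := 𝓝 (0 : RapidLaurent p))) ik
        simp only [id, sub_zero] at h0
        exact squeeze_zero (fun _ => apply_nonneg _ _) (fun a => seminorm_le_sumNorm ik a) h0
      exact hx _ (h1 (Iio_mem_nhds hε))
    have hle : ∀ (i : ι) (k : ℕ) (a : RapidLaurent p) (n : ℤ),
        (1 + |(n : ℝ)|) ^ k * p i (a.coeff n) ≤ RapidLaurent.seminorm p (i, k) a :=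
      fun i k a n => le_ciSup (bddAbove_weight a i k) n
    have hlim : ∀ n : ℤ, ∃ a, Tendsto (fun m => (x m).coeff n) atTop (𝓝 a) := by
      intro n
      refine SeqComplete.exists_lim _ fun U hU => ?_
      have h1 : Tendsto (fun a : RapidLaurent p => a.coeff n) (𝓝 0) (𝓝 0) :=
        (RapidLaurent.continuous_coeff n).tendsto 0
      obtain ⟨N, hN⟩ := hx _ (h1 hU)
      exact ⟨N, fun m hm l hl => by simpa [sub_eq_add_neg] using hN m hm l hl⟩
    choose a ha using hlim
    have hbound : ∀ (i : ι) (k N : ℕ) (C : ℝ),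
        (∀ m ≥ N, ∀ l ≥ N, RapidLaurent.seminorm p (i, k) (x m - x l) ≤ C) → ∀ m ≥ N, ∀ n : ℤ,
          (1 + |(n : ℝ)|) ^ k * p i ((x m).coeff n - a n) ≤ C := by
      intro i k N C h m hm n
      have h1 : Tendsto (fun l => (1 + |(n : ℝ)|) ^ k * p i ((x m).coeff n - (x l).coeff n)) atTop
          (𝓝 ((1 + |(n : ℝ)|) ^ k * p i ((x m).coeff n - a n))) :=
        (((continuous_seminorm p i).tendsto _).comp ((ha n).const_sub _)).const_mul _
      refine le_of_tendsto h1 (eventually_atTop.2 ⟨N, fun l hl => ?_⟩)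
      refine le_trans ?_ (h m hm l hl)
      simpa [sub_eq_add_neg] using hle i k (x m - x l) n
    have hrapid : ∀ (i : ι) (k : ℕ), ∃ C : ℝ, ∀ n : ℤ, (1 + |(n : ℝ)|) ^ k * p i (a n) ≤ C := by
      intro i k
      obtain ⟨N, hN⟩ := hc (i, k) 1 one_pos
      obtain ⟨C, hC⟩ := (x N).rapid i k
      refine ⟨1 + C, fun n => ?_⟩
      have h1 := hbound i k N 1 (fun m hm l hl => (hN m hm l hl).le) N le_rfl n
      have h2 : p i (a n) ≤ p i ((x N).coeff n - a n) + p i ((x N).coeff n) := by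
        have := map_sub_le_add (p i) ((x N).coeff n) ((x N).coeff n - a n)
        rw [sub_sub_cancel] at this
        linarith
      calc (1 + |(n : ℝ)|) ^ k * p i (a n)
          ≤ (1 + |(n : ℝ)|) ^ k * (p i ((x N).coeff n - a n) + p i ((x N).coeff n)) := by gcongr
        _ ≤ _ := by rw [mul_add]; exact add_le_add h1 (hC n)
    refine ⟨⟨a, hrapid⟩, ?_⟩
    rw [tendsto_iff (sumNorm p)]
    rintro ⟨i, k⟩
    set S := ∑' n : ℤ, ((1 + |(n : ℝ)|) ^ 2)⁻¹ with hS
    have hS0 : 0 ≤ S := tsum_nonneg fun n => by positivity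
    -- Convergence is needed for the weighted sum of order `k`; it follows from that of the supremum
    -- of order `k + 2`.
    have h0 : Tendsto (fun m => RapidLaurent.seminorm p (i, k + 2)
        (x m - ⟨a, hrapid⟩)) atTop (𝓝 0) := by
      rw [Metric.tendsto_atTop]
      intro ε hε
      obtain ⟨N, hN⟩ := hc (i, k + 2) (ε / 2) (by positivity)
      refine ⟨N, fun m hm => ?_⟩
      rw [Real.dist_0_eq_abs, abs_of_nonneg (apply_nonneg _ _)]
      refine lt_of_le_of_lt (ciSup_le fun n => ?_) (half_lt_self hε)
      simpa [sub_eq_add_neg] using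
        hbound i (k + 2) N _ (fun m hm l hl => (hN m hm l hl).le) m hm n
    refine squeeze_zero (fun _ => apply_nonneg _ _) (fun m => sumNorm_le_seminorm i k _) ?_
    simpa using h0.const_mul S

end LaurentInstances

/-! ### Matrices with bounded row and column sums, and the ideal of summable matrices -/

section BddMat

variable {A : Type u} [CommRing A] {ι : Type v}

/-- The absolute row sums of the matrix are bounded, for each seminorm. -/
def RowBdd (p : ι → AddGroupSeminorm A) (X : Matrix ℤ ℤ A) : Prop :=
  ∀ i, ∃ C : ℝ≥0∞, C ≠ ⊤ ∧ ∀ n, ∑' m, en p i (X n m) ≤ C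

/-- The sum of the absolute values of the entries of the matrix is finite, for each seminorm. -/
def TraceClass (p : ι → AddGroupSeminorm A) (X : Matrix ℤ ℤ A) : Prop :=
  ∀ i, ∑' n, ∑' m, en p i (X n m) ≠ ⊤

/-- The `ℤ × ℤ` matrices with bounded absolute row and column sums. -/
@[ext]
structure BddMat (p : ι → AddGroupSeminorm A) where
  /-- the matrix of entries -/
  toMat : Matrix ℤ ℤ A
  row : RowBdd p toMat
  col : RowBdd p toMat.transpose

variable {p : ι → AddGroupSeminorm A}

theorem RowBdd.add {X Y : Matrix ℤ ℤ A} (hX : RowBdd p X) (hY : RowBdd p Y) : RowBdd p (X + Y) := by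
  intro i
  obtain ⟨C, hC, h1⟩ := hX i
  obtain ⟨D, hD, h2⟩ := hY i
  refine ⟨C + D, ENNReal.add_ne_top.2 ⟨hC, hD⟩, fun n => ?_⟩
  refine (ENNReal.tsum_le_tsum fun m => en_add_le p i _ _).trans ?_
  rw [ENNReal.tsum_add]
  exact add_le_add (h1 n) (h2 n)

theorem RowBdd.neg {X : Matrix ℤ ℤ A} (hX : RowBdd p X) : RowBdd p (-X) := by
  intro i
  obtain ⟨C, hC, h1⟩ := hX i
  exact ⟨C, hC, fun n => by simpa using h1 n⟩

theorem rowBdd_one : RowBdd p (1 : Matrix ℤ ℤ A) := by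
  intro i
  refine ⟨en p i 1, en_ne_top _ _ _, fun n => ?_⟩
  rw [tsum_eq_single n (fun m hm => by simp [Matrix.one_apply_ne hm.symm])]
  simp

theorem TraceClass.rowBdd {X : Matrix ℤ ℤ A} (hX : TraceClass p X) : RowBdd p X :=
  fun i => ⟨_, hX i, fun n => ENNReal.le_tsum (f := fun n => ∑' m, en p i (X n m)) n⟩

theorem TraceClass.transpose {X : Matrix ℤ ℤ A} (hX : TraceClass p X) :
    TraceClass p X.transpose := by
  intro i
  have := hX i
  rw [ENNReal.tsum_comm] at this
  exact this

theorem TraceClass.add {X Y : Matrix ℤ ℤ A} (hX : TraceClass p X) (hY : TraceClass p Y) :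
    TraceClass p (X + Y) := by
  intro i
  have h : ∑' n, ∑' m, en p i ((X + Y) n m) ≤
      ∑' n, ∑' m, en p i (X n m) + ∑' n, ∑' m, en p i (Y n m) := by
    simp only [← ENNReal.tsum_add]
    exact ENNReal.tsum_le_tsum fun n => ENNReal.tsum_le_tsum fun m => en_add_le p i _ _
  exact ne_top_of_le_ne_top (ENNReal.add_ne_top.2 ⟨hX i, hY i⟩) h

theorem TraceClass.neg {X : Matrix ℤ ℤ A} (hX : TraceClass p X) : TraceClass p (-X) := by
  intro i
  simpa using hX i

theorem traceClass_zero : TraceClass p (0 : Matrix ℤ ℤ A) := by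
  intro i
  simp

/-- A matrix with absolutely summable entries has bounded row and column sums. -/
def TraceClass.toBddMat {X : Matrix ℤ ℤ A} (hX : TraceClass p X) : BddMat p :=
  ⟨X, hX.rowBdd, hX.transpose.rowBdd⟩

variable [TopologicalSpace A] [StrongPolymetric p]

/-- The product of infinite matrices. -/
def mmul (X Y : Matrix ℤ ℤ A) : Matrix ℤ ℤ A := fun n m => ∑' l, X n l * Y l m

theorem mmul_transpose (X Y : Matrix ℤ ℤ A) :
    (mmul X Y).transpose = mmul Y.transpose X.transpose := by
  ext n m
  exact tsum_congr fun l => mul_comm _ _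

theorem tsum_en_mmul_le {i j : ι} (hj : ∀ x y, en p i (x * y) ≤ en p j x * en p j y)
    {Y : Matrix ℤ ℤ A} {C : ℝ≥0∞} (hC : ∀ n, ∑' m, en p j (Y n m) ≤ C) (X : Matrix ℤ ℤ A) (n : ℤ) :
    ∑' m, ∑' l, en p i (X n l * Y l m) ≤ (∑' l, en p j (X n l)) * C := by
  rw [ENNReal.tsum_comm, ← ENNReal.tsum_mul_right]
  refine ENNReal.tsum_le_tsum fun l => ?_
  calc ∑' m, en p i (X n l * Y l m) ≤ ∑' m, en p j (X n l) * en p j (Y l m) :=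
        ENNReal.tsum_le_tsum fun m => hj _ _
    _ = en p j (X n l) * ∑' m, en p j (Y l m) := ENNReal.tsum_mul_left
    _ ≤ _ := by gcongr; exact hC l

theorem RowBdd.mmul {X Y : Matrix ℤ ℤ A} (hX : RowBdd p X) (hY : RowBdd p Y) :
    RowBdd p (mmul X Y) := by
  intro i
  obtain ⟨j, hj, -⟩ := exists_en_mul_le p i
  obtain ⟨C, hC, h1⟩ := hX j
  obtain ⟨D, hD, h2⟩ := hY j
  refine ⟨C * D, ENNReal.mul_ne_top hC hD, fun n => ?_⟩
  calc ∑' m, en p i (Polymetric.mmul X Y n m) ≤ ∑' m, ∑' l, en p i (X n l * Y l m) :=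
        ENNReal.tsum_le_tsum fun m => en_tsum_le p i _
    _ ≤ (∑' l, en p j (X n l)) * D := tsum_en_mmul_le hj h2 X n
    _ ≤ _ := by gcongr; exact h1 n

/-- The sum over `l` stays outside the seminorm, so that the left side also dominates all partial
products; this is used in `tendsto_det1_truncate_mul`. -/
theorem tsum_tsum_en_mmul_le {i j : ι} (hj : ∀ x y, en p i (x * y) ≤ en p j x * en p j y)
    {Y : Matrix ℤ ℤ A} {C : ℝ≥0∞} (hC : ∀ n, ∑' m, en p j (Y n m) ≤ C) (X : Matrix ℤ ℤ A) :
    ∑' n, ∑' m, ∑' l, en p i (X n l * Y l m) ≤ (∑' n, ∑' m, en p j (X n m)) * C := by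
  rw [← ENNReal.tsum_mul_right]
  exact ENNReal.tsum_le_tsum fun n => tsum_en_mmul_le hj hC X n

theorem TraceClass.mmul_right {X Y : Matrix ℤ ℤ A} (hX : TraceClass p X) (hY : RowBdd p Y) :
    TraceClass p (mmul X Y) := by
  intro i
  obtain ⟨j, hj, -⟩ := exists_en_mul_le p i
  obtain ⟨D, hD, h2⟩ := hY j
  refine ne_top_of_le_ne_top (ENNReal.mul_ne_top (hX j) hD) ?_
  refine le_trans ?_ (tsum_tsum_en_mmul_le hj h2 X)
  exact ENNReal.tsum_le_tsum fun n => ENNReal.tsum_le_tsum fun m => en_tsum_le p i _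

theorem TraceClass.mmul_left {X Y : Matrix ℤ ℤ A} (hX : RowBdd p X.transpose)
    (hY : TraceClass p Y) : TraceClass p (mmul X Y) := by
  have h := (hY.transpose.mmul_right hX).transpose
  rwa [← mmul_transpose] at h

variable [SeqComplete A]

theorem RowBdd.summable {X Y : Matrix ℤ ℤ A} (hX : RowBdd p X) (hY : RowBdd p Y) (n m : ℤ) :
    Summable fun l => X n l * Y l m := by
  refine summable_of_en p fun i => ?_
  obtain ⟨j, hj, -⟩ := exists_en_mul_le p i
  obtain ⟨C, hC, h1⟩ := hX j
  obtain ⟨D, hD, h2⟩ := hY j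
  refine ne_top_of_le_ne_top (ENNReal.mul_ne_top hC hD) ?_
  refine le_trans ?_ ((tsum_en_mmul_le hj h2 X n).trans (by gcongr; exact h1 n))
  exact ENNReal.le_tsum (f := fun m => ∑' l, en p i (X n l * Y l m)) m

variable [IsTopologicalRing A] [T2Space A]

/-- Both sides are iterated sums of one absolutely summable double family: bounded row sums of `X`
and `Y` together with bounded entries of `Z` suffice. -/
theorem mmul_assoc {X Y Z : Matrix ℤ ℤ A} (hX : RowBdd p X) (hY : RowBdd p Y) (hZ : RowBdd p Z) :
    mmul (mmul X Y) Z = mmul X (mmul Y Z) := by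
  ext n m
  have hs : Summable fun lk : ℤ × ℤ => X n lk.1 * Y lk.1 lk.2 * Z lk.2 m := by
    refine summable_of_en p fun i => ?_
    obtain ⟨j, -, hj⟩ := exists_en_mul_le p i
    obtain ⟨C, hC, h1⟩ := hX j
    obtain ⟨D, hD, h2⟩ := hY j
    obtain ⟨F, hF, h3⟩ := hZ j
    refine ne_top_of_le_ne_top (ENNReal.mul_ne_top (ENNReal.mul_ne_top hC hD) hF) ?_
    rw [ENNReal.tsum_prod (f := fun l k => en p i (X n l * Y l k * Z k m))]
    calc ∑' l, ∑' k, en p i (X n l * Y l k * Z k m)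
        ≤ ∑' l, ∑' k, en p j (X n l) * en p j (Y l k) * F := by
          refine ENNReal.tsum_le_tsum fun l => ENNReal.tsum_le_tsum fun k => (hj _ _ _).trans ?_
          gcongr
          exact (ENNReal.le_tsum (f := fun m => en p j (Z k m)) m).trans (h3 k)
      _ = (∑' l, en p j (X n l) * ∑' k, en p j (Y l k)) * F := by
          simp only [ENNReal.tsum_mul_right, ENNReal.tsum_mul_left]
      _ ≤ (∑' l, en p j (X n l) * D) * F := by gcongr with l; exact h2 l
      _ ≤ C * D * F := by rw [ENNReal.tsum_mul_right]; gcongr; exact h1 n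
  have h1 : HasSum (fun l => X n l * mmul Y Z l m)
      (∑' lk : ℤ × ℤ, X n lk.1 * Y lk.1 lk.2 * Z lk.2 m) := by
    refine hs.hasSum.prod_fiberwise fun l => ?_
    simp only [mul_assoc]
    exact (hY.summable hZ l m).hasSum.mul_left _
  have h2 : HasSum (fun k => mmul X Y n k * Z k m)
      (∑' lk : ℤ × ℤ, X n lk.1 * Y lk.1 lk.2 * Z lk.2 m) := by
    refine (((Equiv.prodComm ℤ ℤ).hasSum_iff).2 hs.hasSum).prod_fiberwise fun k => ?_
    exact (hX.summable hY n k).hasSum.mul_right _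
  exact h2.tsum_eq.trans h1.tsum_eq.symm

namespace BddMat

instance : Zero (BddMat p) := ⟨traceClass_zero.toBddMat⟩
instance : One (BddMat p) := ⟨1, rowBdd_one, by rw [Matrix.transpose_one]; exact rowBdd_one⟩
instance : Add (BddMat p) := ⟨fun X Y => ⟨X.toMat + Y.toMat, X.row.add Y.row, X.col.add Y.col⟩⟩
instance : Neg (BddMat p) := ⟨fun X => ⟨-X.toMat, X.row.neg, X.col.neg⟩⟩
instance : Mul (BddMat p) := ⟨fun X Y => ⟨mmul X.toMat Y.toMat, X.row.mmul Y.row, by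
  rw [mmul_transpose]; exact Y.col.mmul X.col⟩⟩

@[simp] theorem toMat_zero : (0 : BddMat p).toMat = 0 := rfl
@[simp] theorem toMat_one : (1 : BddMat p).toMat = 1 := rfl
@[simp] theorem toMat_add (X Y : BddMat p) : (X + Y).toMat = X.toMat + Y.toMat := rfl
theorem mul_apply (X Y : BddMat p) (n m : ℤ) :
    (X * Y).toMat n m = ∑' l, X.toMat n l * Y.toMat l m := rfl

theorem hasSum_mul (X Y : BddMat p) (n m : ℤ) :
    HasSum (fun l => X.toMat n l * Y.toMat l m) ((X * Y).toMat n m) :=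
  (X.row.summable Y.row n m).hasSum

instance : AddCommGroup (BddMat p) where
  add_assoc a b c := BddMat.ext (add_assoc _ _ _)
  zero_add a := BddMat.ext (zero_add _)
  add_zero a := BddMat.ext (add_zero _)
  add_comm a b := BddMat.ext (add_comm _ _)
  neg_add_cancel a := BddMat.ext (neg_add_cancel _)
  nsmul := nsmulRec
  zsmul := zsmulRec

instance : Ring (BddMat p) where
  __ := (inferInstance : AddCommGroup (BddMat p))
  mul_assoc X Y Z := BddMat.ext (mmul_assoc X.row Y.row Z.row)
  one_mul X := BddMat.ext <| by
    ext n m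
    rw [mul_apply, tsum_eq_single n (fun l hl => by simp [Matrix.one_apply_ne hl.symm])]
    simp
  mul_one X := BddMat.ext <| by
    ext n m
    rw [mul_apply, tsum_eq_single m (fun l hl => by simp [Matrix.one_apply_ne hl])]
    simp
  left_distrib X Y Z := BddMat.ext <| by
    ext n m
    refine (hasSum_mul X (Y + Z) n m).unique ?_
    simpa [mul_add] using (hasSum_mul X Y n m).add (hasSum_mul X Z n m)
  right_distrib X Y Z := BddMat.ext <| by
    ext n m
    refine (hasSum_mul (X + Y) Z n m).unique ?_
    simpa [add_mul] using (hasSum_mul X Z n m).add (hasSum_mul Y Z n m)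
  zero_mul X := BddMat.ext <| by
    ext n m
    simp [mul_apply]
  mul_zero X := BddMat.ext <| by
    ext n m
    simp [mul_apply]

@[simp] theorem toMat_sub (X Y : BddMat p) : (X - Y).toMat = X.toMat - Y.toMat := by
  rw [sub_eq_add_neg, sub_eq_add_neg]; rfl

/-- The two-sided ideal of the matrices with absolutely summable entries. -/
def IsTr (X : BddMat p) : Prop := TraceClass p X.toMat

theorem IsTr.add {X Y : BddMat p} (hX : X.IsTr) (hY : Y.IsTr) : (X + Y).IsTr :=
  TraceClass.add hX hY
theorem IsTr.neg {X : BddMat p} (hX : X.IsTr) : (-X).IsTr := TraceClass.neg hX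
theorem IsTr.sub {X Y : BddMat p} (hX : X.IsTr) (hY : Y.IsTr) : (X - Y).IsTr := by
  rw [sub_eq_add_neg]; exact hX.add hY.neg
theorem IsTr.mul_right {X : BddMat p} (hX : X.IsTr) (Y : BddMat p) : (X * Y).IsTr :=
  TraceClass.mmul_right hX Y.row
theorem IsTr.mul_left {Y : BddMat p} (hY : Y.IsTr) (X : BddMat p) : (X * Y).IsTr :=
  TraceClass.mmul_left X.col hY

end BddMat

end BddMat

/-! ### Finite permutations and their graphs -/

section FinitePerm

/-- The pairs `(σ, T)` such that `σ` is the identity outside of `T`. -/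
def FinitePerm.Supports (x : FinitePerm × Finset ℤ) : Prop := ∀ n ∉ x.2, x.1.1 n = n

/-- The graph of a permutation over a finite set. -/
def FinitePerm.graph (x : FinitePerm × Finset ℤ) : Finset (ℤ × ℤ) :=
  x.2.map ⟨fun n => (n, x.1.1 n), fun _ _ h => (Prod.mk.inj h).1⟩

theorem FinitePerm.mem_graph {x : FinitePerm × Finset ℤ} {e : ℤ × ℤ} :
    e ∈ FinitePerm.graph x ↔ e.1 ∈ x.2 ∧ x.1.1 e.1 = e.2 := by
  simp only [FinitePerm.graph, Finset.mem_map]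
  constructor
  · rintro ⟨n, hn, rfl⟩
    exact ⟨hn, rfl⟩
  · rintro ⟨h1, h2⟩
    exact ⟨e.1, h1, Prod.ext rfl h2⟩

/-- The graph determines `T` by projection and `σ` on `T`; outside of `T` the permutation is the
identity. -/
theorem FinitePerm.graph_injOn {x y : FinitePerm × Finset ℤ} (hx : FinitePerm.Supports x)
    (hy : FinitePerm.Supports y) (h : FinitePerm.graph x = FinitePerm.graph y) : x = y := by
  have h2 : x.2 = y.2 := by
    ext n
    constructor
    · intro hn
      have : (n, x.1.1 n) ∈ FinitePerm.graph x := FinitePerm.mem_graph.2 ⟨hn, rfl⟩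
      rw [h] at this
      exact (FinitePerm.mem_graph.1 this).1
    · intro hn
      have : (n, y.1.1 n) ∈ FinitePerm.graph y := FinitePerm.mem_graph.2 ⟨hn, rfl⟩
      rw [← h] at this
      exact (FinitePerm.mem_graph.1 this).1
  refine Prod.ext (Subtype.ext (Equiv.ext fun n => ?_)) h2
  by_cases hn : n ∈ x.2
  · have : (n, x.1.1 n) ∈ FinitePerm.graph x := FinitePerm.mem_graph.2 ⟨hn, rfl⟩
    rw [h] at this
    exact (FinitePerm.mem_graph.1 this).2.symm
  · rw [hx n hn, hy n (h2 ▸ hn)]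

instance : Countable FinitePerm := by
  refine Function.Injective.countable
    (f := fun σ : FinitePerm => FinitePerm.graph (σ, σ.2.toFinset)) fun σ τ h => ?_
  have hs : ∀ σ : FinitePerm, FinitePerm.Supports (σ, σ.2.toFinset) := fun σ n hn => by
    by_contra h'
    exact hn (by simpa using h')
  exact (Prod.mk.inj (FinitePerm.graph_injOn (hs σ) (hs τ) h)).1

/-- The extension of a permutation of a finite set of integers by the identity. -/
def FinitePerm.ofFinset (s : Finset ℤ) (τ : Equiv.Perm s) : FinitePerm :=
  ⟨Equiv.Perm.ofSubtype τ, s.finite_toSet.subset fun n hn => by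
    by_contra h
    exact hn (Equiv.Perm.ofSubtype_apply_of_not_mem τ h)⟩

theorem FinitePerm.ofFinset_injective (s : Finset ℤ) :
    Function.Injective (FinitePerm.ofFinset s) := fun _ _ h =>
  Equiv.Perm.ofSubtype_injective (congrArg Subtype.val h)

theorem FinitePerm.sign_ofFinset (s : Finset ℤ) (τ : Equiv.Perm s) :
    FinitePerm.sign (FinitePerm.ofFinset s τ) = Equiv.Perm.sign τ := by
  classical
  let : Fintype {n // (FinitePerm.ofFinset s τ).1 n ≠ n} := (FinitePerm.ofFinset s τ).2.fintype
  have hm : ∀ n, (FinitePerm.ofFinset s τ).1 n ≠ n → n ∈ s := fun n hn => by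
    by_contra h
    exact hn (Equiv.Perm.ofSubtype_apply_of_not_mem τ h)
  have hv : ∀ n (h : n ∈ s), (FinitePerm.ofFinset s τ).1 n = τ ⟨n, h⟩ := fun n h =>
    Equiv.Perm.ofSubtype_apply_of_mem τ h
  refine Equiv.Perm.sign_bij (fun x _ => ⟨x.1, hm x.1 x.2⟩) ?_ ?_ ?_
  · intro x hx hx'
    exact Subtype.ext (hv x.1 (hm x.1 x.2))
  · intro x y _ _ h
    exact Subtype.ext (Subtype.mk.inj h)
  · intro y hy
    have h1 : (FinitePerm.ofFinset s τ).1 y.1 ≠ y.1 := by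
      rw [hv y.1 y.2]
      exact fun h => hy (Subtype.ext h)
    refine ⟨⟨y.1, h1⟩, fun h => h1 ?_, rfl⟩
    exact congrArg Subtype.val h

theorem FinitePerm.exists_ofFinset {s : Finset ℤ} {σ : FinitePerm} (h : ∀ n ∉ s, σ.1 n = n) :
    ∃ τ, FinitePerm.ofFinset s τ = σ := by
  have hs : ∀ n, σ.1 n ∈ s ↔ n ∈ s := fun n => by
    constructor
    · intro h1
      by_contra h2
      rw [h n h2] at h1
      exact h2 h1
    · intro h1
      by_contra h2
      have h3 := σ.1.injective (h _ h2)
      rw [h3] at h2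
      exact h2 h1
  refine ⟨σ.1.subtypePerm hs, Subtype.ext ?_⟩
  exact Equiv.Perm.ofSubtype_subtypePerm hs fun n hn => by
    by_contra h2
    exact hn (h n h2)

@[simp] theorem FinitePerm.sign_one (h : {n | (1 : Equiv.Perm ℤ) n ≠ n}.Finite) :
    FinitePerm.sign ⟨1, h⟩ = 1 := by
  have e : (⟨1, h⟩ : FinitePerm) = FinitePerm.ofFinset ∅ 1 := Subtype.ext (by
    simp [FinitePerm.ofFinset])
  rw [e, FinitePerm.sign_ofFinset, map_one]

end FinitePerm

/-! ### The exponential bound for determinant expansions -/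

section FinsetProducts

/-- Finitely many subsets lie in the power set of one finite set, where the sum of products is `∏ (1
+ k b) ≤ exp (∑ k b)`. -/
theorem tsum_finset_prod_le {β : Type*} {k : β → ℝ≥0∞} (hk : ∑' b, k b ≠ ⊤) :
    ∑' S : Finset β, ∏ b ∈ S, k b ≤ ENNReal.ofReal (Real.exp (∑' b, k b).toReal) := by
  classical
  rw [ENNReal.tsum_eq_iSup_sum]
  refine iSup_le fun T => ?_
  have hkb : ∀ b, k b = ENNReal.ofReal (k b).toReal := fun b =>
    (ENNReal.ofReal_toReal (ENNReal.ne_top_of_tsum_ne_top hk b)).symm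
  calc ∑ S ∈ T, ∏ b ∈ S, k b ≤ ∑ S ∈ (T.biUnion id).powerset, ∏ b ∈ S, k b :=
        Finset.sum_le_sum_of_subset (fun s hs => Finset.mem_powerset.mpr
          (Finset.subset_biUnion_of_mem id hs))
    _ = ∏ b ∈ T.biUnion id, (1 + k b) := (Finset.prod_one_add _).symm
    _ = ENNReal.ofReal (∏ b ∈ T.biUnion id, (1 + (k b).toReal)) := by
        rw [ENNReal.ofReal_prod_of_nonneg (fun b _ => by positivity)]
        refine Finset.prod_congr rfl fun b _ => ?_
        rw [ENNReal.ofReal_add zero_le_one ENNReal.toReal_nonneg, ENNReal.ofReal_one, ← hkb]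
    _ ≤ ENNReal.ofReal (Real.exp (∑ b ∈ T.biUnion id, (k b).toReal)) :=
        ENNReal.ofReal_le_ofReal (Real.prod_one_add_le_exp_sum _ fun b => ENNReal.toReal_nonneg)
    _ ≤ _ := by
        refine ENNReal.ofReal_le_ofReal (Real.exp_le_exp.2 ?_)
        rw [← ENNReal.toReal_sum fun b _ => ENNReal.ne_top_of_tsum_ne_top hk b]
        exact ENNReal.toReal_mono hk (ENNReal.sum_le_tsum _)

open scoped Classical in
/-- The absolute values of the terms of the determinant for a matrix of absolute values. -/
def detBound (k : ℤ → ℤ → ℝ≥0∞) (x : FinitePerm × Finset ℤ) : ℝ≥0∞ :=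
  if FinitePerm.Supports x ∧ x.2.Nonempty then ∏ n ∈ x.2, k n (x.1.1 n) else 0

theorem detBound_mono {k l : ℤ → ℤ → ℝ≥0∞} (h : ∀ n m, k n m ≤ l n m)
    (x : FinitePerm × Finset ℤ) : detBound k x ≤ detBound l x := by
  unfold detBound
  split_ifs
  · exact Finset.prod_le_prod' fun n _ => h _ _
  · exact le_rfl

/-- By injectivity of the graph, the terms form part of the sum over all finite subsets of `ℤ × ℤ`.
Permutations may thus be forgotten, and no Hadamard-type estimate is needed. -/
theorem one_add_tsum_detBound_le {k : ℤ → ℤ → ℝ≥0∞} (hk : ∑' n, ∑' m, k n m ≠ ⊤) :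
    1 + ∑' x, detBound k x ≤ ENNReal.ofReal (Real.exp (∑' n, ∑' m, k n m).toReal) := by
  classical
  rw [← ENNReal.tsum_prod] at hk ⊢
  refine le_trans ?_ (tsum_finset_prod_le hk)
  -- The summand `1` on the left is the contribution of the empty set, which `detBound` omits.
  rw [ENNReal.tsum_eq_add_tsum_ite (∅ : Finset (ℤ × ℤ)), Finset.prod_empty]
  refine add_le_add le_rfl ?_
  have h1 : ∑' x, detBound k x = ∑' x : {x // FinitePerm.Supports x}, detBound k x.1 := by
    refine (tsum_subtype_eq_of_support_subset (s := {x | FinitePerm.Supports x}) ?_).symm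
    intro x hx
    by_contra h
    exact hx (if_neg fun h' => h h'.1)
  rw [h1]
  refine le_trans (ENNReal.tsum_le_tsum fun x => ?_)
    (ENNReal.tsum_comp_le_tsum_of_injective
      (f := fun x : {x // FinitePerm.Supports x} => FinitePerm.graph x.1)
      (fun x y h => Subtype.ext (FinitePerm.graph_injOn x.2 y.2 h))
      _)
  have hg : FinitePerm.graph x.1 = ∅ ↔ x.1.2 = ∅ := by simp [FinitePerm.graph]
  unfold detBound
  by_cases h : x.1.2 = ∅
  · rw [if_neg]
    · simp
    · simp [h]
  · rw [if_pos ⟨x.2, Finset.nonempty_iff_ne_empty.2 h⟩, if_neg (hg.not.2 h)]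
    rw [FinitePerm.graph, Finset.prod_map]
    exact le_rfl

theorem tsum_detBound_ne_top {k : ℤ → ℤ → ℝ≥0∞} (hk : ∑' n, ∑' m, k n m ≠ ⊤) :
    ∑' x, detBound k x ≠ ⊤ :=
  ne_top_of_le_ne_top ENNReal.ofReal_ne_top (le_add_self.trans (one_add_tsum_detBound_le hk))

end FinsetProducts

/-! ### Determinants of summable perturbations of the identity -/

section Det

variable {A : Type u} [CommRing A]

open scoped Classical in
/-- The terms of the expansion of `det (1 + K)` into principal minors of `K`. -/
def detTerm (K : Matrix ℤ ℤ A) (x : FinitePerm × Finset ℤ) : A :=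
  if FinitePerm.Supports x then
    (((FinitePerm.sign x.1 : ℤˣ) : ℤ) : A) * ∏ n ∈ x.2, K n (x.1.1 n) else 0

variable [TopologicalSpace A]

/-- The determinant of `1 + K`, as the sum of the principal minors of `K`. -/
def det1 (K : Matrix ℤ ℤ A) : A := ∑' x, detTerm K x

variable {ι : Type v} {p : ι → AddGroupSeminorm A}

theorem en_sign_mul (i : ι) (ε : ℤˣ) (x : A) : en p i (((ε : ℤ) : A) * x) = en p i x := by
  rcases Int.units_eq_one_or ε with rfl | rfl <;> simp

open scoped Classical in
theorem detTerm_zero (x : FinitePerm × Finset ℤ) :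
    detTerm (0 : Matrix ℤ ℤ A) x = if x = (⟨1, by simp⟩, ∅) then 1 else 0 := by
  split_ifs with h
  · subst h
    simp [detTerm, FinitePerm.Supports]
  · rw [detTerm]
    split_ifs with h1
    · rcases x.2.eq_empty_or_nonempty with h2 | ⟨n, hn⟩
      · refine absurd (Prod.ext (Subtype.ext (Equiv.ext fun n => ?_)) h2) h
        exact h1 n (by simp [h2])
      · rw [Finset.prod_eq_zero hn (by simp), mul_zero]
    · rfl

open scoped Classical in
theorem hasSum_detTerm_zero : HasSum (detTerm (0 : Matrix ℤ ℤ A)) 1 := by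
  have h := hasSum_ite_eq ((⟨1, by simp⟩, ∅) : FinitePerm × Finset ℤ) (1 : A)
  refine h.congr_fun fun x => ?_
  rw [detTerm_zero]

theorem det1_zero [T2Space A] : det1 (0 : Matrix ℤ ℤ A) = 1 := hasSum_detTerm_zero.tsum_eq

variable [StrongPolymetric p]

theorem exists_en_finset_prod_le (i : ι) : ∃ j, ∀ {β : Type} (s : Finset β) (f : β → A),
    s.Nonempty → en p i (∏ b ∈ s, f b) ≤ ∏ b ∈ s, en p j (f b) := by
  obtain ⟨j, hj⟩ := exists_en_prod_le p i
  refine ⟨j, fun s f hs => ?_⟩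
  have h := hj (s.toList.map f) (by simpa using hs.ne_empty)
  rwa [List.map_map, Finset.prod_map_toList, Finset.prod_map_toList] at h

/-- Seminorm domination holds only for nonempty products, as `p i 1` need not be at most `1`.
Subtracting the expansion for `K = 0` removes exactly the term with `T = ∅`. -/
theorem exists_en_detTerm_sub_le (i : ι) : ∃ j, ∀ (K : Matrix ℤ ℤ A) x,
    en p i (detTerm K x - detTerm 0 x) ≤ detBound (fun n m => en p j (K n m)) x := by
  obtain ⟨j, hj⟩ := exists_en_finset_prod_le (p := p) i
  refine ⟨j, fun K x => ?_⟩
  unfold detTerm detBound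
  by_cases h : FinitePerm.Supports x
  · rcases x.2.eq_empty_or_nonempty with h2 | h2
    · simp [h2]
    · rw [if_pos h, if_pos h, if_pos ⟨h, h2⟩]
      obtain ⟨n, hn⟩ := h2
      rw [Finset.prod_eq_zero (f := fun n => (0 : Matrix ℤ ℤ A) n (x.1.1 n)) hn (by simp), mul_zero,
        sub_zero, en_sign_mul]
      exact hj x.2 _ ⟨n, hn⟩
  · simp [h]

variable [SeqComplete A] [IsTopologicalRing A] [T2Space A]

theorem TraceClass.summable_detTerm_sub {K : Matrix ℤ ℤ A} (hK : TraceClass p K) :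
    Summable fun x => detTerm K x - detTerm 0 x := by
  refine summable_of_en p fun i => ?_
  obtain ⟨j, hj⟩ := exists_en_detTerm_sub_le (p := p) i
  exact ne_top_of_le_ne_top (tsum_detBound_ne_top (hK j)) (ENNReal.tsum_le_tsum fun x => hj K x)

theorem TraceClass.summable_detTerm {K : Matrix ℤ ℤ A} (hK : TraceClass p K) :
    Summable (detTerm K) := by
  have h := hK.summable_detTerm_sub.add (hasSum_detTerm_zero (A := A)).summable
  simpa using h

theorem TraceClass.hasSum_det1 {K : Matrix ℤ ℤ A} (hK : TraceClass p K) :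
    HasSum (detTerm K) (det1 K) := hK.summable_detTerm.hasSum

/-- With the `1` kept on the left, the bound tends to `0` together with the sum of the entries; this
gives the continuity of the projections. -/
theorem exists_en_det1_sub_one_le (i : ι) : ∃ j, ∀ K : Matrix ℤ ℤ A, TraceClass p K →
    1 + en p i (det1 K - 1) ≤
      ENNReal.ofReal (Real.exp (∑' n, ∑' m, en p j (K n m)).toReal) := by
  obtain ⟨j, hj⟩ := exists_en_detTerm_sub_le (p := p) i
  refine ⟨j, fun K hK => le_trans ?_ (one_add_tsum_detBound_le (hK j))⟩
  gcongr
  refine (en_le_of_hasSum p i (hK.hasSum_det1.sub hasSum_detTerm_zero)).trans ?_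
  exact ENNReal.tsum_le_tsum fun x => hj K x

/-- Each term of the expansion is a finite product and converges with the entries; the family
`detBound (B j)` is a summable majorant independent of `a`. -/
theorem tendsto_det1 {α : Type*} {l : Filter α} {Kf : α → Matrix ℤ ℤ A} {K : Matrix ℤ ℤ A}
    (B : ι → ℤ → ℤ → ℝ≥0∞) (hB : ∀ i, ∑' n, ∑' m, B i n m ≠ ⊤)
    (hb : ∀ i a n m, en p i (Kf a n m) ≤ B i n m) (hK : ∀ i n m, en p i (K n m) ≤ B i n m)
    (ht : ∀ n m, Tendsto (fun a => Kf a n m) l (𝓝 (K n m))) :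
    Tendsto (fun a => det1 (Kf a)) l (𝓝 (det1 K)) := by
  have tr : ∀ L : Matrix ℤ ℤ A, (∀ i n m, en p i (L n m) ≤ B i n m) → TraceClass p L :=
    fun L hL i => ne_top_of_le_ne_top (hB i)
      (ENNReal.tsum_le_tsum fun n => ENNReal.tsum_le_tsum fun m => hL i n m)
  have trK := tr K hK
  have trf : ∀ a, TraceClass p (Kf a) := fun a => tr _ fun i => hb i a
  rw [tendsto_iff p]
  intro i
  obtain ⟨j, hj⟩ := exists_en_detTerm_sub_le (p := p) i
  have hle : ∀ L : Matrix ℤ ℤ A, (∀ i n m, en p i (L n m) ≤ B i n m) → ∀ x,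
      p i (detTerm L x - detTerm 0 x) ≤ (detBound (B j) x).toReal := by
    intro L hL x
    rw [← toReal_en p]
    refine ENNReal.toReal_mono (ENNReal.ne_top_of_tsum_ne_top (tsum_detBound_ne_top (hB j)) x) ?_
    exact (hj L x).trans (detBound_mono (hL j) x)
  have hle2 : ∀ a x, p i (detTerm (Kf a) x - detTerm K x) ≤ 2 * (detBound (B j) x).toReal := by
    intro a x
    have h1 := hle (Kf a) (fun i => hb i a) x
    have h2 := hle K hK x
    have h3 := map_sub_le_add (p i) (detTerm (Kf a) x - detTerm 0 x) (detTerm K x - detTerm 0 x)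
    rw [sub_sub_sub_cancel_right] at h3
    linarith
  have hs : Summable fun x => 2 * (detBound (B j) x).toReal :=
    (ENNReal.summable_toReal (tsum_detBound_ne_top (hB j))).mul_left 2
  have key : Tendsto (fun a => ∑' x, p i (detTerm (Kf a) x - detTerm K x)) l
      (𝓝 (∑' _ : FinitePerm × Finset ℤ, (0 : ℝ))) := by
    refine tendsto_tsum_of_dominated_convergence hs (fun x => ?_)
      (Eventually.of_forall fun a x => ?_)
    · refine (tendsto_iff p).1 ?_ i
      unfold detTerm
      split_ifs
      · exact (tendsto_finsetProd _ fun n _ => ht _ _).const_mul _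
      · exact tendsto_const_nhds
    · rw [Real.norm_of_nonneg (apply_nonneg _ _)]
      exact hle2 a x
  rw [tsum_zero] at key
  refine squeeze_zero (fun _ => apply_nonneg _ _) (fun a => ?_) key
  have h := en_le_of_hasSum p i ((trf a).hasSum_det1.sub trK.hasSum_det1)
  have hsa : Summable fun x => p i (detTerm (Kf a) x - detTerm K x) :=
    Summable.of_nonneg_of_le (fun _ => apply_nonneg _ _) (hle2 a) hs
  rw [← toReal_en p]
  refine (ENNReal.toReal_mono ?_ h).trans (le_of_eq ?_)
  · exact hsa.tsum_ofReal_ne_top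
  · rw [ENNReal.tsum_toReal_eq fun _ => en_ne_top _ _ _]
    simp only [toReal_en]

theorem TraceClass.hasSum_detTerm_finset {K : Matrix ℤ ℤ A} (hK : TraceClass p K)
    (σ : FinitePerm) : Summable fun T => detTerm K (σ, T) := by
  have hinj : Function.Injective fun T : Finset ℤ => (σ, T) := fun _ _ h => (Prod.mk.inj h).2
  have h1 : Summable fun T => detTerm K (σ, T) - detTerm 0 (σ, T) := by
    refine summable_of_en p fun i => ?_
    obtain ⟨j, hj⟩ := exists_en_detTerm_sub_le (p := p) i
    refine ne_top_of_le_ne_top (tsum_detBound_ne_top (hK j)) ?_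
    refine (ENNReal.tsum_le_tsum fun T => hj K (σ, T)).trans ?_
    exact ENNReal.tsum_comp_le_tsum_of_injective hinj _
  have h2 : Summable fun T => detTerm (0 : Matrix ℤ ℤ A) (σ, T) := by
    refine summable_of_hasFiniteSupport ((Set.finite_singleton ∅).subset fun T hT => ?_)
    by_contra h
    refine hT ?_
    change detTerm 0 (σ, T) = 0
    rw [detTerm_zero, if_neg fun h' => h (Prod.mk.inj h').2]
  simpa using h1.add h2

/-- Expanding `∏ (1 + K)` over a finite set `s` gives a sum over `T ⊆ s`. The identity factors
vanish unless `σ` fixes `s \ T`, so for large `s` only the sets supporting `σ` survive. -/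
theorem TraceClass.hasProd {K : Matrix ℤ ℤ A} (hK : TraceClass p K) (σ : FinitePerm) :
    HasProd (fun n => (1 + K) n (σ.1 n))
      ((((FinitePerm.sign σ : ℤˣ) : ℤ) : A) * ∑' T, detTerm K (σ, T)) := by
  classical
  have h := (hK.hasSum_detTerm_finset σ).hasSum.mul_left (((FinitePerm.sign σ : ℤˣ) : ℤ) : A)
  rw [HasProd, SummationFilter.unconditional_filter]
  rw [HasSum, SummationFilter.unconditional_filter] at h
  refine (h.comp tendsto_finset_powerset_atTop_atTop).congr' ?_
  filter_upwards [eventually_ge_atTop σ.2.toFinset] with s hs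
  simp only [Function.comp, Matrix.add_apply]
  simp only [add_comm ((1 : Matrix ℤ ℤ A) _ _)]
  rw [Finset.prod_add]
  refine Finset.sum_congr rfl fun T hT => ?_
  have hfix : ∀ n ∉ s, σ.1 n = n := fun n hn => by
    by_contra h'
    exact hn (hs (by simpa using h'))
  unfold detTerm
  split_ifs with hsup
  -- The sign contained in `detTerm` cancels against the sign placed in front of the sum.
  · rw [← mul_assoc, ← Int.cast_mul, ← Units.val_mul, Int.units_mul_self, Units.val_one,
      Int.cast_one, one_mul]
    rw [Finset.prod_eq_one (s := s \ T), mul_one]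
    intro n hn
    have h1 : σ.1 n = n := hsup n (Finset.mem_sdiff.1 hn).2
    rw [h1, Matrix.one_apply_eq]
  · rw [mul_zero]
    simp only [FinitePerm.Supports, not_forall] at hsup
    obtain ⟨n, hn, hne⟩ := hsup
    rw [Finset.prod_eq_zero (s := s \ T) (i := n), mul_zero]
    · refine Finset.mem_sdiff.2 ⟨?_, hn⟩
      by_contra h'
      exact hne (hfix n h')
    · exact Matrix.one_apply_ne fun h' => hne h'.symm

theorem TraceClass.hasDet {K : Matrix ℤ ℤ A} (hK : TraceClass p K) : HasDet (1 + K) (det1 K) := by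
  refine ⟨fun σ => (hK.hasProd σ).multipliable, ?_⟩
  refine hK.hasSum_det1.prod_fiberwise fun σ => ?_
  rw [(hK.hasProd σ).tprod_eq, ← mul_assoc, ← Int.cast_mul, ← Units.val_mul, Int.units_mul_self,
    Units.val_one, Int.cast_one, one_mul]
  exact (hK.hasSum_detTerm_finset σ).hasSum

/-- The matrix obtained by replacing the entries outside of `s × s` by zero. -/
def truncate (s : Finset ℤ) (K : Matrix ℤ ℤ A) : Matrix ℤ ℤ A :=
  fun n m => if n ∈ s ∧ m ∈ s then K n m else 0

theorem traceClass_truncate (s : Finset ℤ) (K : Matrix ℤ ℤ A) : TraceClass p (truncate s K) := by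
  intro i
  have h : ∀ n, ∑' m, en p i (truncate s K n m) = ∑ m ∈ s, en p i (truncate s K n m) := fun n =>
    tsum_eq_sum fun m hm => by simp [truncate, hm]
  rw [tsum_congr h, tsum_eq_sum (s := s) fun n hn => by simp [truncate, hn]]
  simp [ENNReal.sum_eq_top, en_ne_top]

theorem det1_truncate (p : ι → AddGroupSeminorm A) [StrongPolymetric p] (s : Finset ℤ)
    (K : Matrix ℤ ℤ A) :
    det1 (truncate s K) = (1 + K.submatrix ((↑) : s → ℤ) (↑)).det := by
  have hd := (traceClass_truncate (p := p) s K).hasDet.2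
  refine hd.unique ?_
  have hz : ∀ σ ∉ Set.range (FinitePerm.ofFinset s),
      (((FinitePerm.sign σ : ℤˣ) : ℤ) : A) * ∏' n, (1 + truncate s K) n (σ.1 n) = 0 := by
    intro σ hσ
    have h1 : ∃ n, n ∉ s ∧ σ.1 n ≠ n := by
      by_contra h
      push Not at h
      exact hσ (FinitePerm.exists_ofFinset h)
    obtain ⟨n, hn, hne⟩ := h1
    rw [tprod_of_exists_eq_zero ⟨n, by simp [truncate, hn, Matrix.one_apply_ne hne.symm]⟩, mul_zero]
  -- In `Matrix.det_apply'` the permutation acts on the row index, in `HasDet` on the column index;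
  -- hence the transpose.
  rw [← (FinitePerm.ofFinset_injective s).hasSum_iff hz, ← Matrix.det_transpose,
    Matrix.det_apply']
  convert hasSum_fintype _ using 1
  refine Finset.sum_congr rfl fun τ _ => ?_
  simp only [Function.comp, FinitePerm.sign_ofFinset]
  congr 1
  rw [tprod_eq_prod (s := s), ← Finset.prod_coe_sort s]
  · refine Finset.prod_congr rfl fun x _ => ?_
    have h : (FinitePerm.ofFinset s τ).1 x = τ x := Equiv.Perm.ofSubtype_apply_coe τ x
    rw [h]
    simp [truncate, Matrix.one_apply]
  · intro n hn
    have h : (FinitePerm.ofFinset s τ).1 n = n := Equiv.Perm.ofSubtype_apply_of_not_mem τ hn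
    rw [h]
    simp [truncate, hn]

theorem tendsto_truncate (K : Matrix ℤ ℤ A) (n m : ℤ) :
    Tendsto (fun s => truncate s K n m) atTop (𝓝 (K n m)) := by
  refine tendsto_const_nhds.congr' ?_
  filter_upwards [eventually_ge_atTop {n, m}] with s hs
  simp [truncate, hs (show n ∈ ({n, m} : Finset ℤ) by simp),
    hs (show m ∈ ({n, m} : Finset ℤ) by simp)]

theorem en_truncate_le (s : Finset ℤ) (K : Matrix ℤ ℤ A) (i : ι) (n m : ℤ) :
    en p i (truncate s K n m) ≤ en p i (K n m) := by
  unfold truncate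
  split_ifs <;> simp

theorem TraceClass.tendsto_det1_truncate {K : Matrix ℤ ℤ A} (hK : TraceClass p K) :
    Tendsto (fun s => det1 (truncate s K)) atTop (𝓝 (det1 K)) :=
  tendsto_det1 (p := p) (fun i n m => en p i (K n m)) hK (fun i s n m => en_truncate_le s K i n m)
    (fun _ _ _ => le_rfl) (tendsto_truncate K)

/-- The product in which only the summation indices in `s` are taken into account. -/
def partialMul (s : Finset ℤ) (X Y : Matrix ℤ ℤ A) : Matrix ℤ ℤ A :=
  fun n m => ∑ l ∈ s, X n l * Y l m

theorem submatrix_partialMul (s : Finset ℤ) (X Y : Matrix ℤ ℤ A) :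
    (partialMul s X Y).submatrix ((↑) : s → ℤ) ((↑) : s → ℤ) =
      X.submatrix ((↑) : s → ℤ) ((↑) : s → ℤ) * Y.submatrix ((↑) : s → ℤ) ((↑) : s → ℤ) := by
  ext n m
  simp only [Matrix.submatrix_apply, Matrix.mul_apply, partialMul]
  exact (Finset.sum_coe_sort s fun l => X n l * Y l m).symm

/-- A corner of `XY` is not the product of the corners. Restricting the inner summation to `s` makes
it so, and the sums of absolute values of all products `X n l * Y l m` form a common majorant.
Finite determinant identities thereby pass to the limit. -/
theorem tendsto_det1_truncate_mul {X Y : Matrix ℤ ℤ A} (hX : TraceClass p X ∧ RowBdd p Y ∨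
    RowBdd p X ∧ RowBdd p X.transpose ∧ TraceClass p Y) (Z : Matrix ℤ ℤ A) (hZ : TraceClass p Z) :
    Tendsto (fun s : Finset ℤ => det1 (truncate s
      (Z + partialMul s X Y))) atTop
      (𝓝 (det1 (Z + mmul X Y))) := by
  have hB : ∀ i, ∑' n, ∑' m, ∑' l, en p i (X n l * Y l m) ≠ ⊤ := by
    intro i
    obtain ⟨j, hj, -⟩ := exists_en_mul_le p i
    rcases hX with ⟨h1, h2⟩ | ⟨-, h1, h2⟩
    · obtain ⟨D, hD, h3⟩ := h2 j
      exact ne_top_of_le_ne_top (ENNReal.mul_ne_top (h1 j) hD) (tsum_tsum_en_mmul_le hj h3 X)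
    · obtain ⟨D, hD, h3⟩ := h1 j
      rw [ENNReal.tsum_comm]
      have h4 := tsum_tsum_en_mmul_le hj h3 Y.transpose
      simp only [Matrix.transpose_apply] at h4
      simp only [mul_comm (X _ _)]
      exact ne_top_of_le_ne_top (ENNReal.mul_ne_top (h2.transpose j) hD) h4
  have hsum : ∀ n m, Summable fun l => X n l * Y l m := by
    rcases hX with ⟨h1, h2⟩ | ⟨h0, h1, h2⟩
    · exact fun n m => h1.rowBdd.summable h2 n m
    · exact fun n m => h0.summable h2.rowBdd n m
  refine tendsto_det1 (p := p) (fun i n m => en p i (Z n m) + ∑' l, en p i (X n l * Y l m))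
    (fun i => ?_) (fun i s n m => ?_) (fun i n m => ?_) (fun n m => ?_)
  · simp only [ENNReal.tsum_add]
    exact ENNReal.add_ne_top.2 ⟨hZ i, hB i⟩
  · refine (en_truncate_le s _ i n m).trans ((en_add_le p i _ _).trans ?_)
    gcongr
    exact (en_sum_le p i s _).trans (ENNReal.sum_le_tsum s)
  · refine (en_add_le p i _ _).trans ?_
    gcongr
    exact en_tsum_le p i _
  · have h1 : Tendsto (fun s : Finset ℤ => Z n m + ∑ l ∈ s, X n l * Y l m) atTop
        (𝓝 (Z n m + mmul X Y n m)) := by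
      have := (hsum n m).hasSum
      rw [HasSum, SummationFilter.unconditional_filter] at this
      exact this.const_add _
    refine h1.congr' ?_
    filter_upwards [eventually_ge_atTop {n, m}] with s hs
    simp [truncate, partialMul, hs (show n ∈ ({n, m} : Finset ℤ) by simp),
      hs (show m ∈ ({n, m} : Finset ℤ) by simp)]

namespace BddMat

/-- The determinant of the matrix `x`, if `x - 1` has absolutely summable entries. -/
def det (x : BddMat p) : A := det1 (x - 1).toMat

theorem hasDet {x : BddMat p} (hx : (x - 1).IsTr) : HasDet x.toMat x.det := by
  have h := TraceClass.hasDet hx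
  rwa [toMat_sub, toMat_one, add_sub_cancel, ← toMat_one (p := p), ← toMat_sub] at h

theorem det_one : (1 : BddMat p).det = 1 := by
  rw [det, sub_self]; exact det1_zero

/-- On each finite block this is Sylvester's identity `det (1 + xy) = det (1 + yx)`. Only one factor
has to be summable. -/
theorem det1_mul_comm {x : BddMat p} (hx : x.IsTr) (y : BddMat p) :
    det1 (x * y).toMat = det1 (y * x).toMat := by
  have h1 := tendsto_det1_truncate_mul (Or.inl ⟨hx, y.row⟩) 0 traceClass_zero
  have h2 := tendsto_det1_truncate_mul (Or.inr ⟨y.row, y.col, hx⟩) 0 traceClass_zero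
  simp only [zero_add] at h1 h2
  refine tendsto_nhds_unique h1 (h2.congr fun s => ?_)
  rw [det1_truncate p, det1_truncate p, submatrix_partialMul, submatrix_partialMul,
    Matrix.det_one_add_mul_comm]

/-- Multiplicativity in the form `1 + x + y + xy = (1 + x)(1 + y)`, valid on each finite block after
truncating the inner sum of `xy`. -/
theorem det1_add_add_mul {x y : BddMat p} (hx : x.IsTr) (hy : y.IsTr) :
    det1 (x + y + x * y).toMat = det1 x.toMat * det1 y.toMat := by
  have h1 := tendsto_det1_truncate_mul (Or.inl ⟨hx, y.row⟩) _ (hx.add hy)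
  have h2 := (TraceClass.tendsto_det1_truncate hx).mul (TraceClass.tendsto_det1_truncate hy)
  refine tendsto_nhds_unique h1 (h2.congr fun s => ?_)
  rw [det1_truncate p, det1_truncate p, det1_truncate p, ← Matrix.det_mul, toMat_add]
  have e := submatrix_partialMul s x.toMat y.toMat
  rw [Matrix.submatrix_add, Matrix.submatrix_add]
  simp only [Pi.add_apply]
  rw [e]
  congr 1
  noncomm_ring

theorem det_mul {x y : BddMat p} (hx : (x - 1).IsTr) (hy : (y - 1).IsTr) :
    (x * y).det = x.det * y.det := by
  rw [det, det, det, ← det1_add_add_mul hx hy]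
  congr 2
  noncomm_ring

theorem isTr_mul_sub_one {x y : BddMat p} (hx : (x - 1).IsTr) (hy : (y - 1).IsTr) :
    (x * y - 1).IsTr := by
  have e : x * y - 1 = (x - 1) * y + (y - 1) := by noncomm_ring
  rw [e]
  exact (hx.mul_right y).add hy

theorem isTr_conj {u v x : BddMat p} (huv : u * v = 1) (hx : (x - 1).IsTr) :
    (u * x * v - 1).IsTr := by
  have e : u * x * v - 1 = u * (x - 1) * v := by
    rw [mul_sub, mul_one, sub_mul, huv]
  rw [e]
  exact (hx.mul_left u).mul_right v

theorem det_conj {u v x : BddMat p} (huv : u * v = 1) (hvu : v * u = 1) (hx : (x - 1).IsTr) :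
    (u * x * v).det = x.det := by
  have e : u * x * v - 1 = u * (x - 1) * v := by
    rw [mul_sub, mul_one, sub_mul, huv]
  rw [det, det, e, det1_mul_comm (hx.mul_left u), ← mul_assoc, hvu, one_mul]

end BddMat

end Det

/-! ### The matrices `U(a)`, `F` and `V` -/

section Laurent

variable {A : Type u} [CommRing A] [TopologicalSpace A] [IsTopologicalRing A] [T2Space A]
  [SeqComplete A] {ι : Type v} {p : ι → AddGroupSeminorm A} [StrongPolymetric p]

namespace RapidLaurent

theorem coeff_monomial (k : ℤ) (x : A) (n : ℤ) :
    (monomial k x : RapidLaurent p).coeff n = if n = k then x else 0 := rfl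

@[simp] theorem coeff_sub (a b : RapidLaurent p) (n : ℤ) :
    (a - b).coeff n = a.coeff n - b.coeff n := by
  rw [sub_eq_add_neg, coeff_add, coeff_neg, sub_eq_add_neg]

theorem coeff_monomial_mul (k : ℤ) (x : A) (a : RapidLaurent p) (n : ℤ) :
    (monomial k x * a).coeff n = x * a.coeff (n - k) := by
  rw [coeff_mul, tsum_eq_single k]
  · rw [coeff_monomial, if_pos rfl]
  · intro m hm
    rw [coeff_monomial, if_neg hm, zero_mul]

theorem monomial_mul_monomial (k l : ℤ) (x y : A) :
    (monomial k x * monomial l y : RapidLaurent p) = monomial (k + l) (x * y) := by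
  ext n
  rw [coeff_monomial_mul, coeff_monomial, coeff_monomial]
  by_cases h : n = k + l
  · rw [if_pos h, if_pos (by omega)]
  · rw [if_neg h, if_neg (by omega), mul_zero]

variable (p) in
/-- The power `wᵏ` of the variable. -/
def wPow (k : ℤ) : RapidLaurent p := monomial k 1

theorem wPow_zero : wPow p 0 = 1 := rfl

theorem wPow_mul (k l : ℤ) : wPow p k * wPow p l = wPow p (k + l) := by
  rw [wPow, wPow, monomial_mul_monomial, mul_one]; rfl

theorem coeff_wPow_mul (k : ℤ) (a : RapidLaurent p) (n : ℤ) :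
    (wPow p k * a).coeff n = a.coeff (n - k) := by
  rw [wPow, coeff_monomial_mul, one_mul]

theorem coeff_const (x : A) (n : ℤ) :
    (const x : RapidLaurent p).coeff n = if n = 0 then x else 0 := rfl

theorem coeff_const_mul (x : A) (a : RapidLaurent p) (n : ℤ) :
    (const x * a).coeff n = x * a.coeff n := by
  rw [const, coeff_monomial_mul, sub_zero]

variable (p) in
/-- The inclusion of the constants. -/
def constHom : A →+* RapidLaurent p where
  toFun := const
  map_zero' := by ext n; simp [coeff_const]
  map_one' := rfl
  map_add' x y := by ext n; simp only [coeff_add, coeff_const]; split_ifs <;> simp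
  map_mul' x y := by
    rw [const, const, const, monomial_mul_monomial, add_zero]

@[simp] theorem constHom_apply (x : A) : constHom p x = const x := rfl

theorem en_sumNorm_const (i : ι) (k : ℕ) (x : A) :
    en (sumNorm p) (i, k) (const x) = en p i x := by
  rw [const, en_sumNorm_monomial, wt_zero_right, one_mul]

theorem seminormBounded_const : SeminormBounded p (sumNorm p) (constHom p) := by
  rintro ⟨i, k⟩
  exact ⟨i, 1, ENNReal.one_ne_top, fun x => by rw [constHom_apply, en_sumNorm_const, one_mul]⟩

theorem continuous_const' : Continuous (constHom p) :=
  SeminormBounded.continuous (f := (constHom p).toAddMonoidHom) seminormBounded_const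

theorem en_sumNorm_wPow_mul_le (i : ι) (k : ℕ) (n : ℤ) (a : RapidLaurent p) :
    en (sumNorm p) (i, k) (wPow p n * a) ≤ wt k n * en (sumNorm p) (i, k) a := by
  rw [en_sumNorm, en_sumNorm, ← ENNReal.tsum_mul_left]
  rw [← (Equiv.addRight n).tsum_eq]
  refine ENNReal.tsum_le_tsum fun m => ?_
  rw [coeff_wPow_mul, Equiv.coe_addRight, add_sub_cancel_right, ← mul_assoc]
  refine mul_le_mul' ?_ le_rfl
  rw [mul_comm]
  exact wt_add_le k m n

/-- The part of `w⁻ʳ a(w)` that consists of the powers `wʲ`, `ε j ≥ 0`. -/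
def tail (ε : ℤˣ) (a : RapidLaurent p) (r : ℤ) : RapidLaurent p where
  coeff j := if 0 ≤ ε * j then a.coeff (r + j) else 0
  rapid i k := by
    obtain ⟨C, hC⟩ := a.rapid i k
    refine ⟨(1 + |(r : ℝ)|) ^ k * C, fun j => ?_⟩
    have h1 : (1 + |(j : ℝ)|) ^ k * p i (if 0 ≤ ε * j then a.coeff (r + j) else 0) ≤
        (1 + |(j : ℝ)|) ^ k * p i (a.coeff (r + j)) := by
      gcongr
      split_ifs <;> simp
    refine h1.trans (le_trans ?_ (mul_le_mul_of_nonneg_left (hC (r + j)) (by positivity)))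
    rw [← mul_assoc, ← mul_pow]
    gcongr
    push_cast
    have h2 : |(j : ℝ)| ≤ |(r : ℝ)| + |(r : ℝ) + j| := by
      calc |(j : ℝ)| = |((r : ℝ) + j) - r| := by ring_nf
        _ ≤ |(r : ℝ) + j| + |(r : ℝ)| := abs_sub _ _
        _ = _ := add_comm _ _
    nlinarith [abs_nonneg (r : ℝ), abs_nonneg ((r : ℝ) + j)]

theorem coeff_tail (ε : ℤˣ) (a : RapidLaurent p) (r j : ℤ) :
    (tail ε a r).coeff j = if 0 ≤ ε * j then a.coeff (r + j) else 0 := rfl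

/-- Splitting off the constant term gives the recursion in `r` on which all the intertwining
relations below rest. -/
theorem tail_eq (ε : ℤˣ) (a : RapidLaurent p) (r : ℤ) :
    tail ε a r = const (a.coeff r) + wPow p ε * tail ε a (r + ε) := by
  ext j
  rw [coeff_add, coeff_wPow_mul, coeff_tail, coeff_tail, coeff_const]
  rcases Int.units_eq_one_or ε with rfl | rfl <;>
  simp only [Units.val_one, Units.val_neg, one_mul, neg_mul] <;>
  by_cases h : j = 0
  · subst h; simp
  · by_cases h2 : 0 ≤ j
    · rw [if_pos h2, if_neg h, if_pos (by omega), zero_add]; congr 1; omega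
    · rw [if_neg h2, if_neg h, if_neg (by omega), zero_add]
  · subst h; simp
  · by_cases h2 : 0 ≤ -j
    · rw [if_pos h2, if_neg h, if_pos (by omega), zero_add]; congr 1; omega
    · rw [if_neg h2, if_neg h, if_neg (by omega), zero_add]

/-- The weights that measure the decay of the matrices below. -/
def decay (n m : ℤ) : ℝ≥0∞ := (wt 2 n)⁻¹ * (wt 2 m)⁻¹

theorem inv_wt_le_decay {n m r : ℤ} (hn : n.natAbs ≤ r.natAbs) (hm : m.natAbs ≤ r.natAbs) :
    (wt 4 r)⁻¹ ≤ decay n m := by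
  rw [decay, ← ENNReal.mul_inv (Or.inl (wt_ne_zero _ _)) (Or.inl (wt_ne_top _ _)),
    ENNReal.inv_le_inv, show 4 = 2 + 2 from rfl, wt_add]
  exact mul_le_mul' (wt_mono_right 2 hn) (wt_mono_right 2 hm)

theorem en_const_coeff_le (i : ι) (k : ℕ) (a : RapidLaurent p) {n m r : ℤ}
    (hn : n.natAbs ≤ r.natAbs) (hm : m.natAbs ≤ r.natAbs) :
    en (sumNorm p) (i, k) (const (a.coeff r)) ≤ decay n m * en (sumNorm p) (i, k + 4) a := by
  rw [en_sumNorm_const]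
  refine (en_coeff_le i 4 a r).trans ?_
  exact mul_le_mul' (inv_wt_le_decay hn hm) (en_sumNorm_mono i (by omega) a)

/-- The sign condition on `r` gives `|r + j| = |r| + |j|` for every power occurring in the tail.
Four of the `k + 4` weights are then available for the decay in `n` and `m`. -/
theorem en_tail_le (i : ι) (k : ℕ) (ε : ℤˣ) (a : RapidLaurent p) {n m r : ℤ} (hr : 0 ≤ ε * r)
    (hn : n.natAbs ≤ r.natAbs) (hm : m.natAbs ≤ r.natAbs) :
    en (sumNorm p) (i, k) (tail ε a r) ≤ decay n m * en (sumNorm p) (i, k + 4) a := by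
  refine le_trans ?_ (mul_le_mul' (inv_wt_le_decay hn hm) le_rfl)
  rw [en_sumNorm, en_sumNorm, ← ENNReal.tsum_mul_left,
    ← (Equiv.addLeft r).tsum_eq (fun n => (wt 4 r)⁻¹ * (wt (k + 4) n * en p i (a.coeff n)))]
  refine ENNReal.tsum_le_tsum fun j => ?_
  rw [coeff_tail, Equiv.coe_addLeft]
  split_ifs with h
  · rw [← mul_assoc]
    refine mul_le_mul' ?_ le_rfl
    rw [mul_comm, ← div_eq_mul_inv, ENNReal.le_div_iff_mul_le (Or.inl (wt_ne_zero _ _))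
      (Or.inl (wt_ne_top _ _)), wt_add]
    have h2 : (r + j).natAbs = r.natAbs + j.natAbs := by
      rcases Int.units_eq_one_or ε with rfl | rfl <;>
      simp only [Units.val_one, Units.val_neg, one_mul, neg_mul] at h hr <;> omega
    change wt k j * wt 4 r ≤ wt k (r + j) * wt 4 (r + j)
    exact mul_le_mul' (wt_mono_right k (by omega)) (wt_mono_right 4 (by omega))
  · simp

theorem tsum_decay_ne_top : ∑' n, ∑' m, decay n m ≠ ⊤ := by
  simp only [decay, ENNReal.tsum_mul_left, ENNReal.tsum_mul_right]
  exact ENNReal.mul_ne_top tsum_inv_wt_ne_top tsum_inv_wt_ne_top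

theorem traceClass_of_decay {X : Matrix ℤ ℤ (RapidLaurent p)}
    (h : ∀ i k, ∃ C : ℝ≥0∞, C ≠ ⊤ ∧ ∀ n m, en (sumNorm p) (i, k) (X n m) ≤ decay n m * C) :
    TraceClass (sumNorm p) X := by
  rintro ⟨i, k⟩
  obtain ⟨C, hC, h1⟩ := h i k
  refine ne_top_of_le_ne_top (ENNReal.mul_ne_top tsum_decay_ne_top hC) ?_
  simp only [← ENNReal.tsum_mul_right]
  exact ENNReal.tsum_le_tsum fun n => ENNReal.tsum_le_tsum fun m => h1 n m

end RapidLaurent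

namespace BddMat

open RapidLaurent

/-- A matrix with at most one non-zero entry in each row and each column. -/
def perm (f : ℤ → ℤ) (c : ℤ → RapidLaurent p)
    (hc : ∀ ik, ∃ C : ℝ≥0∞, C ≠ ⊤ ∧ ∀ n, en (sumNorm p) ik (c n) ≤ C)
    (hf : ∀ n m, c n ≠ 0 → c m ≠ 0 → f n = f m → n = m) : BddMat (sumNorm p) where
  toMat n m := if m = f n then c n else 0
  row ik := by
    obtain ⟨C, hC, h⟩ := hc ik
    refine ⟨C, hC, fun n => ?_⟩
    rw [tsum_eq_single (f n) fun m hm => by simp [hm]]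
    simpa using h n
  col ik := by
    obtain ⟨C, hC, h⟩ := hc ik
    refine ⟨C, hC, fun m => ?_⟩
    change ∑' n, en (sumNorm p) ik (if m = f n then c n else 0) ≤ C
    by_cases h1 : ∃ n, m = f n ∧ c n ≠ 0
    · obtain ⟨n, hn, hcn⟩ := h1
      rw [tsum_eq_single n]
      · simpa [hn] using h n
      · intro l hl
        split_ifs with h2
        · by_cases h3 : c l = 0
          · simp [h3]
          · exact absurd (hf l n h3 hcn (h2.symm.trans hn)) hl
        · simp
    · push Not at h1
      rw [ENNReal.tsum_eq_zero.2]
      · exact zero_le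
      · intro n
        split_ifs with h2
        · simp [h1 n h2]
        · simp

theorem perm_apply {f : ℤ → ℤ} {c : ℤ → RapidLaurent p} {hc hf} (n m : ℤ) :
    (perm f c hc hf).toMat n m = if m = f n then c n else 0 := rfl

theorem perm_mul_apply {f : ℤ → ℤ} {c : ℤ → RapidLaurent p} {hc hf} (X : BddMat (sumNorm p))
    (n m : ℤ) : (perm f c hc hf * X).toMat n m = c n * X.toMat (f n) m := by
  rw [mul_apply, tsum_eq_single (f n)]
  · rw [perm_apply, if_pos rfl]
  · intro l hl
    rw [perm_apply, if_neg hl, zero_mul]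

theorem mul_perm_apply {f : ℤ → ℤ} {c : ℤ → RapidLaurent p} {hc hf} (X : BddMat (sumNorm p))
    (n : ℤ) {m l : ℤ} (hl : ∀ k, c k ≠ 0 → (m = f k ↔ k = l)) :
    (X * perm f c hc hf).toMat n m = X.toMat n l * c l := by
  rw [mul_apply, tsum_eq_single l]
  · rw [perm_apply]
    by_cases h : c l = 0
    · simp [h]
    · rw [if_pos ((hl l h).2 rfl)]
  · intro k hk
    rw [perm_apply]
    by_cases h : c k = 0
    · simp [h]
    · rw [if_neg fun h' => hk ((hl k h).1 h'), mul_zero]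

/-- The multiplication matrix `U(a)`. -/
def U (a : RapidLaurent p) : BddMat (sumNorm p) where
  toMat := matU a
  row := by
    rintro ⟨i, k⟩
    refine ⟨en (sumNorm p) (i, 0) a, en_ne_top _ _ _, fun n => ?_⟩
    rw [en_sumNorm, ← (Equiv.subLeft n).tsum_eq (fun n => wt 0 n * en p i (a.coeff n))]
    simp [matU, en_sumNorm_const]
  col := by
    rintro ⟨i, k⟩
    refine ⟨en (sumNorm p) (i, 0) a, en_ne_top _ _ _, fun n => ?_⟩
    rw [en_sumNorm, ← (Equiv.subRight n).tsum_eq (fun n => wt 0 n * en p i (a.coeff n))]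
    simp [matU, en_sumNorm_const]

theorem U_apply (a : RapidLaurent p) (n m : ℤ) : (U a).toMat n m = const (a.coeff (n - m)) := rfl

theorem tsum_en_U (a : RapidLaurent p) (i : ι) (k : ℕ) (n : ℤ) :
    ∑' m, en (sumNorm p) (i, k) ((U a).toMat n m) = en (sumNorm p) (i, 0) a := by
  rw [en_sumNorm, ← (Equiv.subLeft n).tsum_eq (fun n => wt 0 n * en p i (a.coeff n))]
  simp [U_apply, en_sumNorm_const]

theorem U_mul (a b : RapidLaurent p) : U (a * b) = U a * U b := by
  refine BddMat.ext ?_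
  ext1 n m
  have h := (hasSum_coeff_mul a b (n - m)).map (constHom p) continuous_const'
  rw [mul_apply, ← (Equiv.subLeft n).tsum_eq]
  refine (h.congr_fun fun l => ?_).tsum_eq.symm
  simp only [Function.comp, map_mul, constHom_apply, U_apply, Equiv.subLeft_apply, sub_sub_cancel]
  congr 3
  omega

theorem U_one : U (1 : RapidLaurent p) = 1 := by
  refine BddMat.ext ?_
  ext1 n m
  rw [U_apply, toMat_one, coeff_one, Matrix.one_apply]
  by_cases h : n = m
  · rw [if_pos h, if_pos (by omega)]; rfl
  · rw [if_neg h, if_neg (by omega)]; exact map_zero (constHom p)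

variable (p) in
/-- The matrix `w^ε ∑_{εn<0} e_{n,n+ε}`. -/
def S (ε : ℤˣ) : BddMat (sumNorm p) :=
  perm (fun n => n + ε) (fun n => if ε * n < 0 then wPow p ε else 0)
    (fun ik => ⟨en (sumNorm p) ik (wPow p ε), en_ne_top _ _ _, fun n => by split_ifs <;> simp⟩)
    (fun n m _ _ h => by simpa using h)

theorem S_mul_apply (ε : ℤˣ) (X : BddMat (sumNorm p)) (n m : ℤ) :
    (S p ε * X).toMat n m = if ε * n < 0 then wPow p ε * X.toMat (n + ε) m else 0 := by
  rw [S, perm_mul_apply]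
  split_ifs <;> simp

theorem mul_S_apply (ε : ℤˣ) (X : BddMat (sumNorm p)) (n m : ℤ) :
    (X * S p ε).toMat n m = if ε * (m - ε) < 0 then X.toMat n (m - ε) * wPow p ε else 0 := by
  rw [S, mul_perm_apply (l := m - ε) X n fun k _ => by omega]
  split_ifs <;> simp

variable (p) in
/-- The value at `t = 1` of the matrices `F⁺(t, w)` and `F⁻(t, w)`. -/
def F (ε : ℤˣ) : BddMat (sumNorm p) := 1 - S p ε

/-- The difference `Z` satisfies `Z = Z S`, so each entry is zero or `w^ε` times the entry `ε`
places before it in its row. Multiplication by `w^ε` does not increase the seminorms of weight `0`.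
A nonzero entry would thus force infinitely many entries of at least its size in one row, against
the bounded row sums. -/
theorem mul_F_cancel {ε : ℤˣ} {X Y : BddMat (sumNorm p)} (h : X * F p ε = Y * F p ε) : X = Y := by
  rw [← sub_eq_zero] at h ⊢
  rw [← sub_mul, F, mul_sub, mul_one, sub_eq_zero] at h
  set Z := X - Y
  have hle : ∀ (i : ι) (n m : ℤ), en (sumNorm p) (i, 0) (Z.toMat n m) ≤
      en (sumNorm p) (i, 0) (Z.toMat n (m - ε)) := by
    intro i n m
    conv_lhs => rw [h, mul_S_apply]
    split_ifs
    · rw [mul_comm]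
      simpa using en_sumNorm_wPow_mul_le i 0 ε (Z.toMat n (m - ε))
    · simp
  have hle2 : ∀ (i : ι) (n m : ℤ) (k : ℕ), en (sumNorm p) (i, 0) (Z.toMat n m) ≤
      en (sumNorm p) (i, 0) (Z.toMat n (m - k * ε)) := by
    intro i n m k
    induction k with
    | zero => simp
    | succ k ih =>
      refine ih.trans ((hle i n _).trans (le_of_eq ?_))
      congr 2
      push_cast
      ring
  have h0 : ∀ (i : ι) (n m : ℤ), en (sumNorm p) (i, 0) (Z.toMat n m) = 0 := by
    intro i n m
    by_contra hne
    obtain ⟨C, hC, h1⟩ := Z.row (i, 0)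
    refine hC (top_unique ?_)
    rw [← ENNReal.tsum_const_eq_top_of_ne_zero (α := ℕ) hne]
    refine (ENNReal.tsum_le_tsum fun k => hle2 i n m k).trans (le_trans ?_ (h1 n))
    refine ENNReal.tsum_comp_le_tsum_of_injective (f := fun k : ℕ => m - k * ε) (fun k l hkl => ?_)
      (fun m => en (sumNorm p) (i, 0) (Z.toMat n m))
    rcases Int.units_eq_one_or ε with rfl | rfl <;> simpa using hkl
  refine BddMat.ext ?_
  ext n m r
  refine eq_zero_of_en p fun i => le_antisymm ?_ zero_le
  have h1 := wt_mul_en_coeff_le i 0 (Z.toMat n m) r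
  rwa [h0, wt_zero_left, one_mul] at h1

/-- The entries of `U⁺(a, 1, w) - U(a)`, respectively `U⁻(a, 1, w) - U(a)`. -/
def matN (ε : ℤˣ) (a : RapidLaurent p) : Matrix ℤ ℤ (RapidLaurent p) := fun n m =>
  if 0 ≤ ε * n ∧ ε * m ≤ 0 then tail ε a (n - m) - const (a.coeff (n - m))
  else if ε * n < 0 ∧ 0 < ε * m then -(wPow p ε * const (a.coeff (n + ε - m))) else 0

/-- Nonzero entries occur only with `n` and `m` on opposite sides of `0`, possibly at `0`. There `n
- m`, or `n + ε - m` when both are nonzero, is at least as large in absolute value as `n` and `m`.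
The constant counts a tail, a coefficient, and a coefficient times `w^ε`. -/
theorem en_matN_le (ε : ℤˣ) (a : RapidLaurent p) (i : ι) (k : ℕ) (n m : ℤ) :
    en (sumNorm p) (i, k) (matN ε a n m) ≤
      decay n m * ((2 + wt k ε) * en (sumNorm p) (i, k + 4) a) := by
  have e : decay n m * ((2 + wt k ε) * en (sumNorm p) (i, k + 4) a) =
      (decay n m * en (sumNorm p) (i, k + 4) a + decay n m * en (sumNorm p) (i, k + 4) a) +
      wt k ε * (decay n m * en (sumNorm p) (i, k + 4) a) := by ring
  rw [e]
  unfold matN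
  split_ifs with h1 h2
  · refine le_trans ?_ le_self_add
    refine (en_sub_le _ _ _ _).trans (add_le_add ?_ ?_)
    · rcases Int.units_eq_one_or ε with rfl | rfl <;>
      simp only [Units.val_one, Units.val_neg, one_mul, neg_mul] at h1 <;>
      refine en_tail_le i k _ a ?_ ?_ ?_ <;>
      first | omega | (simp only [Units.val_one, Units.val_neg, one_mul, neg_mul]; omega)
    · rcases Int.units_eq_one_or ε with rfl | rfl <;>
      simp only [Units.val_one, Units.val_neg, one_mul, neg_mul] at h1 <;>
      refine en_const_coeff_le i k a ?_ ?_ <;> omega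
  · refine le_trans ?_ le_add_self
    rw [en_neg]
    refine (en_sumNorm_wPow_mul_le _ _ _ _).trans (mul_le_mul' le_rfl ?_)
    rcases Int.units_eq_one_or ε with rfl | rfl <;>
    simp only [Units.val_one, Units.val_neg, one_mul, neg_mul] at h2 ⊢ <;>
    refine en_const_coeff_le i k a ?_ ?_ <;> omega
  · simp

theorem matN_const_ne_top (ε : ℤˣ) (a : RapidLaurent p) (i : ι) (k : ℕ) :
    (2 + wt k ε) * en (sumNorm p) (i, k + 4) a ≠ ⊤ :=
  ENNReal.mul_ne_top (ENNReal.add_ne_top.2 ⟨ENNReal.ofNat_ne_top, wt_ne_top _ _⟩)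
    (en_ne_top _ _ _)

theorem traceClass_matN (ε : ℤˣ) (a : RapidLaurent p) : TraceClass (sumNorm p) (matN ε a) :=
  traceClass_of_decay fun i k => ⟨_, matN_const_ne_top ε a i k, en_matN_le ε a i k⟩

/-- The matrix `U⁺(a, 1, w) - U(a)`, respectively `U⁻(a, 1, w) - U(a)`. -/
def N (ε : ℤˣ) (a : RapidLaurent p) : BddMat (sumNorm p) := (traceClass_matN ε a).toBddMat

theorem N_apply (ε : ℤˣ) (a : RapidLaurent p) : (N ε a).toMat = matN ε a := rfl

theorem isTr_N (ε : ℤˣ) (a : RapidLaurent p) : (N ε a).IsTr := traceClass_matN ε a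

/-- The matrix `U⁺(a, 1, w)`, respectively `U⁻(a, 1, w)`. -/
def V (ε : ℤˣ) (a : RapidLaurent p) : BddMat (sumNorm p) := U a + N ε a

theorem V_apply (ε : ℤˣ) (a : RapidLaurent p) (n m : ℤ) : (V ε a).toMat n m =
    if 0 ≤ ε * n ∧ ε * m ≤ 0 then tail ε a (n - m)
    else if ε * n < 0 ∧ 0 < ε * m then
      const (a.coeff (n - m)) - wPow p ε * const (a.coeff (n + ε - m))
    else const (a.coeff (n - m)) := by
  rw [V, toMat_add, Matrix.add_apply, U_apply, N_apply, matN]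
  split_ifs <;> ring

/-- Entry by entry this is the recursion `tail_eq`. The identity replaces the definition of `V` as
`F U F⁻¹`, in which the last factor is unbounded. -/
theorem V_mul_F (ε : ℤˣ) (a : RapidLaurent p) : V ε a * F p ε = F p ε * U a := by
  have key : N ε a = V ε a * S p ε - S p ε * U a := by
    refine BddMat.ext ?_
    ext1 n m
    rw [toMat_sub, Matrix.sub_apply, mul_S_apply, S_mul_apply, V_apply, U_apply, N_apply, matN]
    have ht := tail_eq ε a (n - m)
    rcases Int.units_eq_one_or ε with rfl | rfl <;>
    simp only [Units.val_one, Units.val_neg, one_mul, neg_mul] at ht ⊢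
    · by_cases hm : m ≤ 0
      · rw [if_pos (show m - 1 < 0 by omega)]
        by_cases hn : 0 ≤ n
        · rw [if_pos ⟨hn, hm⟩, if_pos ⟨hn, by omega⟩, if_neg (by omega), ht,
            show n - (m - 1) = n - m + 1 by omega]
          ring
        · rw [if_neg (by omega), if_neg (by omega), if_neg (by omega), if_neg (by omega),
            if_pos (by omega), show n - (m - 1) = n + 1 - m by omega]
          ring
      · rw [if_neg (show ¬ m - 1 < 0 by omega), if_neg (by omega)]
        by_cases hn : n < 0
        · rw [if_pos (by omega), if_pos hn]; ring
        · rw [if_neg (by omega), if_neg hn]; ring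
    · by_cases hm : 0 ≤ m
      · rw [if_pos (show -(m - -1) < 0 by omega)]
        by_cases hn : n ≤ 0
        · rw [if_pos (by omega), if_pos (by omega), if_neg (by omega), ht,
            show n - (m - -1) = n - m + -1 by omega]
          ring
        · rw [if_neg (by omega), if_neg (by omega), if_neg (by omega), if_neg (by omega),
            if_pos (by omega), show n - (m - -1) = n + -1 - m by omega]
          ring
      · rw [if_neg (show ¬ -(m - -1) < 0 by omega), if_neg (by omega)]
        by_cases hn : -n < 0
        · rw [if_pos (by omega), if_pos hn]; ring
        · rw [if_neg (by omega), if_neg hn]; ring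
  have h : V ε a = U a + N ε a := rfl
  rw [F, mul_sub, sub_mul, mul_one, one_mul]
  nth_rw 1 [h]
  rw [key]
  abel

/-- Both sides satisfy `X F = F U(a) U(b)`, and `F` can be cancelled. -/
theorem V_mul (ε : ℤˣ) (a b : RapidLaurent p) : V ε (a * b) = V ε a * V ε b := by
  refine mul_F_cancel (ε := ε) ?_
  rw [V_mul_F, U_mul, mul_assoc, V_mul_F, ← mul_assoc, ← mul_assoc, V_mul_F]

theorem V_one (ε : ℤˣ) : V ε (1 : RapidLaurent p) = 1 := by
  refine mul_F_cancel (ε := ε) ?_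
  rw [V_mul_F, U_one, mul_one, one_mul]

end BddMat

end Laurent

/-! ### Determinant of a perturbation in a single row -/

section RowMatrix

variable {A : Type u} [CommRing A] [TopologicalSpace A] [T2Space A]

/-- Only `T = ∅` and `T = {0}` contribute, each with the identity permutation. -/
theorem det1_of_row {K : Matrix ℤ ℤ A} (hK : ∀ n m, n ≠ 0 → K n m = 0) : det1 K = 1 + K 0 0 := by
  classical
  have hne : ((⟨1, by simp⟩, ∅) : FinitePerm × Finset ℤ) ∉
      ({((⟨1, by simp⟩ : FinitePerm), {0})} : Finset (FinitePerm × Finset ℤ)) := by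
    simp
  have hs : HasSum (detTerm K) (∑ x ∈ insert ((⟨1, by simp⟩, ∅) : FinitePerm × Finset ℤ)
      {((⟨1, by simp⟩ : FinitePerm), {0})}, detTerm K x) := by
    refine hasSum_sum_of_ne_finset_zero fun x hx => ?_
    rw [detTerm]
    split_ifs with h
    · by_cases hT : x.2 ⊆ {0}
      · have h1 : x.1.1 = 1 := by
          have h2 : ∀ n, n ≠ 0 → x.1.1 n = n := fun n hn =>
            h n fun h' => hn (Finset.mem_singleton.1 (hT h'))
          refine Equiv.ext fun n => ?_
          by_cases hn : n = 0
          · subst hn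
            by_contra h3
            exact h3 (x.1.1.injective (h2 _ h3))
          · exact h2 n hn
        have h4 : x.1 = ⟨1, by simp⟩ := Subtype.ext h1
        refine absurd ?_ hx
        rcases Finset.subset_singleton_iff.1 hT with h5 | h5
        · exact Finset.mem_insert.2 (Or.inl (Prod.ext h4 h5))
        · exact Finset.mem_insert.2 (Or.inr (Finset.mem_singleton.2 (Prod.ext h4 h5)))
      · obtain ⟨n, hn, hn0⟩ := Finset.not_subset.1 hT
        rw [Finset.prod_eq_zero (f := fun n => K n (x.1.1 n)) hn (hK n _ (by simpa using hn0)),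
          mul_zero]
    · rfl
  rw [det1, hs.tsum_eq, Finset.sum_insert hne, Finset.sum_singleton]
  simp [detTerm, FinitePerm.Supports]

end RowMatrix

/-! ### The homomorphisms `π⁺` and `π⁻` -/

section Factors

variable {A : Type u} [CommRing A] [TopologicalSpace A] [IsTopologicalRing A] [T2Space A]
  [SeqComplete A] {ι : Type v} {p : ι → AddGroupSeminorm A} [StrongPolymetric p]

namespace RapidLaurent

/-- The coefficients as additive homomorphisms. -/
def coeffHom (n : ℤ) : RapidLaurent p →+ A := ⟨⟨fun a => a.coeff n, rfl⟩, fun _ _ => rfl⟩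

variable (p) in
/-- The series `∑ x_j zʲ` with `x_j = 0` for `ε j ≤ 0`. -/
def positivePart (ε : ℤˣ) : NonUnitalSubring (RapidLaurent p) where
  carrier := {x | ∀ j : ℤ, ε * j ≤ 0 → x.coeff j = 0}
  zero_mem' _ _ := rfl
  add_mem' {x y} hx hy j hj := by rw [coeff_add, hx j hj, hy j hj, add_zero]
  neg_mem' {x} hx j hj := by rw [coeff_neg, hx j hj, neg_zero]
  mul_mem' {x y} hx hy j hj := by
    rw [coeff_mul]
    refine (tsum_congr fun m => ?_).trans tsum_zero
    by_cases hm : ε * m ≤ 0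
    · rw [hx m hm, zero_mul]
    · rw [hy (j - m) (by rw [mul_sub]; omega), mul_zero]

theorem hasSum_mem_positivePart {ε : ℤˣ} {β : Type*} {f : β → RapidLaurent p} {x : RapidLaurent p}
    (hf : HasSum f x) (h : ∀ b, f b ∈ positivePart p ε) : x ∈ positivePart p ε := by
  intro j hj
  have h1 := hf.map (coeffHom j) (continuous_coeff j)
  refine h1.unique ?_
  convert hasSum_zero with b
  exact h b j hj

theorem mul_const_mem_positivePart {ε : ℤˣ} {x : RapidLaurent p} (hx : x ∈ positivePart p ε)
    (y : A) : x * const y ∈ positivePart p ε := by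
  intro j hj
  rw [mul_comm, coeff_const_mul, hx j hj, mul_zero]

theorem prod_mem_positivePart {ε : ℤˣ} {β : Type*} (s : Finset β) {f : β → RapidLaurent p}
    (h : ∀ b ∈ s, f b ∈ positivePart p ε) (hs : s.Nonempty) : ∏ b ∈ s, f b ∈ positivePart p ε := by
  classical
  induction hs using Finset.Nonempty.cons_induction with
  | singleton b => simpa using h b (by simp)
  | cons b s hb hs ih =>
    rw [Finset.prod_cons]
    exact mul_mem (h b (by simp)) (ih fun c hc => h c (by simp [hc]))

end RapidLaurent

open RapidLaurent

/-- The series with only strictly positive (or only strictly negative) powers form a closed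
non-unital subring, and every term with `T ≠ ∅` is, up to sign, a nonempty product of entries. -/
theorem TraceClass.det1_sub_one_mem_positivePart {ε : ℤˣ} {K : Matrix ℤ ℤ (RapidLaurent p)}
    (hK : TraceClass (sumNorm p) K) (h : ∀ n m, K n m ∈ positivePart p ε) :
    det1 K - 1 ∈ positivePart p ε := by
  refine hasSum_mem_positivePart (hK.hasSum_det1.sub hasSum_detTerm_zero) fun x => ?_
  unfold detTerm
  split_ifs
  · rcases x.2.eq_empty_or_nonempty with h2 | h2
    · simp [h2]
    · have e : ∀ y : RapidLaurent p, y ∈ positivePart p ε →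
          (((FinitePerm.sign x.1 : ℤˣ) : ℤ) : RapidLaurent p) * y ∈ positivePart p ε := by
        intro y hy
        rcases Int.units_eq_one_or (FinitePerm.sign x.1) with h3 | h3 <;> rw [h3] <;> simpa using hy
      refine sub_mem (e _ (prod_mem_positivePart _ (fun n _ => h _ _) h2)) (e _ ?_)
      exact prod_mem_positivePart _ (fun n _ => by simp) h2
  · simp

namespace BddMat

theorem U_mul_U_inv (a : (RapidLaurent p)ˣ) :
    U (a : RapidLaurent p) * U ((a⁻¹ : (RapidLaurent p)ˣ) : RapidLaurent p) = 1 := by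
  rw [← U_mul, Units.mul_inv, U_one]

theorem U_inv_mul_U (a : (RapidLaurent p)ˣ) :
    U ((a⁻¹ : (RapidLaurent p)ˣ) : RapidLaurent p) * U (a : RapidLaurent p) = 1 := by
  rw [← U_mul, Units.inv_mul, U_one]

theorem V_mul_V_inv (ε : ℤˣ) (a : (RapidLaurent p)ˣ) :
    V ε (a : RapidLaurent p) * V ε ((a⁻¹ : (RapidLaurent p)ˣ) : RapidLaurent p) = 1 := by
  rw [← V_mul, Units.mul_inv, V_one]

theorem V_inv_mul_V (ε : ℤˣ) (a : (RapidLaurent p)ˣ) :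
    V ε ((a⁻¹ : (RapidLaurent p)ˣ) : RapidLaurent p) * V ε (a : RapidLaurent p) = 1 := by
  rw [← V_mul, Units.inv_mul, V_one]

theorem V_mul_U_inv_sub_one (ε : ℤˣ) (a : (RapidLaurent p)ˣ) :
    V ε (a : RapidLaurent p) * U ((a⁻¹ : (RapidLaurent p)ˣ) : RapidLaurent p) - 1 =
      N ε (a : RapidLaurent p) * U ((a⁻¹ : (RapidLaurent p)ˣ) : RapidLaurent p) := by
  rw [V, add_mul, U_mul_U_inv, add_sub_cancel_left]

theorem isTr_V_mul_U_inv (ε : ℤˣ) (a : (RapidLaurent p)ˣ) :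
    (V ε (a : RapidLaurent p) * U ((a⁻¹ : (RapidLaurent p)ˣ) : RapidLaurent p) - 1).IsTr := by
  rw [V_mul_U_inv_sub_one]
  exact (isTr_N ε _).mul_right _

/-- The determinants `π⁺(a, 1, w)` and `π⁻(a, 1, w)`. -/
def piPM (ε : ℤˣ) (a : (RapidLaurent p)ˣ) : RapidLaurent p :=
  (V ε (a : RapidLaurent p) * U ((a⁻¹ : (RapidLaurent p)ˣ) : RapidLaurent p)).det

theorem piPM_one (ε : ℤˣ) : piPM ε (1 : (RapidLaurent p)ˣ) = 1 := by
  rw [piPM, inv_one, Units.val_one, V_one, U_one, mul_one, det_one]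

/-- `V(ab) U(ab)⁻¹` is the conjugate of `V(b) U(b)⁻¹` by `V(a)`, multiplied by `V(a) U(a)⁻¹`. -/
theorem piPM_mul (ε : ℤˣ) (a b : (RapidLaurent p)ˣ) :
    piPM ε (a * b) = piPM ε a * piPM ε b := by
  have e : V ε ((a * b : (RapidLaurent p)ˣ) : RapidLaurent p) *
      U (((a * b)⁻¹ : (RapidLaurent p)ˣ) : RapidLaurent p) =
      (V ε (a : RapidLaurent p) *
        (V ε (b : RapidLaurent p) * U ((b⁻¹ : (RapidLaurent p)ˣ) : RapidLaurent p)) *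
        V ε ((a⁻¹ : (RapidLaurent p)ˣ) : RapidLaurent p)) *
      (V ε (a : RapidLaurent p) * U ((a⁻¹ : (RapidLaurent p)ˣ) : RapidLaurent p)) := by
    rw [mul_inv_rev, Units.val_mul, Units.val_mul, V_mul, U_mul]
    simp only [mul_assoc]
    rw [← mul_assoc (V ε ((a⁻¹ : (RapidLaurent p)ˣ) : RapidLaurent p)), V_inv_mul_V, one_mul]
  rw [piPM, e, det_mul (isTr_conj (V_mul_V_inv ε a) (isTr_V_mul_U_inv ε b))
    (isTr_V_mul_U_inv ε a), det_conj (V_mul_V_inv ε a) (V_inv_mul_V ε a) (isTr_V_mul_U_inv ε b),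
    mul_comm]
  rfl

/-- Subtracting `U(a)` removes just the constant term of the tail. -/
theorem matN_mem_positivePart (ε : ℤˣ) (a : RapidLaurent p) (n m : ℤ) :
    matN ε a n m ∈ positivePart p ε := by
  intro j hj
  unfold matN
  split_ifs
  · rw [coeff_sub, coeff_tail, coeff_const]
    by_cases h : j = 0
    · subst h; simp
    · have h2 : ¬ 0 ≤ ε * j := fun h3 => by
        have h4 : (ε : ℤ) * j = 0 := le_antisymm hj h3
        simp [h] at h4
      rw [if_neg h2, if_neg h, sub_zero]
  · rw [coeff_neg, coeff_wPow_mul, coeff_const, if_neg, neg_zero]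
    intro h
    have h2 : j = ε := by omega
    rw [h2] at hj
    rcases Int.units_eq_one_or ε with rfl | rfl <;> simp at hj
  · rfl

theorem piPM_sub_one_mem (ε : ℤˣ) (a : (RapidLaurent p)ˣ) :
    piPM ε a - 1 ∈ positivePart p ε := by
  refine TraceClass.det1_sub_one_mem_positivePart (isTr_V_mul_U_inv ε a) fun n m => ?_
  rw [V_mul_U_inv_sub_one]
  refine hasSum_mem_positivePart (hasSum_mul _ _ n m) fun l => ?_
  exact mul_const_mem_positivePart (matN_mem_positivePart ε _ n l) _

/-! ### The matrix `Ũ(a, w)` and the determinant `π̃` -/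

variable (p) in
/-- The matrix unit `e_{0,0}`. -/
def E : BddMat (sumNorm p) :=
  perm (fun n => n) (fun n => if n = 0 then 1 else 0)
    (fun ik => ⟨en (sumNorm p) ik 1, en_ne_top _ _ _, fun n => by split_ifs <;> simp⟩)
    (fun n m _ _ h => h)

theorem E_mul_apply (X : BddMat (sumNorm p)) (n m : ℤ) :
    (E p * X).toMat n m = if n = 0 then X.toMat n m else 0 := by
  rw [E, perm_mul_apply]
  split_ifs <;> simp

variable (p) in
/-- The matrix that removes the `0`-th row and column and closes the gap. -/
def P : BddMat (sumNorm p) :=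
  perm (fun n => if n < 0 then n else n - 1)
    (fun n => if n < 0 then 1 else if 0 < n then -wPow p (-1) else 0)
    (fun ik => ⟨en (sumNorm p) ik 1 + en (sumNorm p) ik (wPow p (-1)),
      ENNReal.add_ne_top.2 ⟨en_ne_top _ _ _, en_ne_top _ _ _⟩, fun n => by
        split_ifs <;> simp⟩)
    (fun n m hn hm h => by
      have hn' : n ≠ 0 := fun h' => hn (by simp [h'])
      have hm' : m ≠ 0 := fun h' => hm (by simp [h'])
      split_ifs at h <;> omega)

variable (p) in
/-- The inverse of the matrix `P` on the complement of the `0`-th row and column. -/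
def Q : BddMat (sumNorm p) :=
  perm (fun n => if n < 0 then n else n + 1)
    (fun n => if n < 0 then 1 else -wPow p 1)
    (fun ik => ⟨en (sumNorm p) ik 1 + en (sumNorm p) ik (wPow p 1),
      ENNReal.add_ne_top.2 ⟨en_ne_top _ _ _, en_ne_top _ _ _⟩, fun n => by
        split_ifs <;> simp⟩)
    (fun n m _ _ h => by
      split_ifs at h <;> omega)

/-- The index maps are inverse bijections between `ℤ` and `ℤ \ {0}`, and the factors cancel as
`(-w)(-w⁻¹) = 1`. -/
theorem Q_mul_P : Q p * P p = 1 := by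
  refine BddMat.ext ?_
  ext1 n m
  rw [Q, perm_mul_apply, P, perm_apply, toMat_one, Matrix.one_apply]
  by_cases hn : n < 0
  · simp [hn, eq_comm]
  · rw [if_neg hn, if_neg hn, if_neg (show ¬ n + 1 < 0 by omega),
      if_neg (show ¬ n + 1 < 0 by omega), if_pos (show 0 < n + 1 by omega)]
    by_cases h : n = m
    · rw [if_pos (by omega), if_pos h, neg_mul_neg, wPow_mul]; rfl
    · rw [if_neg (by omega), if_neg h, mul_zero]

theorem P_mul_Q : P p * Q p = 1 - E p := by
  refine BddMat.ext ?_
  ext1 n m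
  rw [P, perm_mul_apply, Q, perm_apply, toMat_sub, Matrix.sub_apply, toMat_one, Matrix.one_apply,
    E, perm_apply]
  rcases lt_trichotomy n 0 with hn | hn | hn
  · simp [hn, hn.ne, eq_comm]
  · subst hn; simp [eq_comm]
  · rw [if_neg (by omega), if_pos hn, if_neg (show ¬ n < 0 by omega),
      if_neg (show ¬ n - 1 < 0 by omega), if_neg (show ¬ n - 1 < 0 by omega), if_neg hn.ne']
    by_cases h : n = m
    · rw [if_pos (by omega), if_pos h, neg_mul_neg, wPow_mul, ite_self, sub_zero]; rfl
    · rw [if_neg (by omega), if_neg h, mul_zero, ite_self, sub_zero]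

theorem E_mul_P : E p * P p = 0 := by
  refine BddMat.ext ?_
  ext1 n m
  rw [E_mul_apply, P, perm_apply]
  by_cases hn : n = 0 <;> simp [hn]

theorem Q_mul_E : Q p * E p = 0 := by
  refine BddMat.ext ?_
  ext1 n m
  rw [Q, perm_mul_apply, E, perm_apply, toMat_zero, Matrix.zero_apply]
  by_cases hn : n < 0
  · simp [hn, hn.ne]
  · simp [hn, show n + 1 ≠ 0 by omega]

theorem E_mul_E : E p * E p = E p := by
  refine BddMat.ext ?_
  ext1 n m
  rw [E_mul_apply, E, perm_apply]
  by_cases hn : n = 0 <;> simp [hn]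

/-- The matrix `Ũ(a, w)`. -/
def UT (a : RapidLaurent p) : BddMat (sumNorm p) := P p * U a * Q p + E p

theorem UT_toMat (a : RapidLaurent p) : (UT a).toMat = matUTilde a := by
  ext1 n m
  have hPU : ∀ k, (P p * U a).toMat n k =
      (if n < 0 then 1 else if 0 < n then -wPow p (-1) else 0) *
        const (a.coeff ((if n < 0 then n else n - 1) - k)) := fun k => by
    rw [P, perm_mul_apply]; rfl
  rw [UT, toMat_add, Matrix.add_apply, Q]
  rcases eq_or_ne m 0 with hm | hm
  · subst hm
    rw [mul_apply, tsum_congr (g := fun _ => 0), tsum_zero, zero_add]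
    · rw [E, perm_apply, matUTilde, if_pos (Or.inr rfl)]
      by_cases hn : n = 0
      · simp [hn]
      · simp [hn]
    · intro l
      rw [perm_apply, if_neg, mul_zero]
      split_ifs <;> omega
  · rw [mul_perm_apply (l := if m < 0 then m else m - 1) _ n (fun k _ => by split_ifs <;> omega),
      hPU, E, perm_apply, matUTilde]
    rcases eq_or_ne n 0 with hn | hn
    · subst hn
      simp [hm, hm.symm]
    · rw [if_neg (show ¬ (n = 0 ∨ m = 0) by simp [hn, hm]), if_neg hn, ite_self, add_zero]
      rcases lt_or_gt_of_ne hn with hn | hn <;> rcases lt_or_gt_of_ne hm with hm | hm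
      · simp [hn, hm, hn.not_gt, hm.not_gt]
      · rw [if_pos hn, if_pos hn, if_neg (by omega), if_neg (by omega), if_pos ⟨hn, hm⟩, one_mul,
          show n - (m - 1) = n - m + 1 by ring]
        change _ = -(wPow p 1 * _)
        ring
      · rw [if_neg (by omega), if_pos hn, if_neg (by omega), if_pos hm, if_pos hm,
          if_neg (by omega), if_pos ⟨hn, hm⟩, mul_one, show n - 1 - m = n - m - 1 by ring]
        change _ = -(wPow p (-1) * _)
        ring
      · rw [if_neg (by omega), if_pos hn, if_neg (by omega), if_neg (by omega),
          if_neg (by omega), if_neg (by omega), if_neg (by omega),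
          show n - 1 - (m - 1) = n - m by ring]
        have h : wPow p (-1) * wPow p 1 = 1 := wPow_mul _ _
        linear_combination const (a.coeff (n - m)) * h

/-- The relations `QP = 1`, `QE = 0`, `EP = 0`, `E² = E` make `X ↦ P X Q + E` multiplicative. -/
theorem UT_mul (a b : RapidLaurent p) : UT (a * b) = UT a * UT b := by
  have e : UT a * UT b = P p * U a * (Q p * P p) * U b * Q p + P p * U a * (Q p * E p) +
      (E p * P p) * U b * Q p + E p * E p := by
    rw [UT, UT]; noncomm_ring
  rw [e, Q_mul_P, Q_mul_E, E_mul_P, E_mul_E, UT, U_mul]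
  noncomm_ring

theorem UT_one : UT (1 : RapidLaurent p) = 1 := by
  rw [UT, U_one, mul_one, P_mul_Q, sub_add_cancel]

theorem UT_mul_UT_inv (a : (RapidLaurent p)ˣ) :
    UT (a : RapidLaurent p) * UT ((a⁻¹ : (RapidLaurent p)ˣ) : RapidLaurent p) = 1 := by
  rw [← UT_mul, Units.mul_inv, UT_one]

theorem UT_inv_mul_UT (a : (RapidLaurent p)ˣ) :
    UT ((a⁻¹ : (RapidLaurent p)ˣ) : RapidLaurent p) * UT (a : RapidLaurent p) = 1 := by
  rw [← UT_mul, Units.inv_mul, UT_one]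

/-- The two matrices coincide where `n` and `m` have the same strict sign. Elsewhere one index is
`0` or the signs are opposite, and the coefficient indices dominate `|n|` and `|m|` even after the
shift by one that closes the gap. -/
theorem isTr_U_sub_UT (a : RapidLaurent p) : (U a - UT a).IsTr := by
  refine traceClass_of_decay fun i k => ?_
  set D := en (sumNorm p) (i, k + 4) a with hD
  refine ⟨en (sumNorm p) (i, k) 1 + (1 + wt k 1) * D, ENNReal.add_ne_top.2 ⟨en_ne_top _ _ _,
    ENNReal.mul_ne_top (ENNReal.add_ne_top.2 ⟨ENNReal.one_ne_top, wt_ne_top _ _⟩)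
      (en_ne_top _ _ _)⟩, fun n m => ?_⟩
  have e : decay n m * (en (sumNorm p) (i, k) 1 + (1 + wt k 1) * D) =
      decay n m * D + (decay n m * en (sumNorm p) (i, k) 1 + wt k 1 * (decay n m * D)) := by ring
  rw [e, toMat_sub, Matrix.sub_apply, UT_toMat, U_apply, matUTilde]
  have hw : ∀ (ε : ℤ) (r : ℤ), ε.natAbs = 1 → n.natAbs ≤ r.natAbs → m.natAbs ≤ r.natAbs →
      en (sumNorm p) (i, k) (-(wPow p ε * const (a.coeff r))) ≤ wt k 1 * (decay n m * D) := by
    intro ε r hε hn hm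
    rw [en_neg]
    refine (en_sumNorm_wPow_mul_le i k ε _).trans (mul_le_mul' (wt_mono_right k (by simp [hε])) ?_)
    exact en_const_coeff_le i k a hn hm
  split_ifs with h1 h2 h3 h4
  · subst h2
    refine (en_sub_le _ _ _ _).trans (add_le_add ?_ (le_trans ?_ le_self_add))
    · exact en_const_coeff_le i k a (by omega) (by omega)
    · simp [show n = 0 by omega, decay]
  · rw [sub_zero]
    exact (en_const_coeff_le i k a (by omega) (by omega)).trans le_self_add
  · refine (en_sub_le _ _ _ _).trans (add_le_add ?_ (le_trans ?_ le_add_self))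
    · exact en_const_coeff_le i k a (by omega) (by omega)
    · exact hw 1 _ rfl (by omega) (by omega)
  · refine (en_sub_le _ _ _ _).trans (add_le_add ?_ (le_trans ?_ le_add_self))
    · exact en_const_coeff_le i k a (by omega) (by omega)
    · exact hw (-1) _ rfl (by omega) (by omega)
  · simp

theorem isTr_U_mul_UT_inv (a : (RapidLaurent p)ˣ) :
    (U (a : RapidLaurent p) * UT ((a⁻¹ : (RapidLaurent p)ˣ) : RapidLaurent p) - 1).IsTr := by
  rw [← UT_mul_UT_inv a, ← sub_mul]
  exact (isTr_U_sub_UT _).mul_right _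

/-- The determinant `π̃(a, w)`. -/
def piTilde (a : (RapidLaurent p)ˣ) : RapidLaurent p :=
  (U (a : RapidLaurent p) * UT ((a⁻¹ : (RapidLaurent p)ˣ) : RapidLaurent p)).det

/-! ### Conjugation by `F⁻ F⁺` and the factorization of `a` -/

variable (p) in
/-- The matrix `w ∑ e_{n,n+1}`. -/
def Z : BddMat (sumNorm p) :=
  perm (fun n => n + 1) (fun _ => wPow p 1)
    (fun ik => ⟨en (sumNorm p) ik (wPow p 1), en_ne_top _ _ _, fun n => le_rfl⟩)
    (fun n m _ _ h => by simpa using h)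

theorem Z_mul_U (a : RapidLaurent p) : Z p * U a = U a * Z p := by
  refine BddMat.ext ?_
  ext1 n m
  rw [Z, perm_mul_apply, mul_perm_apply (l := m - 1) _ n (fun k _ => by omega), U_apply, U_apply,
    mul_comm]
  congr 3
  ring

/-- A row in the range of one shift does not cross `0`, and there the opposite shift has zero rows.
Hence `F⁻ F⁺` has no mixed term. -/
theorem S_mul_S_neg (ε : ℤˣ) : S p ε * S p (-ε) = 0 := by
  refine BddMat.ext ?_
  ext1 n m
  rw [S_mul_apply, S, perm_apply]
  rcases Int.units_eq_one_or ε with rfl | rfl <;>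
  simp only [Units.val_one, Units.val_neg, one_mul, neg_mul, neg_neg] <;>
  split_ifs <;> first | rfl | omega | simp

theorem F_mul_F : F p (-1) * F p 1 = 1 - S p (-1) - S p 1 := by
  have h : S p (-1) * S p 1 = 0 := by simpa using S_mul_S_neg (p := p) (-1)
  rw [F, F, sub_mul, mul_sub, one_mul, mul_sub, mul_one, h]
  simp
  abel

theorem E_mul_S (ε : ℤˣ) : E p * S p ε = 0 := by
  refine BddMat.ext ?_
  ext1 n m
  rw [E_mul_apply, S, perm_apply]
  by_cases hn : n = 0 <;> simp [hn]

theorem E_mul_F_mul_F : E p * (F p (-1) * F p 1) = E p := by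
  rw [F_mul_F, mul_sub, mul_sub, E_mul_S, E_mul_S, mul_one, sub_zero, sub_zero]

/-- For `n > 0`, row `n` of `F⁻ F⁺` is `e_n - w⁻¹ e_{n-1} = -w⁻¹ (e_{n-1} - w e_n)`, a multiple of
row `n - 1` of `1 - Z`; for `n < 0` it is row `n` of `1 - Z` itself. The factors `-w⁻¹` in `P`, and
thus the blocks of `Ũ`, originate here. -/
theorem one_sub_E_mul_F_mul_F : (1 - E p) * (F p (-1) * F p 1) = P p * (1 - Z p) := by
  rw [sub_mul, E_mul_F_mul_F, one_mul, F_mul_F, mul_sub, mul_one]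
  refine BddMat.ext ?_
  ext1 n m
  simp only [toMat_sub, Matrix.sub_apply]
  rw [P, perm_mul_apply, Z, perm_apply, perm_apply, E, perm_apply, S, S, perm_apply, perm_apply,
    toMat_one, Matrix.one_apply]
  simp only [Units.val_one, Units.val_neg, one_mul, neg_mul]
  have h : wPow p (-1) * wPow p 1 = 1 := wPow_mul _ _
  rcases lt_trichotomy n 0 with hn | hn | hn
  · simp [hn, hn.ne, hn.not_gt, eq_comm]
  · subst hn; simp [eq_comm]
  · rw [if_neg hn.ne', ite_self, if_neg (show ¬ n < 0 by omega), if_neg (show ¬ n < 0 by omega),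
      if_neg (show ¬ n < 0 by omega), if_pos hn, if_pos (show -n < 0 by omega), ite_self,
      show n - 1 + 1 = n by ring, show n + -1 = n - 1 by ring]
    by_cases h1 : n = m
    · simp only [if_neg (show ¬ m = n - 1 by omega)]
      rw [if_pos h1, if_pos h1.symm]
      linear_combination -h
    · rw [if_neg h1, if_neg (Ne.symm h1)]
      split_ifs <;> ring

theorem Q_mul_F_mul_F : Q p * (F p (-1) * F p 1) = 1 - Z p := by
  have h : Q p * ((1 - E p) * (F p (-1) * F p 1)) = Q p * (F p (-1) * F p 1) := by
    rw [← mul_assoc, mul_sub, Q_mul_E, mul_one, sub_zero]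
  rw [← h, one_sub_E_mul_F_mul_F, ← mul_assoc, Q_mul_P, one_mul]

/-- The `0`-th row of `F U(a) F⁻¹` at `t = 1`, where `F = F⁺ F⁻`. -/
def matT (a : RapidLaurent p) : Matrix ℤ ℤ (RapidLaurent p) := fun n m =>
  if n = 0 then (if m < 0 then tail 1 a (-m) else if 0 < m then tail (-1) a (-m) else a) else 0

theorem traceClass_matT (a : RapidLaurent p) : TraceClass (sumNorm p) (matT a) := by
  refine traceClass_of_decay fun i k => ⟨en (sumNorm p) (i, k + 4) a, en_ne_top _ _ _,
    fun n m => ?_⟩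
  unfold matT
  split_ifs with h1 h2 h3
  · exact en_tail_le i k 1 a (by simp; omega) (by omega) (by omega)
  · exact en_tail_le i k (-1) a (by simp; omega) (by omega) (by omega)
  · have hm : m = 0 := by omega
    subst h1 hm
    simpa [decay] using en_sumNorm_mono i (by omega) a
  · simp

/-- The matrix whose only non-zero row is the `0`-th row of `F U(a) F⁻¹`, where `F = F⁺ F⁻`. -/
def T (a : RapidLaurent p) : BddMat (sumNorm p) := (traceClass_matT a).toBddMat

theorem T_apply (a : RapidLaurent p) : (T a).toMat = matT a := rfl

theorem eq_add_tail_add_tail (a : RapidLaurent p) :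
    a = const (a.coeff 0) + wPow p 1 * tail 1 a 1 + wPow p (-1) * tail (-1) a (-1) := by
  ext j
  rw [coeff_add, coeff_add, coeff_const, coeff_wPow_mul, coeff_wPow_mul, coeff_tail, coeff_tail]
  simp only [Units.val_one, Units.val_neg, one_mul, neg_mul]
  rcases lt_trichotomy j 0 with h | h | h
  · rw [if_neg h.ne, if_neg (by omega), if_pos (by omega), zero_add, zero_add]
    congr 1; ring
  · subst h; simp
  · rw [if_neg h.ne', if_pos (by omega), if_neg (by omega), zero_add, add_zero]
    congr 1; ring

/-- Row `0` of `F⁻ F⁺` is that of the identity, so row `0` of the conjugate has to solve `T F = E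
U`. The tails to the left and right of column `0` solve the recursion. -/
theorem T_mul_F_mul_F (a : RapidLaurent p) : T a * (F p (-1) * F p 1) = E p * U a := by
  have key : T a = E p * U a + T a * S p (-1) + T a * S p 1 := by
    refine BddMat.ext ?_
    ext1 n m
    simp only [toMat_add, Matrix.add_apply]
    rw [E_mul_apply, mul_S_apply, mul_S_apply, T_apply, U_apply, matT, matT, matT]
    simp only [Units.val_one, Units.val_neg, one_mul, neg_mul]
    by_cases hn : n = 0
    · subst hn
      simp only [if_true, zero_sub]
      rcases lt_trichotomy m 0 with h | h | h
      · rw [if_pos h, if_neg (by omega), if_pos (show m - 1 < 0 by omega), if_pos (by omega),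
          tail_eq, add_zero, mul_comm (wPow p _)]
        congr 3
        simp; ring
      -- In column `0` both shifts contribute, and the two tails with the constant term reassemble
      -- `a(w)`.
      · subst h
        have h1 := eq_add_tail_add_tail a
        norm_num
        linear_combination h1
      · rw [if_neg h.not_gt, if_pos h, if_pos (by omega), if_neg (by omega), if_pos (by omega),
          if_neg (by omega), tail_eq, add_zero, mul_comm (wPow p _)]
        congr 3
        simp; ring
    · simp [hn]
  rw [F_mul_F, mul_sub, mul_sub, mul_one]
  nth_rw 1 [key]
  abel

/-- The value at `t = 1` of `F U(a) F⁻¹`, where `F = F⁺ F⁻`. -/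
def M (a : RapidLaurent p) : BddMat (sumNorm p) := (1 - E p) * UT a + T a

/-- Off row `0` this is `P U Q F = P U (1 - Z) = P (1 - Z) U`, because `Z` commutes with `U(a)`; row
`0` is the equation for `T`. -/
theorem M_mul_F_mul_F (a : RapidLaurent p) :
    M a * (F p (-1) * F p 1) = (F p (-1) * F p 1) * U a := by
  have h1 : (1 - E p) * UT a = P p * U a * Q p := by
    have e : (1 - E p) * UT a = P p * U a * Q p - (E p * P p) * U a * Q p +
        (E p - E p * E p) := by rw [UT]; noncomm_ring
    rw [e, E_mul_P, E_mul_E]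
    noncomm_ring
  rw [M, add_mul, T_mul_F_mul_F, h1, mul_assoc (P p * U a), Q_mul_F_mul_F]
  have h2 : P p * U a * (1 - Z p) = P p * (1 - Z p) * U a := by
    rw [mul_assoc, mul_assoc, mul_sub (U a), sub_mul _ _ (U a), Z_mul_U, mul_one, one_mul]
  rw [h2, ← one_sub_E_mul_F_mul_F, sub_mul, sub_mul, E_mul_F_mul_F, one_mul]
  abel

/-- The conjugation by `F⁻ F⁺` is done in two stages, through `V⁺`. -/
theorem M_mul_F (a : RapidLaurent p) : M a * F p (-1) = F p (-1) * V 1 a := by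
  refine mul_F_cancel (ε := 1) ?_
  rw [mul_assoc, M_mul_F_mul_F, mul_assoc, mul_assoc, V_mul_F]

/-- The product differs from the identity only in row `0`. Column `0` of the inverse of `Ũ` is that
of the identity, so the corner entry is that of `T`, which is `a(w)`. -/
theorem det_M_mul_UT_inv (a : (RapidLaurent p)ˣ) :
    (M (a : RapidLaurent p) * UT ((a⁻¹ : (RapidLaurent p)ˣ) : RapidLaurent p)).det = a := by
  have e : M (a : RapidLaurent p) * UT ((a⁻¹ : (RapidLaurent p)ˣ) : RapidLaurent p) - 1 =
      T (a : RapidLaurent p) * UT ((a⁻¹ : (RapidLaurent p)ˣ) : RapidLaurent p) - E p := by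
    rw [M, add_mul, mul_assoc, UT_mul_UT_inv]; noncomm_ring
  rw [det, e, det1_of_row]
  · rw [toMat_sub, Matrix.sub_apply, mul_apply, tsum_eq_single 0]
    · simp [T_apply, matT, UT_toMat, matUTilde, E, perm_apply]
    · intro l hl
      rw [UT_toMat, matUTilde, if_pos (Or.inr rfl), if_neg hl, mul_zero]
  · intro n m hn
    rw [toMat_sub, Matrix.sub_apply, mul_apply]
    simp [T_apply, matT, hn, E, perm_apply]

/-- The entries of `(U⁺(a, 1, w) - U(a)) F⁻(1, w)⁻¹`. -/
def matH (a : RapidLaurent p) : Matrix ℤ ℤ (RapidLaurent p) := fun n m =>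
  if m < 0 then matN 1 a n m
  else if 0 < m then (if 0 ≤ n then 0 else -(wPow p 1 * tail (-1) a (n + 1 - m)))
  else if 0 ≤ n then tail 1 a n - const (a.coeff n) else -tail (-1) a n

theorem traceClass_matH (a : RapidLaurent p) : TraceClass (sumNorm p) (matH a) := by
  refine traceClass_of_decay fun i k => ?_
  refine ⟨_, matN_const_ne_top 1 a i k, fun n m => ?_⟩
  have e : decay n m * ((2 + wt k ((1 : ℤˣ) : ℤ)) * en (sumNorm p) (i, k + 4) a) =
      (decay n m * en (sumNorm p) (i, k + 4) a + decay n m * en (sumNorm p) (i, k + 4) a) +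
      wt k 1 * (decay n m * en (sumNorm p) (i, k + 4) a) := by rw [Units.val_one]; ring
  unfold matH
  split_ifs with h1 h2 h3 h4
  · exact en_matN_le 1 a i k n m
  · simp
  · rw [e, en_neg]
    refine le_trans ?_ le_add_self
    refine (en_sumNorm_wPow_mul_le _ _ _ _).trans (mul_le_mul' le_rfl ?_)
    exact en_tail_le i k (-1) a (by simp; omega) (by omega) (by omega)
  · rw [e]
    refine le_trans ?_ le_self_add
    refine (en_sub_le _ _ _ _).trans (add_le_add ?_ ?_)
    · exact en_tail_le i k 1 a (by simpa using h4) (by omega) (by omega)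
    · exact en_const_coeff_le i k a (by omega) (by omega)
  · rw [e, en_neg]
    refine le_trans ?_ (le_self_add.trans le_self_add)
    exact en_tail_le i k (-1) a (by simp; omega) (by omega) (by omega)

/-- The matrix `(U⁺(a, 1, w) - U(a)) F⁻(1, w)⁻¹`. -/
def H (a : RapidLaurent p) : BddMat (sumNorm p) := (traceClass_matH a).toBddMat

theorem H_apply (a : RapidLaurent p) : (H a).toMat = matH a := rfl

/-- `H` replaces the product of `V⁺ - U` with the unbounded inverse of `F⁻`. It is still summable,
since summing along a row merely turns coefficients into tails. -/
theorem H_mul_F (a : RapidLaurent p) : H a * F p (-1) = N 1 a := by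
  have key : H a = N 1 a + H a * S p (-1) := by
    refine BddMat.ext ?_
    ext1 n m
    rw [toMat_add, Matrix.add_apply, mul_S_apply, H_apply, N_apply]
    have hw : wPow p 1 * wPow p (-1) = 1 := wPow_mul _ _
    simp only [matH, matN, Units.val_one, Units.val_neg, one_mul, neg_mul, sub_neg_eq_add]
    rcases lt_trichotomy m 0 with h | h | h
    · rw [if_pos h, if_neg (show ¬ -(m + 1) < 0 by omega), add_zero]
    · subst h
      by_cases hn : 0 ≤ n
      · simp [hn]
      · simp [hn]
        linear_combination -tail (-1) a n * hw
    · rw [if_neg h.not_gt, if_pos h, if_neg (show ¬ (0 ≤ n ∧ m ≤ 0) by omega),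
        if_pos (show -(m + 1) < 0 by omega),
        if_neg (show ¬ m + 1 < 0 by omega), if_pos (show 0 < m + 1 by omega)]
      by_cases hn : 0 ≤ n
      · rw [if_pos hn, if_neg (show ¬ (n < 0 ∧ 0 < m) by omega), if_pos hn, zero_mul, add_zero]
      · rw [if_neg hn, if_pos (show n < 0 ∧ 0 < m by omega), if_neg hn]
        have ht := tail_eq (-1) a (n + 1 - m)
        simp only [Units.val_one, Units.val_neg] at ht
        rw [ht, show n + 1 - (m + 1) = n + 1 - m + -1 by ring]
        ring
  rw [F, mul_sub, mul_one]
  nth_rw 1 [key]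
  abel

/-- The determinant of `M Ũ⁻¹ = (M (V⁻)⁻¹) (V⁻ U⁻¹) (U Ũ⁻¹)` is `a(w)`. Formally, the first factor
is `F⁻ (V⁺ U⁻¹) (F⁻)⁻¹`. -/
theorem piPM_mul_piTilde (a : (RapidLaurent p)ˣ) : piPM 1 a * piPM (-1) a * piTilde a = a := by
  set a' : RapidLaurent p := ((a⁻¹ : (RapidLaurent p)ˣ) : RapidLaurent p) with ha'
  have hH : (H (a : RapidLaurent p)).IsTr := traceClass_matH _
  have hK : H (a : RapidLaurent p) * V (-1) a' * F p (-1) = V 1 (a : RapidLaurent p) * U a' - 1 := by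
    rw [mul_assoc, V_mul_F, ← mul_assoc, H_mul_F, V_mul_U_inv_sub_one]
  -- With `Y = H V⁻(a⁻¹)`, the first factor is `1 + F⁻ Y` while `V⁺ U⁻¹ = 1 + Y F⁻`. `det1_mul_comm`
  -- equates the determinants without inverting `F⁻`.
  have hL : M (a : RapidLaurent p) * V (-1) a' - 1 =
      F p (-1) * (H (a : RapidLaurent p) * V (-1) a') := by
    refine mul_F_cancel (ε := -1) ?_
    rw [mul_assoc (F p (-1)), hK, sub_mul, mul_assoc, V_mul_F, ← mul_assoc, M_mul_F, mul_sub,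
      mul_assoc]
    simp
  have htr : (M (a : RapidLaurent p) * V (-1) a' - 1).IsTr := by
    rw [hL]; exact (hH.mul_right _).mul_left _
  have h1 : (M (a : RapidLaurent p) * V (-1) a').det = piPM 1 a := by
    rw [det, hL, ← det1_mul_comm (hH.mul_right _), hK]; rfl
  have e1 : M (a : RapidLaurent p) * U a' =
      (M (a : RapidLaurent p) * V (-1) a') * (V (-1) (a : RapidLaurent p) * U a') := by
    rw [mul_assoc, ← mul_assoc (V (-1) a'), V_inv_mul_V, one_mul]
  have e2 : M (a : RapidLaurent p) * UT a' =
      (M (a : RapidLaurent p) * U a') * (U (a : RapidLaurent p) * UT a') := by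
    rw [mul_assoc, ← mul_assoc (U a'), U_inv_mul_U, one_mul]
  have h2 := isTr_mul_sub_one htr (isTr_V_mul_U_inv (-1) a)
  rw [← e1] at h2
  have h3 := det_mul h2 (isTr_U_mul_UT_inv a)
  rw [← e2, det_M_mul_UT_inv, e1, det_mul htr (isTr_V_mul_U_inv (-1) a), h1] at h3
  exact h3.symm

end BddMat

end Factors

/-! ### Base change of matrices and determinants -/

section Map

variable {A : Type u} [CommRing A] [TopologicalSpace A] [IsTopologicalRing A] [T2Space A]
  [SeqComplete A] {ι : Type v} {p : ι → AddGroupSeminorm A} [StrongPolymetric p]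
  {B : Type u'} [CommRing B] [TopologicalSpace B] [IsTopologicalRing B] [T2Space B]
  [SeqComplete B] {κ : Type v'} {q : κ → AddGroupSeminorm B} [StrongPolymetric q]

theorem SeminormBounded.comp {D : Type*} [CommRing D] {μ : Type*} {r : μ → AddGroupSeminorm D}
    {f : A → B} {g : B → D} (hg : SeminormBounded q r g) (hf : SeminormBounded p q f) :
    SeminormBounded p r (g ∘ f) := by
  intro m
  obtain ⟨k, C, hC, h1⟩ := hg m
  obtain ⟨i, C', hC', h2⟩ := hf k
  refine ⟨i, C * C', ENNReal.mul_ne_top hC hC', fun x => (h1 _).trans ?_⟩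
  rw [mul_assoc]
  exact mul_le_mul' le_rfl (h2 x)

theorem SeminormBounded.continuous_ringHom {f : A →+* B} (hf : SeminormBounded p q f) :
    Continuous f :=
  SeminormBounded.continuous (f := f.toAddMonoidHom) hf

theorem RowBdd.map {f : A → B} (hf : SeminormBounded p q f) {X : Matrix ℤ ℤ A} (hX : RowBdd p X) :
    RowBdd q (X.map f) := by
  intro k
  obtain ⟨i, C, hC, h1⟩ := hf k
  obtain ⟨D, hD, h2⟩ := hX i
  refine ⟨C * D, ENNReal.mul_ne_top hC hD, fun n => ?_⟩
  refine (ENNReal.tsum_le_tsum fun m => h1 (X n m)).trans ?_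
  rw [ENNReal.tsum_mul_left]
  exact mul_le_mul' le_rfl (h2 n)

theorem TraceClass.map {f : A → B} (hf : SeminormBounded p q f) {X : Matrix ℤ ℤ A}
    (hX : TraceClass p X) : TraceClass q (X.map f) := by
  intro k
  obtain ⟨i, C, hC, h1⟩ := hf k
  refine ne_top_of_le_ne_top (ENNReal.mul_ne_top hC (hX i)) ?_
  simp only [← ENNReal.tsum_mul_left]
  exact ENNReal.tsum_le_tsum fun n => ENNReal.tsum_le_tsum fun m => h1 (X n m)

theorem TraceClass.det1_map {f : A →+* B} (hf : Continuous f) {K : Matrix ℤ ℤ A}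
    (hK : TraceClass p K) : det1 (K.map f) = f (det1 K) := by
  refine ((hK.hasSum_det1.map f hf).congr_fun fun x => ?_).tsum_eq
  simp only [Function.comp, detTerm]
  split_ifs
  · simp
  · simp

namespace BddMat

/-- The homomorphism of matrix rings induced by a bounded homomorphism. -/
def map (f : A →+* B) (hf : SeminormBounded p q f) : BddMat p →+* BddMat q where
  toFun X := ⟨X.toMat.map f, X.row.map hf, X.col.map hf⟩
  map_zero' := BddMat.ext <| by ext1 n m; simp
  map_one' := BddMat.ext <| by ext1 n m; simp [Matrix.one_apply, apply_ite f]
  map_add' X Y := BddMat.ext <| by ext1 n m; simp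
  map_mul' X Y := BddMat.ext <| by
    ext1 n m
    refine (((hasSum_mul X Y n m).map f hf.continuous_ringHom).congr_fun fun l => ?_).tsum_eq.symm
    simp

theorem map_toMat (f : A →+* B) (hf : SeminormBounded p q f) (X : BddMat p) (n m : ℤ) :
    (map f hf X).toMat n m = f (X.toMat n m) := rfl

theorem IsTr.map {f : A →+* B} (hf : SeminormBounded p q f) {X : BddMat p} (hX : X.IsTr) :
    (map f hf X).IsTr := TraceClass.map hf hX

theorem det_map {f : A →+* B} (hf : SeminormBounded p q f) {X : BddMat p} (hX : (X - 1).IsTr) :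
    (map f hf X).det = f X.det := by
  rw [det, det, ← TraceClass.det1_map hf.continuous_ringHom hX, ← map_one (map f hf), ← map_sub]
  rfl

end BddMat

end Map

/-! ### Substitutions into a second variable -/

section Evaluation

variable {A : Type u} [CommRing A] [TopologicalSpace A] [IsTopologicalRing A] [T2Space A]
  [SeqComplete A] {ι : Type v} {p : ι → AddGroupSeminorm A} [StrongPolymetric p]

namespace RapidLaurent

theorem rapid_of_wt {c : ℤ → A} (h : ∀ i k, ∃ C : ℝ≥0∞, C ≠ ⊤ ∧ ∀ n, wt k n * en p i (c n) ≤ C)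
    (i : ι) (k : ℕ) : ∃ C : ℝ, ∀ n : ℤ, (1 + |(n : ℝ)|) ^ k * p i (c n) ≤ C := by
  obtain ⟨C, hC, h1⟩ := h i k
  refine ⟨C.toReal, fun n => ?_⟩
  have h2 := ENNReal.toReal_mono hC (h1 n)
  rwa [ENNReal.toReal_mul, toReal_en, wt_eq_ofReal, ENNReal.toReal_ofReal (by positivity)] at h2

theorem wt_mul_le (k : ℕ) (m n : ℤ) : wt k (m * n) ≤ wt k m * wt k n := by
  rw [wt, wt, wt, ← mul_pow, ← Nat.cast_mul, Int.natAbs_mul]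
  gcongr
  nlinarith [Nat.zero_le m.natAbs, Nat.zero_le n.natAbs]

theorem en_twist_le (e : ℤ) (a : RapidLaurent p) (i : ι) (k l : ℕ) (n : ℤ) :
    wt l n * en (sumNorm p) (i, k) (monomial (e * n) (a.coeff n)) ≤
      wt k e * (wt (l + k) n * en p i (a.coeff n)) := by
  rw [en_sumNorm_monomial]
  calc wt l n * (wt k (e * n) * en p i (a.coeff n))
      ≤ wt l n * (wt k e * wt k n * en p i (a.coeff n)) := by gcongr; exact wt_mul_le k e n
    _ = _ := by rw [wt_add]; ring

theorem monomial_add (k : ℤ) (x y : A) :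
    (monomial k (x + y) : RapidLaurent p) = monomial k x + monomial k y := by
  ext n
  simp only [coeff_add, coeff_monomial]
  split_ifs <;> simp

theorem monomial_zero (k : ℤ) : (monomial k 0 : RapidLaurent p) = 0 := by
  ext n
  simp [coeff_monomial]

/-- The monomials as additive homomorphisms. -/
def monomialHom (k : ℤ) : A →+ RapidLaurent p := ⟨⟨monomial k, monomial_zero k⟩, monomial_add k⟩

theorem continuous_monomial (k : ℤ) : Continuous (monomialHom (p := p) k) := by
  refine SeminormBounded.continuous (p := p) (q := sumNorm p) ?_
  rintro ⟨i, l⟩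
  exact ⟨i, wt l k, wt_ne_top _ _, fun x => (en_sumNorm_monomial i l k x).le⟩

variable (p) in
/-- The substitution `a(w) ↦ a(wᵉ w')`, where `w'` is a second variable. -/
def twist (e : ℤ) : RapidLaurent p →+* RapidLaurent (sumNorm p) where
  toFun a := ⟨fun n => monomial (e * n) (a.coeff n), rapid_of_wt fun ik l =>
    ⟨_, ENNReal.mul_ne_top (wt_ne_top ik.2 e) (en_ne_top (sumNorm p) (ik.1, l + ik.2) a), fun n =>
      (en_twist_le e a ik.1 ik.2 l n).trans
        (mul_le_mul' le_rfl (wt_mul_en_coeff_le ik.1 (l + ik.2) a n))⟩⟩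
  map_zero' := by
    ext1; funext n
    exact monomial_zero _
  map_one' := by
    ext1; funext n
    rw [coeff_one]
    change monomial (e * n) ((1 : RapidLaurent p).coeff n) = _
    rw [coeff_one]
    split_ifs with h
    · rw [h, mul_zero]; rfl
    · exact monomial_zero _
  map_add' a b := by
    ext1; funext n
    exact monomial_add _ _ _
  map_mul' a b := by
    ext1; funext n
    refine (((hasSum_coeff_mul a b n).map (monomialHom (e * n))
      (continuous_monomial _)).congr_fun fun m => ?_).tsum_eq.symm
    change monomial (e * m) (a.coeff m) * monomial (e * (n - m)) (b.coeff (n - m)) =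
      monomial (e * n) (a.coeff m * b.coeff (n - m))
    rw [monomial_mul_monomial]
    congr 1
    ring

theorem coeff_twist (e : ℤ) (a : RapidLaurent p) (n : ℤ) :
    (twist p e a).coeff n = monomial (e * n) (a.coeff n) := rfl

theorem seminormBounded_twist (e : ℤ) :
    SeminormBounded (sumNorm p) (sumNorm (sumNorm p)) (twist p e) := by
  rintro ⟨⟨i, k⟩, l⟩
  refine ⟨(i, l + k), wt k e, wt_ne_top _ _, fun a => ?_⟩
  rw [en_sumNorm, en_sumNorm, ← ENNReal.tsum_mul_left]
  exact ENNReal.tsum_le_tsum fun n => en_twist_le e a i k l n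

theorem twist_monomial (e k : ℤ) (x : A) :
    twist p e (monomial k x) = monomial k (monomial (e * k) x) := by
  ext1; funext n
  rw [coeff_twist, coeff_monomial, coeff_monomial]
  split_ifs with h
  · rw [h]
  · exact monomial_zero _

theorem summable_coeff (a : RapidLaurent p) : Summable a.coeff :=
  summable_of_seminorm p fun i => a.summable_seminorm i

variable (p) in
/-- The evaluation `a ↦ a(1)`. -/
def evalOne : RapidLaurent p →+* A where
  toFun a := ∑' n, a.coeff n
  map_zero' := by simp
  map_one' := by
    rw [tsum_eq_single 0 fun n hn => by rw [coeff_one, if_neg hn], coeff_one, if_pos rfl]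
  map_add' a b := (a.summable_coeff.hasSum.add b.summable_coeff.hasSum).tsum_eq
  map_mul' a b := by
    have hs : Summable fun mn : ℤ × ℤ => a.coeff mn.1 * b.coeff mn.2 := by
      refine summable_of_seminorm p fun i => ?_
      obtain ⟨j, hj, -⟩ := exists_mul_le p i
      exact Summable.of_nonneg_of_le (fun _ => apply_nonneg _ _) (fun mn => hj _ _)
        ((a.summable_seminorm j).mul_of_nonneg (b.summable_seminorm j)
          (fun _ => apply_nonneg _ _) (fun _ => apply_nonneg _ _))
    have h1 : HasSum (fun m => a.coeff m * ∑' n, b.coeff n)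
        (∑' mn : ℤ × ℤ, a.coeff mn.1 * b.coeff mn.2) :=
      hs.hasSum.prod_fiberwise fun m => b.summable_coeff.hasSum.mul_left _
    let e : ℤ × ℤ ≃ ℤ × ℤ :=
      { toFun := fun kl => (kl.2, kl.1 - kl.2)
        invFun := fun lm => (lm.1 + lm.2, lm.1)
        left_inv := fun kl => by simp
        right_inv := fun lm => by simp }
    have h2 : HasSum (fun n => (a * b).coeff n)
        (∑' mn : ℤ × ℤ, a.coeff mn.1 * b.coeff mn.2) :=
      ((e.hasSum_iff).2 hs.hasSum).prod_fiberwise fun n => hasSum_coeff_mul a b n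
    exact h2.tsum_eq.trans (h1.unique (a.summable_coeff.hasSum.mul_right _))

theorem seminormBounded_evalOne : SeminormBounded (sumNorm p) p (evalOne p) := by
  intro i
  refine ⟨(i, 0), 1, ENNReal.one_ne_top, fun a => ?_⟩
  rw [en_sumNorm]
  simp only [wt_zero_left, one_mul]
  exact en_tsum_le p i a.coeff

theorem evalOne_monomial (k : ℤ) (x : A) : evalOne p (monomial k x) = x := by
  change ∑' n, (monomial k x : RapidLaurent p).coeff n = x
  rw [tsum_eq_single k fun n hn => by rw [coeff_monomial, if_neg hn], coeff_monomial, if_pos rfl]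

variable (p) in
/-- The substitution `a(w) ↦ a(1)`, as a constant in two variables. -/
def evalOneConst : RapidLaurent p →+* RapidLaurent (sumNorm p) :=
  (constHom (sumNorm p)).comp ((constHom p).comp (evalOne p))

theorem seminormBounded_evalOneConst :
    SeminormBounded (sumNorm p) (sumNorm (sumNorm p)) (evalOneConst p) :=
  seminormBounded_const.comp (seminormBounded_const.comp seminormBounded_evalOne)

end RapidLaurent

end Evaluation

/-! ### The functional equation of `π̃` and orthogonality -/

section Orthogonality

variable {A : Type u} [CommRing A] [TopologicalSpace A] [IsTopologicalRing A] [T2Space A]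
  [SeqComplete A] {ι : Type v} {p : ι → AddGroupSeminorm A} [StrongPolymetric p]

namespace BddMat

open RapidLaurent

/-- The diagonal matrix with the entries `u` for `n < 0` and `1` for `n ≥ 0`. -/
def diag (u : RapidLaurent p) : BddMat (sumNorm p) :=
  perm (fun n => n) (fun n => if n < 0 then u else 1)
    (fun ik => ⟨en (sumNorm p) ik u + en (sumNorm p) ik 1,
      ENNReal.add_ne_top.2 ⟨en_ne_top _ _ _, en_ne_top _ _ _⟩, fun n => by split_ifs <;> simp⟩)
    (fun n m _ _ h => h)

theorem diag_mul_mul_diag_apply (u v : RapidLaurent p) (X : BddMat (sumNorm p)) (n m : ℤ) :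
    (diag u * X * diag v).toMat n m =
      (if n < 0 then u else 1) * X.toMat n m * (if m < 0 then v else 1) := by
  rw [diag, diag, mul_perm_apply (l := m) _ n (fun k _ => eq_comm), perm_mul_apply]

theorem diag_mul_diag {u v : RapidLaurent p} (h : u * v = 1) : diag u * diag v = 1 := by
  refine BddMat.ext ?_
  ext1 n m
  rw [diag, perm_mul_apply, diag, perm_apply, toMat_one, Matrix.one_apply]
  by_cases hn : n < 0
  · simp [hn, h, eq_comm]
  · simp [hn, eq_comm]

/-- `Ũ` contains the variable only in its off-diagonal blocks, as `w` and `w⁻¹`; rescaling the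
variable by `u` is therefore conjugation by a diagonal matrix. -/
theorem map_UT_eq {f g : RapidLaurent p →+* RapidLaurent (sumNorm p)}
    (hf : SeminormBounded (sumNorm p) (sumNorm (sumNorm p)) f)
    (hg : SeminormBounded (sumNorm p) (sumNorm (sumNorm p)) g) {u v : RapidLaurent (sumNorm p)}
    (huv : u * v = 1) (hc : ∀ x, f (const x) = g (const x)) (hw : f (wPow p 1) = u * g (wPow p 1))
    (hw' : f (wPow p (-1)) = v * g (wPow p (-1))) (a : RapidLaurent p) :
    map f hf (UT a) = diag u * map g hg (UT a) * diag v := by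
  refine BddMat.ext ?_
  ext1 n m
  rw [diag_mul_mul_diag_apply, map_toMat, map_toMat, UT_toMat, matUTilde]
  change f (if n = 0 ∨ m = 0 then (if n = m then 1 else 0)
    else if n < 0 ∧ 0 < m then -(wPow p 1 * const (a.coeff (n - m + 1)))
    else if 0 < n ∧ m < 0 then -(wPow p (-1) * const (a.coeff (n - m - 1)))
    else const (a.coeff (n - m))) = _ * g (if n = 0 ∨ m = 0 then (if n = m then 1 else 0)
    else if n < 0 ∧ 0 < m then -(wPow p 1 * const (a.coeff (n - m + 1)))
    else if 0 < n ∧ m < 0 then -(wPow p (-1) * const (a.coeff (n - m - 1)))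
    else const (a.coeff (n - m))) * _
  by_cases h1 : n = 0 ∨ m = 0
  · rw [if_pos h1]
    by_cases h2 : n = m
    · have hn : n = 0 := by omega
      have hm : m = 0 := by omega
      subst hn hm
      simp
    · rw [if_neg h2]
      simp
  · rw [if_neg h1]
    by_cases h2 : n < 0
    · by_cases h3 : 0 < m
      · rw [if_pos ⟨h2, h3⟩, if_pos h2, if_neg (by omega), map_neg, map_mul, map_neg, map_mul, hw,
          hc]
        ring
      · rw [if_neg (by omega), if_neg (by omega), if_pos h2, if_pos (by omega), hc]
        linear_combination -g (const (a.coeff (n - m))) * huv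
    · by_cases h3 : m < 0
      · rw [if_neg (by omega), if_pos (by omega), if_neg h2, if_pos h3, map_neg, map_mul, map_neg,
          map_mul, hw', hc]
        ring
      · rw [if_neg (by omega), if_neg (by omega), if_neg h2, if_neg h3, hc]
        ring

/-- Two matrices which are inverse to each other up to a matrix with summable entries. -/
theorem isTr_mul_sub_one_of_isTr {u u' x y y' : BddMat p} (hu : u' * u = 1) (hy : y' * y = 1)
    (h1 : (u * y - 1).IsTr) (h2 : (u * x - 1).IsTr) : (y' * x - 1).IsTr := by
  have e : y' * x - 1 = y' * (u' * u) * x - y' * (u' * u) * y := by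
    rw [hu, mul_one, hy]
  have e2 : y' * x - 1 = (y' * u') * ((u * x - 1) - (u * y - 1)) := by
    rw [e]; noncomm_ring
  rw [e2]
  exact (h2.sub h1).mul_left _

theorem map_U_eq {f g : RapidLaurent p →+* RapidLaurent (sumNorm p)}
    (hf : SeminormBounded (sumNorm p) (sumNorm (sumNorm p)) f)
    (hg : SeminormBounded (sumNorm p) (sumNorm (sumNorm p)) g)
    (hc : ∀ x, f (const x) = g (const x)) (a : RapidLaurent p) :
    map f hf (U a) = map g hg (U a) :=
  BddMat.ext <| by ext1 n m; exact hc _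

theorem map_piTilde {f : RapidLaurent p →+* RapidLaurent (sumNorm p)}
    (hf : SeminormBounded (sumNorm p) (sumNorm (sumNorm p)) f) (a : (RapidLaurent p)ˣ) :
    f (piTilde a) = (map f hf (U (a : RapidLaurent p)) *
      map f hf (UT ((a⁻¹ : (RapidLaurent p)ˣ) : RapidLaurent p))).det := by
  rw [piTilde, ← det_map hf (isTr_U_mul_UT_inv a), map_mul]

/-- Here `X₀, X₁, X₂, X₃` stand for `Ũ⁻¹` at `1, w, w', w w'`, the `Y`'s for the inverses, and `W`
for `U`. From `W X₃ = (W X₁)(Y₁ X₃)`, where `Y₁ X₃` is conjugate to `Y₀ X₂`, and `W X₂ = (W X₀)(Y₀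
X₂)`, the determinant of `Y₀ X₂` can be eliminated. -/
theorem det_mul_det_of_conj {W X₀ X₁ X₂ X₃ Y₀ Y₁ D D' : BddMat p} (hD : D * D' = 1)
    (hD' : D' * D = 1) (h0 : X₀ * Y₀ = 1) (h1 : X₁ * Y₁ = 1) (e1 : Y₁ = D * Y₀ * D')
    (e3 : X₃ = D * X₂ * D') (t0 : (W * X₀ - 1).IsTr) (t1 : (W * X₁ - 1).IsTr)
    (t : (Y₀ * X₂ - 1).IsTr) :
    (W * X₃).det * (W * X₀).det = (W * X₁).det * (W * X₂).det := by
  have f4 : D * (Y₀ * X₂) * D' = Y₁ * X₃ := by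
    rw [e1, e3]
    simp only [mul_assoc]
    rw [← mul_assoc D' D, hD', one_mul]
  have f3 : W * X₃ = (W * X₁) * (D * (Y₀ * X₂) * D') := by
    rw [f4, mul_assoc, ← mul_assoc X₁, h1, one_mul]
  have f2 : W * X₂ = (W * X₀) * (Y₀ * X₂) := by
    rw [mul_assoc, ← mul_assoc X₀, h0, one_mul]
  rw [f3, det_mul t1 (isTr_conj hD t), det_conj hD hD' t, f2, det_mul t0 t]
  ring

theorem evalOneConst_const (x : A) : evalOneConst p (const x) = const (const x) := by
  change const (const (evalOne p (monomial 0 x))) = _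
  rw [evalOne_monomial]

theorem twist_const (e : ℤ) (x : A) : twist p e (const x) = const (const x) := by
  rw [const, twist_monomial, mul_zero]
  rfl

theorem constHom_wPow (k : ℤ) :
    constHom (sumNorm p) (wPow p k) = const (wPow p k) * evalOneConst p (wPow p k) := by
  change _ = _ * const (const (evalOne p (monomial k 1)))
  rw [evalOne_monomial]
  exact (mul_one _).symm

theorem twist_one_wPow (k : ℤ) :
    twist p 1 (wPow p k) = const (wPow p k) * twist p 0 (wPow p k) := by
  rw [wPow, twist_monomial, twist_monomial, const, monomial_mul_monomial, monomial_mul_monomial,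
    zero_add, mul_one, zero_mul, add_zero, one_mul]

theorem map_UT_inv_mul {f : RapidLaurent p →+* RapidLaurent (sumNorm p)}
    (hf : SeminormBounded (sumNorm p) (sumNorm (sumNorm p)) f) (a : (RapidLaurent p)ˣ) :
    map f hf (UT ((a⁻¹ : (RapidLaurent p)ˣ) : RapidLaurent p)) *
      map f hf (UT (a : RapidLaurent p)) = 1 := by
  rw [← map_mul, UT_inv_mul_UT, map_one]

theorem map_U_mul_UT {f g : RapidLaurent p →+* RapidLaurent (sumNorm p)}
    (hf : SeminormBounded (sumNorm p) (sumNorm (sumNorm p)) f)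
    (hg : SeminormBounded (sumNorm p) (sumNorm (sumNorm p)) g)
    (hc : ∀ x, f (const x) = g (const x)) (a : (RapidLaurent p)ˣ) :
    (map g hg (U (a : RapidLaurent p)) *
      map f hf (UT ((a⁻¹ : (RapidLaurent p)ˣ) : RapidLaurent p)) - 1).IsTr := by
  rw [← map_U_eq hf hg hc, ← map_mul, ← map_one (map f hf), ← map_sub]
  exact (isTr_U_mul_UT_inv a).map hf

/-- With `w` the inner and `w'` the outer variable, this reads `π̃(w w') π̃(1) = π̃(w) π̃(w')`. -/
theorem twist_piTilde_mul (a : (RapidLaurent p)ˣ) :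
    twist p 1 (piTilde a) * evalOneConst p (piTilde a) =
      constHom (sumNorm p) (piTilde a) * twist p 0 (piTilde a) := by
  have b0 := seminormBounded_evalOneConst (p := p)
  have b1 : SeminormBounded (sumNorm p) (sumNorm (sumNorm p)) (constHom (sumNorm p)) :=
    seminormBounded_const (p := sumNorm p)
  have b2 := seminormBounded_twist (p := p) 0
  have b3 := seminormBounded_twist (p := p) 1
  have c0 : ∀ x, evalOneConst p (const x) = twist p 0 (const x) := fun x =>
    (evalOneConst_const x).trans (twist_const 0 x).symm
  have c1 : ∀ x, constHom (sumNorm p) (const x) = twist p 0 (const x) := fun x =>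
    (twist_const 0 x).symm
  have c3 : ∀ x, twist p 1 (const x) = twist p 0 (const x) := fun x =>
    (twist_const 1 x).trans (twist_const 0 x).symm
  have huv : (const (wPow p 1) : RapidLaurent (sumNorm p)) * const (wPow p (-1)) = 1 := by
    change constHom (sumNorm p) _ * constHom (sumNorm p) _ = 1
    rw [← map_mul, wPow_mul]
    exact map_one _
  have hvu := (mul_comm _ _).trans huv
  -- Both `U Ũ(1)⁻¹` and `U Ũ(w')⁻¹` are summable perturbations of the identity, hence so is `Ũ(1)
  -- Ũ(w')⁻¹`.
  have tr02 := isTr_mul_sub_one_of_isTr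
    (u := map _ b2 (U (a : RapidLaurent p)))
    (u' := map _ b2 (U ((a⁻¹ : (RapidLaurent p)ˣ) : RapidLaurent p)))
    (x := map _ b2 (UT ((a⁻¹ : (RapidLaurent p)ˣ) : RapidLaurent p)))
    (y := map _ b0 (UT ((a⁻¹ : (RapidLaurent p)ˣ) : RapidLaurent p)))
    (y' := map _ b0 (UT (a : RapidLaurent p)))
    (by rw [← map_mul, U_inv_mul_U, map_one]) (by rw [← map_mul, UT_mul_UT_inv, map_one])
    (map_U_mul_UT b0 b2 c0 a) (map_U_mul_UT b2 b2 (fun _ => rfl) a)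
  rw [map_piTilde b3, map_piTilde b1, map_piTilde b2, map_piTilde b0, map_U_eq b3 b2 c3,
    map_U_eq b1 b2 c1, map_U_eq b0 b2 c0]
  exact det_mul_det_of_conj (diag_mul_diag huv) (diag_mul_diag hvu) (map_UT_inv_mul b0 a)
    (map_UT_inv_mul b1 a)
    (map_UT_eq b1 b0 huv (fun x => (c1 x).trans (c0 x).symm) (constHom_wPow 1)
      (constHom_wPow (-1)) _)
    (map_UT_eq b3 b2 huv c3 (twist_one_wPow 1) (twist_one_wPow (-1)) _)
    (map_U_mul_UT b0 b2 c0 a) (map_U_mul_UT b1 b2 c1 a) tr02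

theorem piTilde_orthogonal (a : (RapidLaurent p)ˣ) (n m : ℤ) (h : n ≠ m) :
    (piTilde a).coeff n * (piTilde a).coeff m = 0 := by
  -- Coefficient of `wⁿ w'ᵐ`: the left side contains only powers of `w w'`, so it vanishes for `n ≠
  -- m`.
  have h1 := congrArg (fun x => (x.coeff m).coeff n) (twist_piTilde_mul a)
  have h2 : evalOneConst p (piTilde a) = const (const (evalOne p (piTilde a))) := rfl
  simp only [h2, constHom_apply] at h1
  rw [mul_comm, coeff_const_mul, coeff_const_mul, coeff_const_mul, coeff_twist, coeff_twist,
    coeff_monomial, if_neg (by omega), mul_zero, mul_comm, coeff_monomial_mul, zero_mul,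
    sub_zero, mul_comm] at h1
  exact h1.symm

end BddMat

end Orthogonality

/-! ### Continuity of the projections -/

section Continuity

variable {A : Type u} [CommRing A] [TopologicalSpace A] [IsTopologicalRing A] [T2Space A]
  [SeqComplete A] {ι : Type v} {p : ι → AddGroupSeminorm A} [StrongPolymetric p]

namespace BddMat

open RapidLaurent

theorem matN_sub (ε : ℤˣ) (a b : RapidLaurent p) : matN ε (a - b) = matN ε a - matN ε b := by
  ext n m j
  have h : tail ε (a - b) (n - m) = tail ε a (n - m) - tail ε b (n - m) := by
    ext j
    simp only [coeff_tail, coeff_sub]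
    split_ifs <;> simp
  rw [Matrix.sub_apply]
  unfold matN
  rw [h, coeff_sub, coeff_sub, ← constHom_apply, ← constHom_apply, map_sub, map_sub, constHom_apply,
    constHom_apply, constHom_apply, constHom_apply]
  split_ifs
  · congr 1; ring
  · congr 1; ring
  · simp

theorem matN_one (ε : ℤˣ) : matN ε (1 : RapidLaurent p) = 0 := by
  have h : N ε (1 : RapidLaurent p) = 0 := by
    rw [← add_left_cancel_iff (a := U (1 : RapidLaurent p)), add_zero]
    exact (V_one ε).trans U_one.symm
  rw [← N_apply, h, toMat_zero]

/-- `V - U` depends additively on `a` and vanishes at `a = 1`, which brings in the factor `a - 1`.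
-/
theorem tsum_en_V_mul_U_inv_le (i : ι) (k : ℕ) : ∃ j l, ∃ C : ℝ≥0∞, C ≠ ⊤ ∧
    ∀ (ε : ℤˣ) (a : (RapidLaurent p)ˣ),
      ∑' n, ∑' m, en (sumNorm p) (i, k) ((V ε (a : RapidLaurent p) *
        U ((a⁻¹ : (RapidLaurent p)ˣ) : RapidLaurent p) - 1).toMat n m) ≤
      C * en (sumNorm p) (j, l) ((a : RapidLaurent p) - 1) *
        en (sumNorm p) (j, 0) ((a⁻¹ : (RapidLaurent p)ˣ) : RapidLaurent p) := by
  obtain ⟨⟨j, l⟩, hj, -⟩ := exists_en_mul_le (sumNorm p) (i, k)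
  refine ⟨j, l + 4, (∑' n, ∑' m, decay n m) * (2 + wt l 1), ENNReal.mul_ne_top tsum_decay_ne_top
    (ENNReal.add_ne_top.2 ⟨ENNReal.ofNat_ne_top, wt_ne_top _ _⟩), fun ε a => ?_⟩
  have hε : wt l ε = wt l 1 := by
    rcases Int.units_eq_one_or ε with rfl | rfl
    · rfl
    · exact wt_neg l 1
  rw [V_mul_U_inv_sub_one]
  refine (ENNReal.tsum_le_tsum fun n => ENNReal.tsum_le_tsum fun m =>
    en_tsum_le (sumNorm p) (i, k) _).trans ?_
  refine (tsum_tsum_en_mmul_le hj (fun n => (tsum_en_U _ j l n).le) _).trans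
    (mul_le_mul' ?_ le_rfl)
  rw [N_apply, ← sub_zero (matN ε (a : RapidLaurent p)), ← matN_one ε, ← matN_sub, mul_assoc,
    ← ENNReal.tsum_mul_right]
  refine ENNReal.tsum_le_tsum fun n => ?_
  rw [← ENNReal.tsum_mul_right, ← hε]
  exact ENNReal.tsum_le_tsum fun m => en_matN_le ε _ j l n m

variable (p) in
/-- The homomorphism `π⁺` or `π⁻` into the multiplicative monoid. -/
def piPMMonoidHom (ε : ℤˣ) : (RapidLaurent p)ˣ →* RapidLaurent p where
  toFun := piPM ε
  map_one' := piPM_one ε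
  map_mul' := piPM_mul ε

/-- For a homomorphism continuity at `1` suffices, where the estimate is `exp (C ‖a - 1‖ ‖a⁻¹‖) -
1`. Both norms are continuous in the topology of the unit group. -/
theorem continuous_piPM (ε : ℤˣ) : Continuous (piPMMonoidHom p ε) := by
  refine continuous_of_continuousAt_one _ ?_
  rw [ContinuousAt, map_one, tendsto_iff (sumNorm p)]
  rintro ⟨i, k⟩
  obtain ⟨⟨i', k'⟩, h1⟩ := exists_en_det1_sub_one_le (p := sumNorm p) (i, k)
  obtain ⟨j, l, C, hC, h2⟩ := tsum_en_V_mul_U_inv_le (p := p) i' k'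
  have hle : ∀ a : (RapidLaurent p)ˣ, sumNorm p (i, k) (piPMMonoidHom p ε a - 1) ≤
      Real.exp (C.toReal * sumNorm p (j, l) ((a : RapidLaurent p) - 1) *
        sumNorm p (j, 0) ((a⁻¹ : (RapidLaurent p)ˣ) : RapidLaurent p)) - 1 := by
    intro a
    have h3 := (h1 _ (isTr_V_mul_U_inv ε a)).trans (ENNReal.ofReal_le_ofReal (Real.exp_le_exp.2
      (ENNReal.toReal_mono (ENNReal.mul_ne_top (ENNReal.mul_ne_top hC (en_ne_top _ _ _))
        (en_ne_top _ _ _)) (h2 ε a))))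
    rw [ENNReal.toReal_mul, ENNReal.toReal_mul, toReal_en, toReal_en, en, ← ENNReal.ofReal_one,
      ← ENNReal.ofReal_add zero_le_one (apply_nonneg _ _),
      ENNReal.ofReal_le_ofReal_iff (Real.exp_pos _).le] at h3
    exact le_sub_iff_add_le'.2 h3
  refine squeeze_zero (fun a => apply_nonneg _ _) hle ?_
  have hc : Continuous fun a : (RapidLaurent p)ˣ =>
      Real.exp (C.toReal * sumNorm p (j, l) ((a : RapidLaurent p) - 1) *
        sumNorm p (j, 0) ((a⁻¹ : (RapidLaurent p)ˣ) : RapidLaurent p)) - 1 := by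
    have c1 : Continuous fun a : (RapidLaurent p)ˣ => sumNorm p (j, l) ((a : RapidLaurent p) - 1) :=
      (continuous_seminorm (sumNorm p) (j, l)).comp (Units.continuous_val.sub continuous_const)
    have c2 : Continuous fun a : (RapidLaurent p)ˣ =>
        sumNorm p (j, 0) ((a⁻¹ : (RapidLaurent p)ˣ) : RapidLaurent p) :=
      (continuous_seminorm (sumNorm p) (j, 0)).comp Units.continuous_coe_inv
    fun_prop
  have h4 := hc.tendsto 1
  simpa using h4

variable (p) in
/-- The homomorphism `π⁺` or `π⁻` into the group of units. -/
def piPMHom (ε : ℤˣ) : (RapidLaurent p)ˣ →* (RapidLaurent p)ˣ := (piPMMonoidHom p ε).toHomUnits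

theorem continuous_piPMHom (ε : ℤˣ) : Continuous (piPMHom p ε) := by
  refine Units.continuous_iff.2 ⟨continuous_piPM ε, ?_⟩
  have h : (fun a => (((piPMHom p ε a)⁻¹ : (RapidLaurent p)ˣ) : RapidLaurent p)) =
      fun a => piPMMonoidHom p ε a⁻¹ := by
    funext a
    rw [← map_inv]
    rfl
  exact h ▸ (continuous_piPM ε).comp continuous_inv

theorem piPM_coeff_zero (ε : ℤˣ) (a : (RapidLaurent p)ˣ) : (piPM ε a).coeff 0 = 1 := by
  have h := piPM_sub_one_mem ε a 0 (by simp)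
  rwa [coeff_sub, coeff_one, if_pos rfl, sub_eq_zero] at h

theorem piPM_coeff_of_neg (ε : ℤˣ) (a : (RapidLaurent p)ˣ) (n : ℤ) (hn : ε * n < 0) :
    (piPM ε a).coeff n = 0 := by
  have h := piPM_sub_one_mem ε a n hn.le
  rwa [coeff_sub, coeff_one, if_neg (by rintro rfl; simp at hn), sub_zero] at h

theorem piPMHom_mem_holomorphicGroup (a : (RapidLaurent p)ˣ) :
    piPMHom p 1 a ∈ holomorphicGroup p := by
  refine ⟨⟨piPM_coeff_zero 1 a, fun n hn => piPM_coeff_of_neg 1 a n (by simpa using hn)⟩, ?_⟩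
  rw [← map_inv]
  exact ⟨piPM_coeff_zero 1 a⁻¹, fun n hn => piPM_coeff_of_neg 1 a⁻¹ n (by simpa using hn)⟩

theorem piPMHom_mem_antiholomorphicGroup (a : (RapidLaurent p)ˣ) :
    piPMHom p (-1) a ∈ antiholomorphicGroup p := by
  refine ⟨⟨piPM_coeff_zero (-1) a, fun n hn => piPM_coeff_of_neg (-1) a n (by simpa using hn)⟩, ?_⟩
  rw [← map_inv]
  exact ⟨piPM_coeff_zero (-1) a⁻¹, fun n hn => piPM_coeff_of_neg (-1) a⁻¹ n (by simpa using hn)⟩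

/-- The orthogonal factor, as a unit. -/
def piTildeUnit (a : (RapidLaurent p)ˣ) : (RapidLaurent p)ˣ :=
  (piPMHom p 1 a)⁻¹ * (piPMHom p (-1) a)⁻¹ * a

/-- The factorization of `a` shows that `π̃(a)` is a unit depending continuously on `a`; no separate
estimate for the determinant `π̃` is needed. -/
theorem coe_piTildeUnit (a : (RapidLaurent p)ˣ) :
    ((piTildeUnit a : (RapidLaurent p)ˣ) : RapidLaurent p) = piTilde a := by
  rw [piTildeUnit, ← mul_inv, Units.val_mul, Units.inv_mul_eq_iff_eq_mul, Units.val_mul]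
  exact (piPM_mul_piTilde a).symm

theorem piTildeUnit_mem (a : (RapidLaurent p)ˣ) : piTildeUnit a ∈ orthogonalGroup p := by
  intro n m h
  rw [coe_piTildeUnit]
  exact piTilde_orthogonal a n m h

theorem continuous_piTildeUnit : Continuous (piTildeUnit (p := p)) :=
  ((continuous_piPMHom 1).inv.mul (continuous_piPMHom (-1)).inv).mul continuous_id

end BddMat

end Continuity

/-! ### Uniqueness of the factorization -/

section Injectivity

variable {A : Type u} [CommRing A] [TopologicalSpace A] [IsTopologicalRing A] [T2Space A]
  [SeqComplete A] {ι : Type v} {p : ι → AddGroupSeminorm A} [StrongPolymetric p]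

namespace RapidLaurent

theorem coeff_mul_coeff_mul_of_orthogonal {y b : RapidLaurent p}
    (hy : ∀ n m, n ≠ m → y.coeff n * y.coeff m = 0) (k n : ℤ) :
    y.coeff k * (y * b).coeff n = y.coeff k * y.coeff k * b.coeff (n - k) := by
  refine ((hasSum_coeff_mul y b n).mul_left (y.coeff k)).unique ?_
  rw [mul_assoc]
  refine hasSum_single k fun m hm => ?_
  rw [← mul_assoc, hy _ _ hm.symm, zero_mul]

/-- The constant coefficient of `yx = z⁻¹` is `1`, so orthogonality gives `y_k = y_k² x_{-k}`, which
is `0` for `k < 0`. The equation `yz = x⁻¹` treats `k > 0` in the same way. So `y` is constant, and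
comparison of constant coefficients yields `y = 1`. -/
theorem eq_one_of_mul_mul_eq_one {x y z : (RapidLaurent p)ˣ} (hx : x ∈ antiholomorphicGroup p)
    (hy : y ∈ orthogonalGroup p) (hz : z ∈ holomorphicGroup p) (h : x * y * z = 1) :
    x = 1 ∧ y = 1 ∧ z = 1 := by
  have h1 : (y : RapidLaurent p) * x = ((z⁻¹ : (RapidLaurent p)ˣ) : RapidLaurent p) := by
    rw [← Units.val_mul, mul_comm y, eq_inv_of_mul_eq_one_left h]
  have h2 : (y : RapidLaurent p) * z = ((x⁻¹ : (RapidLaurent p)ˣ) : RapidLaurent p) := by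
    rw [mul_assoc] at h
    rw [← Units.val_mul, eq_inv_of_mul_eq_one_right h]
  have y0 : ∀ k, k ≠ 0 → (y : RapidLaurent p).coeff k = 0 := by
    intro k hk
    rcases lt_or_gt_of_ne hk with hk | hk
    · have h3 := coeff_mul_coeff_mul_of_orthogonal (b := (x : RapidLaurent p)) hy k 0
      rwa [h1, hz.2.1, mul_one, hx.1.2 _ (by omega), mul_zero] at h3
    · have h3 := coeff_mul_coeff_mul_of_orthogonal (b := (z : RapidLaurent p)) hy k 0
      rwa [h2, hx.2.1, mul_one, hz.1.2 _ (by omega), mul_zero] at h3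
  have yc : (y : RapidLaurent p) = const ((y : RapidLaurent p).coeff 0) := by
    ext k
    rw [coeff_const]
    split_ifs with hk
    · rw [hk]
    · exact y0 k hk
  have y1 : y = 1 := by
    have h3 := congrArg (fun a => a.coeff 0) h1
    rw [yc, coeff_const_mul, hx.1.1, hz.2.1, mul_one] at h3
    refine Units.ext ?_
    rw [yc, h3]
    rfl
  subst y1
  rw [Units.val_one, one_mul] at h1
  -- Now `x = z⁻¹` is both holomorphic and antiholomorphic, with constant coefficient `1`.
  have x1 : x = 1 := by
    refine Units.ext ?_
    ext k
    rw [Units.val_one, coeff_one]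
    split_ifs with hk
    · rw [hk, hx.1.1]
    · rcases lt_or_gt_of_ne hk with hk | hk
      · rw [h1, hz.2.2 k hk]
      · exact hx.1.2 k hk
  subst x1
  exact ⟨rfl, rfl, by simpa using h⟩

end RapidLaurent

end Injectivity

/-! ### Formal conjugation in `t` and the substitution `t = 1` -/

section Conjugation

variable {A : Type u} [CommRing A] [TopologicalSpace A] [IsTopologicalRing A] [T2Space A]
  [SeqComplete A] {ι : Type v} {p : ι → AddGroupSeminorm A} [StrongPolymetric p]

theorem hasSum_of_single {M β : Type*} [AddCommMonoid M] [TopologicalSpace M] {f : β → M} {x : M}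
    (b : β) (e : f b = x) (h : ∀ b' ≠ b, f b' = 0) : HasSum f x :=
  e ▸ hasSum_single b h

theorem _root_.HasSum.trans_eq {M β : Type*} [AddCommMonoid M] [TopologicalSpace M] {f : β → M}
    {x y : M} (h : HasSum f x) (e : x = y) : HasSum f y := e ▸ h

namespace RapidLaurent

theorem hasSum_monomial (a : RapidLaurent p) :
    HasSum (fun j : ℤ => (monomial j (a.coeff j) : RapidLaurent p)) a := by
  have hs : Summable fun j : ℤ => (monomial j (a.coeff j) : RapidLaurent p) := by
    refine summable_of_en (sumNorm p) ?_
    rintro ⟨i, k⟩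
    simp only [en_sumNorm_monomial]
    rw [← en_sumNorm]
    exact en_ne_top _ _ _
  convert hs.hasSum
  ext n
  have h := hs.hasSum.map (coeffHom n) (continuous_coeff n)
  refine HasSum.unique (hasSum_of_single n ?_ fun j hj => ?_) h
  · change (monomial n (a.coeff n) : RapidLaurent p).coeff n = _
    rw [coeff_monomial, if_pos rfl]
  · change (monomial j (a.coeff j) : RapidLaurent p).coeff n = 0
    rw [coeff_monomial, if_neg hj.symm]

theorem hasSum_tail (ε : ℤˣ) (a : RapidLaurent p) (r : ℤ) :
    HasSum (fun d : ℕ => const (a.coeff (r + ε * d)) * wPow p (ε * d)) (tail ε a r) := by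
  have hi : Function.Injective fun d : ℕ => (ε : ℤ) * d := fun d e h => by simpa using h
  refine ((hi.hasSum_iff fun j hj => ?_).2 (hasSum_monomial (tail ε a r))).congr_fun fun d => ?_
  · rw [coeff_tail, if_neg, monomial_zero]
    intro h
    refine hj ⟨((ε : ℤ) * j).toNat, ?_⟩
    simp only [Int.toNat_of_nonneg h]
    rcases Int.units_eq_one_or ε with rfl | rfl <;> simp
  · rw [const, wPow, monomial_mul_monomial, zero_add, mul_one, Function.comp, coeff_tail, if_pos]
    rcases Int.units_eq_one_or ε with rfl | rfl <;> simp

end RapidLaurent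

open RapidLaurent

variable (p) in
/-- The matrix `F⁺(t, w)`, respectively `F⁻(t, w)`. -/
def matF (ε : ℤˣ) : Matrix ℤ ℤ (PowerSeries (RapidLaurent p)) := fun n m =>
  (if n = m then 1 else 0) -
    if ε * n < 0 ∧ m = n + ε then PowerSeries.monomial 1 (wPow p ε) else 0

theorem X_mul_C_eq_monomial (x : RapidLaurent p) :
    PowerSeries.X * PowerSeries.C x = PowerSeries.monomial 1 x := by
  rw [PowerSeries.X_eq, ← PowerSeries.monomial_zero_eq_C_apply, PowerSeries.monomial_mul_monomial,
    one_mul]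

theorem matFPlus_eq : matFPlus p = matF p 1 := by
  ext1 n m
  simp only [matFPlus, matF, X_mul_C_eq_monomial, Units.val_one, one_mul]
  rfl

theorem matFMinus_eq : matFMinus p = matF p (-1) := by
  ext1 n m
  simp only [matFMinus, matF, X_mul_C_eq_monomial, Units.val_one, Units.val_neg, neg_mul, one_mul,
    neg_lt_zero]
  rfl

variable (p) in
/-- The inverse of `F⁺(t, w)`, respectively `F⁻(t, w)`. -/
def matFInv (ε : ℤˣ) : Matrix ℤ ℤ (PowerSeries (RapidLaurent p)) := fun n m =>
  if ε * m ≤ 0 then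
    if 0 ≤ ε * (m - n) then PowerSeries.monomial (m - n).natAbs (wPow p (m - n)) else 0
  else if n = m then 1 else 0

theorem hasSum_matF_mul (ε : ℤˣ) (G : ℤ → PowerSeries (RapidLaurent p)) (n : ℤ) :
    HasSum (fun l => matF p ε n l * G l)
      (G n - if ε * n < 0 then PowerSeries.monomial 1 (wPow p ε) * G (n + ε) else 0) := by
  simp only [matF, sub_mul]
  refine HasSum.sub ?_ ?_
  · exact hasSum_of_single n (by simp) fun l hl => by simp [hl.symm]
  · exact hasSum_of_single (n + ε) (by simp) fun l hl => by simp [hl]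

theorem hasSum_mul_matF (ε : ℤˣ) (G : ℤ → PowerSeries (RapidLaurent p)) (m : ℤ) :
    HasSum (fun l => G l * matF p ε l m)
      (G m - if ε * m ≤ 0 then G (m - ε) * PowerSeries.monomial 1 (wPow p ε) else 0) := by
  simp only [matF, mul_sub]
  refine HasSum.sub ?_ ?_
  · exact hasSum_of_single m (by simp) fun l hl => by simp [hl]
  · refine hasSum_of_single (m - ε) ?_ fun l hl => ?_
    · have h : (ε : ℤ) * (m - ε) < 0 ↔ ε * m ≤ 0 := by
        rcases Int.units_eq_one_or ε with rfl | rfl <;>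
        simp only [Units.val_one, Units.val_neg, one_mul, neg_mul] <;> omega
      simp [h]
    · rw [if_neg (by omega), mul_zero]

theorem monomial_wPow_mul (k l : ℕ) (i j : ℤ) :
    PowerSeries.monomial k (wPow p i) * PowerSeries.monomial l (wPow p j) =
      PowerSeries.monomial (k + l) (wPow p (i + j)) := by
  rw [PowerSeries.monomial_mul_monomial, wPow_mul]

/-- Over power series in `t` the inverse is the geometric series of `t w^ε ∑ e_{n,n+ε}`; its paths
stop at index `0`, so only columns with `ε m ≤ 0` differ from the identity. -/
theorem isMatInverse_matF (ε : ℤˣ) : IsMatInverse (matF p ε) (matFInv p ε) := by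
  have h1 : PowerSeries.monomial 0 (wPow p 0) = 1 := by
    rw [wPow_zero, PowerSeries.monomial_zero_eq_C_apply, map_one]
  constructor <;> intro n m
  · refine (hasSum_matF_mul ε (fun l => matFInv p ε l m) n).trans_eq ?_
    rw [Matrix.one_apply]
    unfold matFInv
    simp only [mul_ite, monomial_wPow_mul, mul_zero, mul_one]
    by_cases hnm : n = m
    · subst hnm
      simp only [sub_self, Int.natAbs_zero, h1, mul_zero, le_refl, if_true]
      rcases Int.units_eq_one_or ε with rfl | rfl <;>
      simp only [Units.val_one, Units.val_neg, one_mul, neg_mul] <;>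
      split_ifs <;> first | omega | simp
    · rw [if_neg hnm]
      rcases Int.units_eq_one_or ε with rfl | rfl <;>
      simp only [Units.val_one, Units.val_neg, one_mul, neg_mul] <;>
      split_ifs <;> first | omega | simp | skip
      all_goals
        rw [sub_eq_zero]
        congr 2 <;> omega
  · refine (hasSum_mul_matF ε (fun l => matFInv p ε n l) m).trans_eq ?_
    rw [Matrix.one_apply]
    unfold matFInv
    simp only [ite_mul, monomial_wPow_mul, zero_mul, one_mul]
    by_cases hnm : n = m
    · subst hnm
      simp only [sub_self, Int.natAbs_zero, h1, mul_zero, le_refl, if_true]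
      rcases Int.units_eq_one_or ε with rfl | rfl <;>
      simp only [Units.val_one, Units.val_neg, one_mul, neg_mul] <;>
      split_ifs <;> first | omega | simp
    · rw [if_neg hnm]
      rcases Int.units_eq_one_or ε with rfl | rfl <;>
      simp only [Units.val_one, Units.val_neg, one_mul, neg_mul] <;>
      split_ifs <;> first | omega | simp | skip
      all_goals
        rw [sub_eq_zero]
        congr 2 <;> omega

/-- The product of a row of constants with the `m`-th column of the inverse of `F`. -/
def mulMatFInv (ε : ℤˣ) (G : ℤ → RapidLaurent p) (m : ℤ) : PowerSeries (RapidLaurent p) :=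
  PowerSeries.mk fun d => if ε * m ≤ 0 then G (m - ε * d) * wPow p (ε * d)
    else if d = 0 then G m else 0

/-- Convergence of power series is coefficientwise, and each power of `t` receives at most one term.
-/
theorem hasSum_mul_matFInv (ε : ℤˣ) (G : ℤ → RapidLaurent p) (m : ℤ) :
    HasSum (fun l => PowerSeries.C (G l) * matFInv p ε l m) (mulMatFInv ε G m) := by
  rw [PowerSeries.WithPiTopology.hasSum_iff_hasSum_coeff]
  intro d
  rw [mulMatFInv, PowerSeries.coeff_mk]
  simp only [PowerSeries.coeff_C_mul, matFInv]
  by_cases hm : ε * m ≤ 0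
  · simp only [hm, if_true]
    refine hasSum_of_single (m - ε * d) ?_ fun l hl => ?_
    · rw [sub_sub_cancel, if_pos, PowerSeries.coeff_monomial, if_pos]
      · rcases Int.units_eq_one_or ε with rfl | rfl <;> simp
      · rcases Int.units_eq_one_or ε with rfl | rfl <;> simp
    · split_ifs with h
      · rw [PowerSeries.coeff_monomial, if_neg, mul_zero]
        rintro rfl
        apply hl
        rcases Int.units_eq_one_or ε with rfl | rfl <;>
        simp only [Units.val_one, Units.val_neg, one_mul, neg_mul] at h ⊢ <;> omega
      · rw [map_zero, mul_zero]
  · simp only [hm, if_false]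
    refine hasSum_of_single m ?_ fun l hl => ?_
    · rw [if_pos rfl, PowerSeries.coeff_one]
      simp
    · rw [if_neg hl, map_zero, mul_zero]

/-- At `t = 1` the column sums become the tails of `a`; this is where the rapid decay of the
coefficients makes the substitution legitimate. -/
theorem hasSum_coeff_mulMatFInv (ε : ℤˣ) (a : RapidLaurent p) (r m : ℤ) :
    HasSum (fun d => PowerSeries.coeff d (mulMatFInv ε (fun l => const (a.coeff (r - l))) m))
      (if ε * m ≤ 0 then tail ε a (r - m) else const (a.coeff (r - m))) := by
  simp only [mulMatFInv, PowerSeries.coeff_mk]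
  split_ifs
  · convert hasSum_tail ε a (r - m) using 5
    ring
  · refine hasSum_of_single 0 ?_ fun d hd => ?_
    · simp
    · simp [hd]

theorem hasSum_coeff_monomial_one_mul {f : PowerSeries (RapidLaurent p)} {s : RapidLaurent p}
    (hf : HasSum (fun d => PowerSeries.coeff d f) s) (x : RapidLaurent p) :
    HasSum (fun d => PowerSeries.coeff d (PowerSeries.monomial 1 x * f)) (x * s) := by
  rw [← hasSum_nat_add_iff' 1]
  simp only [← X_mul_C_eq_monomial, mul_assoc, PowerSeries.coeff_succ_X_mul,
    PowerSeries.coeff_C_mul, Finset.sum_range_one, PowerSeries.coeff_zero_X_mul, sub_zero]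
  exact hf.mul_left x

namespace BddMat

/-- In the rows with `ε n < 0`, left multiplication by `F` subtracts `w^ε` times the next tail, and
`tail_eq` leaves one coefficient. This identifies the explicit matrix `V`. -/
theorem isConjAtOne_V (ε : ℤˣ) (a : RapidLaurent p) :
    IsConjAtOne (matF p ε) a (V ε a).toMat := by
  let y : PowerSeries (RapidLaurent p) := PowerSeries.monomial 1 (wPow p ε)
  let G : ℤ → ℤ → RapidLaurent p := fun r l => const (a.coeff (r - l))
  refine ⟨matFInv p ε,
    fun n m => PowerSeries.C (G n m) - if ε * n < 0 then y * PowerSeries.C (G (n + ε) m) else 0,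
    fun n m => mulMatFInv ε (G n) m - if ε * n < 0 then y * mulMatFInv ε (G (n + ε)) m else 0,
    isMatInverse_matF ε, fun n m => hasSum_matF_mul ε (fun l => PowerSeries.C (G l m)) n,
    fun n m => ?_, fun n m => ?_⟩
  · simp only [sub_mul, ite_mul, zero_mul]
    refine (hasSum_mul_matFInv ε (G n) m).sub ?_
    split_ifs
    · simp only [mul_assoc]
      exact (hasSum_mul_matFInv ε (G (n + ε)) m).mul_left y
    · exact hasSum_zero
  · simp only [map_sub]
    have e : (V ε a).toMat n m = (if ε * m ≤ 0 then tail ε a (n - m) else const (a.coeff (n - m))) -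
        if ε * n < 0 then wPow p ε * (if ε * m ≤ 0 then tail ε a (n + ε - m)
          else const (a.coeff (n + ε - m))) else 0 := by
      rw [V_apply]
      by_cases hn : ε * n < 0
      · by_cases hm : ε * m ≤ 0
        · rw [if_neg (by omega), if_neg (by omega), if_pos hm, if_pos hn, if_pos hm, tail_eq,
            show n - m + ε = n + ε - m by ring]
          ring
        · rw [if_neg (by omega), if_pos (by omega), if_neg hm, if_pos hn, if_neg hm]
      · by_cases hm : ε * m ≤ 0
        · rw [if_pos (by omega), if_pos hm, if_neg hn, sub_zero]
        · rw [if_neg (by omega), if_neg (by omega), if_neg hm, if_neg hn, sub_zero]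
    rw [e]
    refine (hasSum_coeff_mulMatFInv ε a n m).sub ?_
    by_cases hn : ε * n < 0
    · simp only [if_pos hn]
      exact hasSum_coeff_monomial_one_mul (hasSum_coeff_mulMatFInv ε a (n + ε) m) _
    · simp only [if_neg hn, map_zero]
      exact hasSum_zero

theorem isMatInverse_toMat {X Y : BddMat p} (h1 : X * Y = 1) (h2 : Y * X = 1) :
    IsMatInverse X.toMat Y.toMat :=
  ⟨fun n m => by simpa only [h1, toMat_one] using hasSum_mul X Y n m,
    fun n m => by simpa only [h2, toMat_one] using hasSum_mul Y X n m⟩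

theorem U_toMat (a : RapidLaurent p) : (U a).toMat = matU a := rfl

theorem isConjDet_piPM (ε : ℤˣ) (a : (RapidLaurent p)ˣ) : IsConjDet (matF p ε) a (piPM ε a) := by
  rw [IsConjDet, ← U_toMat, ← U_toMat]
  exact ⟨isMatInverse_toMat (U_mul_U_inv a) (U_inv_mul_U a), (V ε (a : RapidLaurent p)).toMat,
    (V ε (a : RapidLaurent p) * U ((a⁻¹ : (RapidLaurent p)ˣ) : RapidLaurent p)).toMat,
    isConjAtOne_V ε (a : RapidLaurent p), hasSum_mul (V ε (a : RapidLaurent p)) (U _),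
    hasDet (isTr_V_mul_U_inv ε a)⟩

theorem isPiTilde_piTilde (a : (RapidLaurent p)ˣ) : IsPiTilde a (piTilde a) := by
  rw [IsPiTilde, ← UT_toMat, ← UT_toMat]
  exact ⟨isMatInverse_toMat (UT_mul_UT_inv a) (UT_inv_mul_UT a),
    (U (a : RapidLaurent p) * UT ((a⁻¹ : (RapidLaurent p)ˣ) : RapidLaurent p)).toMat,
    hasSum_mul (U (a : RapidLaurent p)) (UT _), hasDet (isTr_U_mul_UT_inv a)⟩

end BddMat

end Conjugation

/-! ### The direct product decomposition -/

section Decomposition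

variable {A : Type u} [CommRing A] [TopologicalSpace A] [IsTopologicalRing A] [T2Space A]
  [SeqComplete A] {ι : Type v} (p : ι → AddGroupSeminorm A) [StrongPolymetric p]

open BddMat RapidLaurent

/-- The multiplication map `G⁻ × G̃ × G⁺ → G`. -/
def mulHom : (antiholomorphicGroup p × orthogonalGroup p × holomorphicGroup p) →*
    (RapidLaurent p)ˣ where
  toFun x := (x.1 : (RapidLaurent p)ˣ) * (x.2.1 : (RapidLaurent p)ˣ) * (x.2.2 : (RapidLaurent p)ˣ)
  map_one' := by simp
  map_mul' x y := by
    simp only [Prod.fst_mul, Prod.snd_mul, Subgroup.coe_mul]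
    rw [mul_mul_mul_comm (x.1 : (RapidLaurent p)ˣ), mul_mul_mul_comm]

theorem mulHom_injective : Function.Injective (mulHom p) := by
  refine (injective_iff_map_eq_one _).2 fun x hx => ?_
  obtain ⟨h1, h2, h3⟩ := eq_one_of_mul_mul_eq_one x.1.2 x.2.1.2 x.2.2.2 hx
  exact Prod.ext (Subtype.ext h1) (Prod.ext (Subtype.ext h2) (Subtype.ext h3))

/-- The components of a unit in `G⁻`, `G̃` and `G⁺`. -/
def components (a : (RapidLaurent p)ˣ) :
    antiholomorphicGroup p × orthogonalGroup p × holomorphicGroup p :=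
  (⟨piPMHom p (-1) a, piPMHom_mem_antiholomorphicGroup a⟩, ⟨piTildeUnit a, piTildeUnit_mem a⟩,
    ⟨piPMHom p 1 a, piPMHom_mem_holomorphicGroup a⟩)

theorem mulHom_components (a : (RapidLaurent p)ˣ) : mulHom p (components p a) = a := by
  change piPMHom p (-1) a * ((piPMHom p 1 a)⁻¹ * (piPMHom p (-1) a)⁻¹ * a) * piPMHom p 1 a = a
  rw [mul_comm (piPMHom p 1 a)⁻¹, mul_assoc (piPMHom p (-1) a)⁻¹, mul_inv_cancel_left, mul_comm,
    mul_inv_cancel_left]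

theorem continuous_components : Continuous (components p) :=
  ((continuous_piPMHom (-1)).subtype_mk _).prodMk
    ((continuous_piTildeUnit.subtype_mk _).prodMk ((continuous_piPMHom 1).subtype_mk _))

/-- The group of units is the inner direct product `G⁻ × G̃ × G⁺`, as a topological group. -/
def decomposition : (antiholomorphicGroup p × orthogonalGroup p × holomorphicGroup p) ≃ₜ*
    (RapidLaurent p)ˣ where
  toFun := mulHom p
  invFun := components p
  left_inv x := mulHom_injective p (mulHom_components p _)
  right_inv a := mulHom_components p a
  map_mul' := map_mul (mulHom p)
  continuous_toFun := by
    change Continuous fun x : antiholomorphicGroup p × orthogonalGroup p × holomorphicGroup p =>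
      (x.1 : (RapidLaurent p)ˣ) * (x.2.1 : (RapidLaurent p)ˣ) * (x.2.2 : (RapidLaurent p)ˣ)
    fun_prop
  continuous_invFun := continuous_components p

end Decomposition

end Polymetric

end

theorem theorem1 {A : Type*} [CommRing A] [TopologicalSpace A] [IsTopologicalRing A] [T2Space A]
    [SeqComplete A] {ι : Type*} (p : ι → AddGroupSeminorm A) [StrongPolymetric p] :
    ∃ φ : (antiholomorphicGroup p × orthogonalGroup p × holomorphicGroup p) ≃ₜ*
        (RapidLaurent p)ˣ,
      (∀ x, φ x = (x.1 : (RapidLaurent p)ˣ) * (x.2.1 : (RapidLaurent p)ˣ) *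
        (x.2.2 : (RapidLaurent p)ˣ)) ∧
      ∀ a : (RapidLaurent p)ˣ,
        IsPiMinus a ((φ.symm a).1 : (RapidLaurent p)ˣ) ∧
        IsPiTilde a ((φ.symm a).2.1 : (RapidLaurent p)ˣ) ∧
        IsPiPlus a ((φ.symm a).2.2 : (RapidLaurent p)ˣ) := by
  refine ⟨decomposition p, fun _ => rfl, fun a => ⟨?_, ?_, ?_⟩⟩
  · rw [IsPiMinus, matFMinus_eq]
    exact BddMat.isConjDet_piPM (-1) a
  · change IsPiTilde a ((BddMat.piTildeUnit a : (RapidLaurent p)ˣ) : RapidLaurent p)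
    rw [BddMat.coe_piTildeUnit]
    exact BddMat.isPiTilde_piTilde a
  · rw [IsPiPlus, matFPlus_eq]
    exact BddMat.isConjDet_piPM 1 a
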